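/- Let $\wp$ be the Weierstrass function of a period lattice in $\mathbb{C}$, let $e_1,e_2,e_3$ be the branch points of its curve $z^2=4(Z-e_1)(Z-e_2)(Z-e_3)$, and put $e=e_1$, $g=(e_1-e_2)(e_1-e_3)\neq0$ with a fixed choice of $\sqrt g$. For $\kappa\in\mathbb{C}$ let $K=\wp(\kappa)-e$, $k=\frac12\frac{\wp'(\kappa)}{\wp(\kappa)-e}$, $k^2=K+3e+\frac gK$, and, for $n\in\mathbb{Z}$ and $x=(x_1,x_2,\dots)$, let $\rho_n(\kappa)=\exp\Big\{\sum_{j\ge0}k^{2j+1}x_{2j+1}+\sum_{j\ge1}\Big[K^j-\Big(\frac gK\Big)^j\Big]x_{2j}\Big\}\Big(\frac{K}{\sqrt g}\Big)^n$ and $\Omega(\kappa,\kappa')=\frac{K-K'}{k+k'}=\frac{k-k'}{1-\frac{g}{KK'}}$. Let $d\zeta(\kappa,\kappa')$ be a complex measure with $d\zeta(\kappa,\kappa')=-d\zeta(\kappa',\kappa)$, carried by $S\times S$, where $S\subset\mathbb{C}$ is a set on which $k$, $K$, $g/K$ are defined and bounded and on which $\Omega$ is defined and bounded ($K\ne0$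 on $S$, and no pole of $\wp$ or of $\Omega$ is met). Let $x$ range over the complex sequences with $\sum_j|x_j|R^j<\infty$ for some $R$ with $|k|\le R$, $|K|\le R^2$, $|g/K|\le R^2$ on $S$. Let $\boldsymbol{c}(\kappa)=(\kappa^i)_{i\in\mathbb{Z}}$, $\boldsymbol{C}_n=\iint d\zeta(\kappa,\kappa')\,\rho_n(\kappa)\boldsymbol{c}(\kappa)\,{}^{t}\boldsymbol{c}(\kappa')\rho_n(\kappa')$, and let the infinite matrix $\boldsymbol{\Omega}$ be defined by ${}^{t}\boldsymbol{c}(\kappa')\boldsymbol{\Omega}\boldsymbol{c}(\kappa)=\Omega(\kappa,\kappa')$. The determinant $\det(1+\boldsymbol{\Omega}\boldsymbol{C}_n)$ is understood as its formal expansion $\sum_{m\ge0}d_m$, $d_m$ being the sum of the principal $m\times m$ minors of $\boldsymbol{\Omega}\boldsymbol{C}_n$, i.e. $d_m=\frac1{m!}\int\!\cdots\!\int\det\big[\Omega(\kappa_b,\kappa_a')\big]_{a,b=1}^m\prod_{a=1}^m\rho_n(\kappa_a)\rho_n(\kappa'_a)\,d\zeta(\kappa_a,\kappa'_a)$, and this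 integral defines $d_m$ also when $\Omega$ has no convergent expansion in monomials. The $\tau$-function $\tau_n$ is the value at $\varepsilon=1$ of the entire function of $\varepsilon$ that equals $1$ at $\varepsilon=0$ and has square $\sum_m\varepsilon^md_m$. Then: (i) if $\boldsymbol{\Omega}$ satisfies ${}^{t}\boldsymbol{c}(\kappa')\boldsymbol{\Omega}\boldsymbol{c}(\kappa)=\Omega(\kappa,\kappa')$ on $S\times S$ with a normally convergent double series, the principal $m\times m$ minors of $\boldsymbol{\Omega}\boldsymbol{C}_n$ have the sum $d_m$, for every $m$; (ii) $\tau_n(x)$ exists, is unique, and is holomorphic in $(x_1,x_2,x_3)$; (iii) for all $n\in\mathbb{Z}$ and all such $x$ it satisfies $\left(\mathrm{D}_1^4-4\mathrm{D}_1\mathrm{D}_3+3\mathrm{D}_2^2\right)\tau_n\cdot\tau_n=24g\left(\tau_{n+1}\tau_{n-1}-\tau_n^2\right)$, $\left(\mathrm{D}_1^3+2\mathrm{D}_3-3\mathrm{D}_1\mathrm{D}_2-18e\mathrm{D}_1\right)\tau_{n+1}\cdot\tau_n=0$, $\left(\mathrm{D}_1^3+2\mathrm{D}_3+3\mathrm{D}_1\mathrm{D}_2-18e\mathrm{D}_1\right)\tau_{n-1}\cdot\tau_n=0$,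 where $P(\mathrm{D})F\cdot G$ is $P\big(\tfrac{\partial}{\partial x_j}-\tfrac{\partial}{\partial x'_j}\big)F(x)G(x')$ at $x'=x$. -/

import Mathlib

open MeasureTheory

/-- The elliptic curve `k² = K + 3e + g/K`, `e = e₁`, `g = (e₁ - e₂)(e₁ - e₃) ≠ 0`, where
`e₁, e₂, e₃` are the branch points of `z² = 4Z³ - g₂Z - g₃ = 4(Z - e₁)(Z - e₂)(Z - e₃)`, the
Weierstrass curve of a period lattice, together with a choice of the square root of `g`. -/
structure EllCurve where
  L : PeriodPair
  e₁ : ℂ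
  e₂ : ℂ
  e₃ : ℂ
  branch : ∀ Z : ℂ, 4 * Z ^ 3 - L.g₂ * Z - L.g₃ = 4 * (Z - e₁) * (Z - e₂) * (Z - e₃)
  sqrtg : ℂ
  sqrtg_sq : sqrtg ^ 2 = (e₁ - e₂) * (e₁ - e₃)
  g_ne_zero : (e₁ - e₂) * (e₁ - e₃) ≠ 0

namespace EllCurve

/-- The modulus `e`. -/
def e (E : EllCurve) : ℂ := E.e₁

/-- The modulus `g`. -/
def g (E : EllCurve) : ℂ := (E.e₁ - E.e₂) * (E.e₁ - E.e₃)

/-- The coordinate `K = ℘(κ) - e`. -/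
noncomputable def K (E : EllCurve) (κ : ℂ) : ℂ := E.L.weierstrassP κ - E.e

/-- The coordinate `k = ℘'(κ) / (2 (℘(κ) - e))`. -/
noncomputable def k (E : EllCurve) (κ : ℂ) : ℂ :=
  1 / 2 * (E.L.derivWeierstrassP κ / (E.L.weierstrassP κ - E.e))

/-- The symbol of the flow `x_j`: `k^j` for odd `j`, and `K^i - (g/K)^i` for `j = 2i`. -/
noncomputable def symbol (E : EllCurve) (κ : ℂ) (j : ℕ+) : ℂ :=
  if Odd (j : ℕ) then E.k κ ^ (j : ℕ)
  else E.K κ ^ ((j : ℕ) / 2) - (E.g / E.K κ) ^ ((j : ℕ) / 2)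

/-- The plane wave factor `ρ_n(κ)` at the point `x = (x₁, x₂, …)`. -/
noncomputable def rho (E : EllCurve) (n : ℤ) (x : ℕ+ → ℂ) (κ : ℂ) : ℂ :=
  Complex.exp (∑' j : ℕ+, E.symbol κ j * x j) * (E.K κ / E.sqrtg) ^ n

open Classical in
/-- The Cauchy kernel `Ω(κ, κ') = (K - K') / (k + k') = (k - k') / (1 - g / (K K'))`. The two
quotients agree where both denominators are nonzero; the second one gives the value of the
(meromorphic) kernel at the points where the first one is `0/0`. -/
noncomputable def kernel (E : EllCurve) (κ κ' : ℂ) : ℂ :=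
  if E.k κ + E.k κ' ≠ 0 then (E.K κ - E.K κ') / (E.k κ + E.k κ')
  else (E.k κ - E.k κ') / (1 - E.g / (E.K κ * E.K κ'))

end EllCurve

/-- A complex measure `dζ = θ dμ` on `ℂ × ℂ` with `dζ(κ, κ') = -dζ(κ', κ)`, carried by `S × S`
for a set `S` of spectral parameters on which `k`, `K`, `g/K` and the kernel `Ω` are
defined and bounded. An integral over a domain `D ⊆ S × S` is the case where `μ` is replaced by its
restriction to `D`. -/
structure SkewMeasure (E : EllCurve) where
  μ : Measure (ℂ × ℂ)
  sigmaFinite : SigmaFinite μ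
  θ : ℂ × ℂ → ℂ
  integrable : Integrable θ μ
  skew : ∀ A : Set (ℂ × ℂ), MeasurableSet A →
    ∫ p in Prod.swap ⁻¹' A, θ p ∂μ = -∫ p in A, θ p ∂μ
  S : Set ℂ
  carried : ∀ᵐ p ∂μ, p.1 ∈ S ∧ p.2 ∈ S
  not_pole : ∀ κ ∈ S, κ ∉ E.L.lattice ∧ E.K κ ≠ 0
  bounded : ∃ R : ℝ, ∀ κ ∈ S, ‖E.k κ‖ ≤ R ∧ ‖E.K κ‖ ≤ R ^ 2 ∧ ‖E.g / E.K κ‖ ≤ R ^ 2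
  kernel_not_pole : ∀ κ ∈ S, ∀ κ' ∈ S, E.k κ + E.k κ' ≠ 0 ∨ E.K κ * E.K κ' ≠ E.g
  kernel_bounded : ∃ B : ℝ, ∀ κ ∈ S, ∀ κ' ∈ S, ‖E.kernel κ κ'‖ ≤ B

namespace SkewMeasure

variable {E : EllCurve}

/-- The admissible times: those sequences `x = (x₁, x₂, …)` for which the series in the exponent of
the plane wave factor is dominated on `S` by a convergent series `∑ |x_j| R^j` (up to a factor). All
finitely supported sequences are admissible. -/
def times (ζ : SkewMeasure E) : Set (ℕ+ → ℂ) :=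
  {x | ∃ R : ℝ,
    (∀ κ ∈ ζ.S, ‖E.k κ‖ ≤ R ∧ ‖E.K κ‖ ≤ R ^ 2 ∧ ‖E.g / E.K κ‖ ≤ R ^ 2) ∧
    Summable fun j : ℕ+ => ‖x j‖ * R ^ (j : ℕ)}

/-- The infinite matrix `C_n = ∬ dζ(κ, κ') ρ_n(κ) c(κ) ᵗc(κ') ρ_n(κ')`, `c(κ) = (κ^i)_{i ∈ ℤ}`. -/
noncomputable def C (ζ : SkewMeasure E) (n : ℤ) (x : ℕ+ → ℂ) : Matrix ℤ ℤ ℂ :=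
  Matrix.of fun i j =>
    ∫ p, ζ.θ p * (E.rho n x p.1 * p.1 ^ i * (p.2 ^ j * E.rho n x p.2)) ∂ζ.μ

/-- `Ω` is an infinite matrix representing the Cauchy kernel on `S`, i.e.
`ᵗc(κ') Ω c(κ) = Ω(κ, κ')`, with a normally convergent double series. -/
def IsKernelMatrix (ζ : SkewMeasure E) (Ω : Matrix ℤ ℤ ℂ) : Prop :=
  (∃ b : ℤ × ℤ → ℝ, Summable b ∧
    ∀ κ ∈ ζ.S, ∀ κ' ∈ ζ.S, ∀ p : ℤ × ℤ, ‖κ' ^ p.1 * Ω p.1 p.2 * κ ^ p.2‖ ≤ b p) ∧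
  ∀ κ ∈ ζ.S, ∀ κ' ∈ ζ.S,
    HasSum (fun p : ℤ × ℤ => κ' ^ p.1 * Ω p.1 p.2 * κ ^ p.2) (E.kernel κ κ')

/-- The term of degree `m` of the formal expansion of `det(1 + ΩC_n)`, evaluated by means of
`ᵗc(κ') Ω c(κ) = Ω(κ, κ')`:
`(1/m!) ∫ ⋯ ∫ det[Ω(κ_b, κ'_a)]_{a,b=1}^m ∏_a ρ_n(κ_a) ρ_n(κ'_a) dζ(κ_a, κ'_a)`.
It makes sense whether or not the kernel has a convergent expansion in the monomials `c(κ)`. -/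
noncomputable def detTerm (ζ : SkewMeasure E) (n : ℤ) (x : ℕ+ → ℂ) (m : ℕ) : ℂ :=
  haveI := ζ.sigmaFinite
  (1 / (m.factorial : ℂ)) *
    ∫ p : Fin m → ℂ × ℂ,
      (∏ a, ζ.θ (p a) * (E.rho n x (p a).1 * E.rho n x (p a).2)) *
        (Matrix.of fun a b : Fin m => E.kernel (p b).1 (p a).2).det
      ∂(Measure.pi fun _ => ζ.μ)

/-- `τ` is the `τ`-function: `τ_n² = det(1 + ΩC_n)`, with the root normalised as
`τ_n = 1 + perturbation`. The latter means that, when `ζ` is replaced by `ε ζ` (so that `C_n`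
becomes `ε C_n`), there is a root of `det(1 + ε Ω C_n)` which is an entire function of `ε` with value
`1` at `ε = 0`; the `τ`-function is the value of this root at `ε = 1`. -/
def IsTau (ζ : SkewMeasure E) (τ : ℤ → (ℕ+ → ℂ) → ℂ) : Prop :=
  ∀ n : ℤ, ∀ x ∈ ζ.times, ∃ f : ℂ → ℂ,
    Differentiable ℂ f ∧ f 0 = 1 ∧
    (∀ ε : ℂ, HasSum (fun m : ℕ => ε ^ m * ζ.detTerm n x m) (f ε ^ 2)) ∧
    τ n x = f 1

end SkewMeasure

/-- The product of infinite matrices. -/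
noncomputable def infMul (A B : Matrix ℤ ℤ ℂ) : Matrix ℤ ℤ ℂ :=
  Matrix.of fun i j => ∑' l : ℤ, A i l * B l j

/-- The principal minor of an infinite matrix on a finite set of indices. -/
def principalMinor (A : Matrix ℤ ℤ ℂ) (s : Finset ℤ) : ℂ :=
  (Matrix.of fun a b : s => A a b).det

/-- The partial derivative `∂_j F` at `x`. -/
noncomputable def partialDeriv (j : ℕ+) (F : (ℕ+ → ℂ) → ℂ) (x : ℕ+ → ℂ) : ℂ :=
  deriv (fun t : ℂ => F (Function.update x j t)) (x j)

/-- The operator `∂/∂x_j - ∂/∂x'_j` on functions of two points `x`, `x'`. -/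
noncomputable def hirotaD (j : ℕ+) (H : (ℕ+ → ℂ) → (ℕ+ → ℂ) → ℂ) :
    (ℕ+ → ℂ) → (ℕ+ → ℂ) → ℂ :=
  fun x x' => partialDeriv j (fun y => H y x') x - partialDeriv j (fun y' => H x y') x'

/-- The function `F(x) G(x')` of two points, to which Hirota operators are applied. A bilinear
derivative `P(D) F·G` is `P(D)` applied to it, evaluated at `x' = x`. -/
def dot (F G : (ℕ+ → ℂ) → ℂ) : (ℕ+ → ℂ) → (ℕ+ → ℂ) → ℂ := fun x x' => F x * G x'

section PairDet

open Matrix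

variable {ι R : Type*} [DecidableEq ι] [CommRing R]

/-- The block diagonal skew matrix with blocks `a i • !![0, -1; 1, 0]`. -/
def pairForm (a : ι → R) : Matrix (ι × Bool) (ι × Bool) R :=
  Matrix.of fun s t => if s.1 = t.1 ∧ s.2 ≠ t.2 then (if s.2 then a s.1 else -a s.1) else 0

theorem pairForm_apply (a : ι → R) (s t : ι × Bool) :
    pairForm a s t = if s.1 = t.1 ∧ s.2 ≠ t.2 then (if s.2 then a s.1 else -a s.1) else 0 := rfl

theorem pairForm_transpose (a : ι → R) : (pairForm a)ᵀ = -pairForm a := by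
  ext ⟨i, s⟩ ⟨j, t⟩
  simp only [transpose_apply, Matrix.neg_apply, pairForm_apply]
  by_cases h : i = j
  · subst h; cases s <;> cases t <;> simp
  · simp [h, Ne.symm h]

theorem pairForm_zero : pairForm (0 : ι → R) = 0 := by
  ext s t; simp [pairForm_apply]

theorem pairForm_map {S : Type*} [CommRing S] (f : R →+* S) (a : ι → R) :
    (pairForm a).map f = pairForm (fun i => f (a i)) := by
  ext s t
  simp only [map_apply, pairForm_apply]
  split_ifs <;> simp

variable [Fintype ι]

/-- The determinant `det (1 + A X)`, where `A` is the block diagonal skew matrix of weights `a`. -/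
def pairDet (X : Matrix (ι × Bool) (ι × Bool) R) (a : ι → R) : R :=
  (1 + pairForm a * X).det

theorem pairDet_zero (X : Matrix (ι × Bool) (ι × Bool) R) : pairDet X 0 = 1 := by
  simp [pairDet, pairForm_zero]

theorem map_pairDet {S : Type*} [CommRing S] (f : R →+* S) (X : Matrix (ι × Bool) (ι × Bool) R)
    (a : ι → R) : f (pairDet X a) = pairDet (X.map f) (fun i => f (a i)) := by
  rw [pairDet, pairDet, RingHom.map_det, map_add, map_one, map_mul]
  simp only [RingHom.mapMatrix_apply, pairForm_map]

end PairDet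

section Update

open Matrix

variable {N R : Type*} [Fintype N] [DecidableEq N] [CommRing R]

theorem mul_inv_one_add_mul_comm {A X : Matrix N N R} (h : IsUnit (1 + A * X).det) :
    X * (1 + A * X)⁻¹ = (1 + X * A)⁻¹ * X := by
  have h' : IsUnit (1 + X * A).det := by rwa [det_one_add_mul_comm]
  calc X * (1 + A * X)⁻¹ = (1 + X * A)⁻¹ * ((1 + X * A) * X) * (1 + A * X)⁻¹ := by
        rw [← Matrix.mul_assoc _ _ X, nonsing_inv_mul _ h', Matrix.one_mul]
    _ = (1 + X * A)⁻¹ * (X * (1 + A * X)) * (1 + A * X)⁻¹ := by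
        congr 2; noncomm_ring
    _ = (1 + X * A)⁻¹ * X := by
        rw [Matrix.mul_assoc, Matrix.mul_assoc, mul_nonsing_inv _ h, Matrix.mul_one]

theorem resolvent_transpose {A X : Matrix N N R} (hA : Aᵀ = -A) (hX : Xᵀ = -X)
    (h : IsUnit (1 + A * X).det) : (X * (1 + A * X)⁻¹)ᵀ = -(X * (1 + A * X)⁻¹) := by
  rw [transpose_mul, transpose_nonsing_inv, transpose_add, transpose_mul, hA, hX, transpose_one,
    neg_mul_neg, Matrix.mul_neg, mul_inv_one_add_mul_comm h]

omit [DecidableEq N] in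
theorem dotProduct_mulVec_skew {Y : Matrix N N R} (hY : Yᵀ = -Y) (b c : N → R) :
    b ⬝ᵥ Y *ᵥ c = -(c ⬝ᵥ Y *ᵥ b) := by
  rw [dotProduct_mulVec, ← mulVec_transpose, hY, neg_mulVec, neg_dotProduct, dotProduct_comm]

omit [DecidableEq N] in
theorem dotProduct_mulVec_self {Y : Matrix N N R} (h2 : IsUnit (2 : R)) (hY : Yᵀ = -Y)
    (b : N → R) : b ⬝ᵥ Y *ᵥ b = 0 := by
  have := dotProduct_mulVec_skew hY b b
  refine (h2.mul_right_eq_zero).1 ?_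
  linear_combination this

/-- The effect on `det (1 + A X)` of a skew change of rank two of `A`. -/
theorem det_one_add_skew_update {A X : Matrix N N R} (h2 : IsUnit (2 : R)) (hA : Aᵀ = -A)
    (hX : Xᵀ = -X) (h : IsUnit (1 + A * X).det) (b c : N → R) :
    (1 + (A + (vecMulVec b c - vecMulVec c b)) * X).det =
      (1 + A * X).det * (1 + c ⬝ᵥ (X * (1 + A * X)⁻¹) *ᵥ b) ^ 2 := by
  set Y := X * (1 + A * X)⁻¹ with hYdef
  have hY : Yᵀ = -Y := resolvent_transpose hA hX h
  have e1 : 1 + (A + (vecMulVec b c - vecMulVec c b)) * X =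
      (1 + (vecMulVec b c - vecMulVec c b) * Y) * (1 + A * X) := by
    rw [add_mul (1 : Matrix N N R), one_mul, hYdef, Matrix.mul_assoc, Matrix.mul_assoc X,
      nonsing_inv_mul _ h, Matrix.mul_one, add_mul, add_assoc]
  let U : Matrix N (Fin 2) R := Matrix.of fun i k => (![b, -c] : Fin 2 → N → R) k i
  let V : Matrix (Fin 2) N R := Matrix.of (![c ᵥ* Y, b ᵥ* Y] : Fin 2 → N → R)
  have e2 : (vecMulVec b c - vecMulVec c b) * Y = U * V := by
    rw [sub_mul, vecMulVec_mul, vecMulVec_mul]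
    ext i j
    simp [U, V, mul_apply, Fin.sum_univ_two, vecMulVec_apply]
    ring
  have e3 : V * U = !![c ⬝ᵥ Y *ᵥ b, -(c ⬝ᵥ Y *ᵥ c); b ⬝ᵥ Y *ᵥ b, -(b ⬝ᵥ Y *ᵥ c)] := by
    ext i j
    simp only [dotProduct_mulVec]
    fin_cases i <;> fin_cases j <;> simp [U, V, mul_apply, dotProduct]
  rw [e1, det_mul, e2, det_one_add_mul_comm, e3, det_fin_two, mul_comm]
  simp only [dotProduct_mulVec_self h2 hY, dotProduct_mulVec_skew hY b c]
  simp
  ring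

end Update

section Root

open Matrix

variable {ι : Type*} [Fintype ι] [DecidableEq ι]

omit [Fintype ι] in
theorem pairForm_update {R : Type*} [CommRing R] (a : ι → R) (s : Finset ι) {i : ι} (hi : i ∉ s) :
    pairForm (fun j => if j ∈ insert i s then a j else 0) =
      pairForm (fun j => if j ∈ s then a j else 0) +
        (vecMulVec (a i • Pi.single (i, true) 1) (Pi.single (i, false) 1) -
          vecMulVec (Pi.single (i, false) 1) (a i • Pi.single (i, true) 1)) := by
  ext ⟨j, s'⟩ ⟨k, t⟩
  simp only [pairForm_apply, Matrix.add_apply, Matrix.sub_apply, vecMulVec_apply, Pi.smul_apply,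
      smul_eq_mul,
    Pi.single_apply, Prod.mk.injEq, Finset.mem_insert]
  by_cases hjk : j = k
  · subst hjk
    by_cases hji : j = i
    · subst hji; cases s' <;> cases t <;> simp [hi]
    · simp [hji]
  · by_cases hji : j = i
    · subst hji; simp [hjk, Ne.symm hjk]
    · simp [hjk, hji]

theorem isSquare_pairDet {K : Type*} [Field K] [CharZero K]
    (X : Matrix (ι × Bool) (ι × Bool) K) (hX : Xᵀ = -X) (a : ι → K)
    (h : ∀ s : Finset ι, pairDet X (fun j => if j ∈ s then a j else 0) ≠ 0) (s : Finset ι) :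
    IsSquare (pairDet X (fun j => if j ∈ s then a j else 0)) := by
  induction s using Finset.induction_on with
  | empty =>
    have : (fun j => if j ∈ (∅ : Finset ι) then a j else 0) = 0 := by ext; simp
    rw [this, pairDet_zero]; exact IsSquare.one
  | insert i s hi ih =>
    rw [pairDet, pairForm_update a s hi, det_one_add_skew_update (IsUnit.mk0 _ two_ne_zero)
      (pairForm_transpose _) hX (IsUnit.mk0 _ (h s))]
    exact ih.mul (IsSquare.sq _)

theorem exists_pairRoot (X : Matrix (ι × Bool) (ι × Bool) ℂ) (hX : Xᵀ = -X) :
    ∃ q : MvPolynomial ι ℂ, q ^ 2 = pairDet (X.map MvPolynomial.C) MvPolynomial.X ∧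
      MvPolynomial.constantCoeff q = 1 := by
  let F := FractionRing (MvPolynomial ι ℂ)
  let φ : MvPolynomial ι ℂ →+* F := algebraMap _ _
  have hφ : Function.Injective φ := IsFractionRing.injective _ _
  have : CharZero F := charZero_of_injective_algebraMap hφ
  have hc : ∀ s : Finset ι, MvPolynomial.constantCoeff (pairDet (X.map MvPolynomial.C)
      (fun j => if j ∈ s then (MvPolynomial.X j : MvPolynomial ι ℂ) else 0)) = 1 := by
    intro s
    rw [map_pairDet]
    have : (fun i => MvPolynomial.constantCoeff
      (if i ∈ s then (MvPolynomial.X i : MvPolynomial ι ℂ) else 0)) = 0 := by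
      ext i; split_ifs <;> simp
    rw [this, pairDet_zero]
  have e : ∀ s : Finset ι, φ (pairDet (X.map MvPolynomial.C)
      (fun j => if j ∈ s then (MvPolynomial.X j : MvPolynomial ι ℂ) else 0)) =
      pairDet ((X.map MvPolynomial.C).map φ)
        (fun j => if j ∈ s then φ (MvPolynomial.X j) else 0) := by
    intro s
    rw [map_pairDet]
    congr 1; ext i; split_ifs <;> simp
  have hX' : ((X.map MvPolynomial.C).map φ)ᵀ = -((X.map MvPolynomial.C).map φ) := by
    ext i j
    have := congrFun (congrFun hX i) j
    simp only [transpose_apply, Matrix.neg_apply] at this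
    simp [this]
  obtain ⟨r, hr⟩ := isSquare_pairDet _ hX' (fun j => φ (MvPolynomial.X j)) (by
    intro s h0
    rw [← e s, map_eq_zero_iff φ hφ] at h0
    have := hc s
    rw [h0, map_zero] at this
    exact zero_ne_one this) Finset.univ
  rw [← e, ← sq] at hr
  have hint : IsIntegral (MvPolynomial ι ℂ) r := by
    refine IsIntegral.of_pow (n := 2) two_pos ?_
    rw [← hr]; exact isIntegral_algebraMap
  obtain ⟨q, rfl⟩ := IsIntegrallyClosed.isIntegral_iff.1 hint
  have hq : q ^ 2 = pairDet (X.map MvPolynomial.C) MvPolynomial.X := by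
    apply hφ
    rw [map_pow]
    have := hr.symm
    simp only [Finset.mem_univ, if_true] at this
    exact this
  have h1 : MvPolynomial.constantCoeff q ^ 2 = 1 := by
    rw [← map_pow, hq]
    simpa using hc Finset.univ
  rcases sq_eq_one_iff.1 h1 with h | h
  · exact ⟨q, hq, h⟩
  · exact ⟨-q, by rw [neg_sq, hq], by rw [map_neg, h, neg_neg]⟩

theorem eq_of_sq_eq_sq_of_map_eq_one {A B : Type*} [CommRing A] [IsDomain A] [CommRing B]
    (f : A →+* B) (h2 : (2 : B) ≠ 0) {p q : A} (h : p ^ 2 = q ^ 2) (hp : f p = 1) (hq : f q = 1) :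
    p = q := by
  rcases sq_eq_sq_iff_eq_or_eq_neg.1 h with h | h
  · exact h
  · exfalso
    have := congrArg f h
    rw [map_neg, hp, hq] at this
    apply h2
    linear_combination this

/-- The square root with constant term `1` of `det (1 + A X)`, as a polynomial in the weights. -/
noncomputable def pairRoot (X : Matrix (ι × Bool) (ι × Bool) ℂ) : MvPolynomial ι ℂ :=
  Classical.epsilon fun q => q ^ 2 = pairDet (X.map MvPolynomial.C) MvPolynomial.X ∧
    MvPolynomial.constantCoeff q = 1

theorem pairRoot_spec {X : Matrix (ι × Bool) (ι × Bool) ℂ} (hX : Xᵀ = -X) :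
    pairRoot X ^ 2 = pairDet (X.map MvPolynomial.C) MvPolynomial.X ∧
      MvPolynomial.constantCoeff (pairRoot X) = 1 :=
  Classical.epsilon_spec (exists_pairRoot X hX)

theorem eq_pairRoot {X : Matrix (ι × Bool) (ι × Bool) ℂ} (hX : Xᵀ = -X) {q : MvPolynomial ι ℂ}
    (h : q ^ 2 = pairDet (X.map MvPolynomial.C) MvPolynomial.X)
    (h0 : MvPolynomial.constantCoeff q = 1) : q = pairRoot X :=
  eq_of_sq_eq_sq_of_map_eq_one MvPolynomial.constantCoeff two_ne_zero
    (h.trans (pairRoot_spec hX).1.symm) h0 (pairRoot_spec hX).2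

end Root

section PairPf

open Matrix

variable {ι : Type*} [Fintype ι] [DecidableEq ι]

theorem pairForm_mul_apply {R : Type*} [CommRing R] (a : ι → R)
    (X : Matrix (ι × Bool) (ι × Bool) R) (s t : ι × Bool) :
    (pairForm a * X) s t = a s.1 * ((if s.2 then 1 else -1) * X (s.1, !s.2) t) := by
  rw [mul_apply, Finset.sum_eq_single (s.1, !s.2)]
  · simp only [pairForm_apply]
    cases s.2 <;> simp
  · rintro ⟨i, b⟩ - h
    rw [pairForm_apply, if_neg, zero_mul]
    rintro ⟨h1, h2⟩
    apply h
    simp only at h1 h2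
    subst h1
    cases hs : s.2 <;> cases b <;> simp_all
  · simp

omit [Fintype ι] in
theorem pairForm_extend {ι' R : Type*} [Fintype ι'] [DecidableEq ι'] [CommRing R] {e : ι' → ι}
    (he : Function.Injective e) (b : ι → R) (hb : ∀ j, j ∉ Set.range e → b j = 0) :
    pairForm b = (1 : Matrix (ι × Bool) (ι × Bool) R).submatrix id (Prod.map e id) *
      pairForm (b ∘ e) * (1 : Matrix (ι × Bool) (ι × Bool) R).submatrix (Prod.map e id) id := by
  ext ⟨j, s⟩ ⟨k, t⟩
  simp only [mul_apply, submatrix_apply, one_apply, id, Prod.map, Prod.mk.injEq,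
    Fintype.sum_prod_type]
  by_cases hj : j ∈ Set.range e
  · obtain ⟨j, rfl⟩ := hj
    by_cases hk : k ∈ Set.range e
    · obtain ⟨k, rfl⟩ := hk
      rw [Finset.sum_eq_single k (fun x _ hx => by simp [he.eq_iff, hx]) (by simp),
        Finset.sum_eq_single t (fun x _ hx => by simp [hx]) (by simp),
        Finset.sum_eq_single j (fun x _ hx => by simp [he.eq_iff, Ne.symm hx]) (by simp),
        Finset.sum_eq_single s (fun x _ hx => by simp [Ne.symm hx]) (by simp)]
      simp [pairForm_apply, he.eq_iff]
    · have : ∀ x, e x ≠ k := fun x hx => hk ⟨x, hx⟩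
      simp [pairForm_apply, this]
  · have : ∀ x, j ≠ e x := fun x hx => hj ⟨x, hx.symm⟩
    simp [pairForm_apply, this, hb j hj]

theorem pairDet_extend {ι' R : Type*} [Fintype ι'] [DecidableEq ι'] [CommRing R] {e : ι' → ι}
    (he : Function.Injective e) (X : Matrix (ι × Bool) (ι × Bool) R) (b : ι → R)
    (hb : ∀ j, j ∉ Set.range e → b j = 0) :
    pairDet X b = pairDet (X.submatrix (Prod.map e id) (Prod.map e id)) (b ∘ e) := by
  rw [pairDet, pairForm_extend he b hb, Matrix.mul_assoc, Matrix.mul_assoc, det_one_add_mul_comm,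
    pairDet, Matrix.mul_assoc, Matrix.mul_assoc]
  congr 3
  ext s t
  simp [mul_apply, one_apply]

/-- The exponent of the squarefree monomial of a set of variables. -/
noncomputable def ind (I : Finset ι) : ι →₀ ℕ := Finsupp.indicator I fun _ _ => 1

omit [Fintype ι] in
theorem ind_apply (I : Finset ι) (i : ι) : ind I i = if i ∈ I then 1 else 0 := by
  simp [ind, Finsupp.indicator_apply]

omit [Fintype ι] in
theorem ind_injective : Function.Injective (ind : Finset ι → ι →₀ ℕ) := by
  intro I J h
  ext i
  have := DFunLike.congr_fun h i
  rw [ind_apply, ind_apply] at this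
  by_cases h1 : i ∈ I <;> by_cases h2 : i ∈ J <;> simp_all

omit [Fintype ι] in
theorem ind_empty : ind (∅ : Finset ι) = 0 := by ext i; simp [ind_apply]

omit [Fintype ι] in
theorem coeff_ind_mul {R : Type*} [CommRing R] (F G : MvPowerSeries ι R) (J : Finset ι) :
    MvPowerSeries.coeff (ind J) (F * G) =
      ∑ I ∈ J.powerset, MvPowerSeries.coeff (ind I) F * MvPowerSeries.coeff (ind (J \ I)) G := by
  rw [MvPowerSeries.coeff_mul]
  symm
  refine Finset.sum_bij (fun I _ => (ind I, ind (J \ I))) ?_ ?_ ?_ ?_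
  · intro I hI
    rw [Finset.mem_powerset] at hI
    rw [Finset.HasAntidiagonal.mem_antidiagonal]
    ext i
    simp only [Finsupp.add_apply, ind_apply, Finset.mem_sdiff]
    by_cases h : i ∈ I
    · simp [h, hI h]
    · simp [h]
  · intro I _ I' _ h
    exact ind_injective (Prod.mk.inj h).1
  · rintro ⟨m, m'⟩ h
    rw [Finset.HasAntidiagonal.mem_antidiagonal] at h
    have hm : ∀ i, m i + m' i = if i ∈ J then 1 else 0 := fun i => by
      rw [← ind_apply, ← h]; rfl
    refine ⟨J.filter (fun i => m i = 1), by simp, ?_⟩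
    refine Prod.ext ?_ ?_
    · ext i
      have := hm i
      by_cases hJ : i ∈ J <;>
        simp only [ind_apply, Finset.mem_filter, hJ, if_true, if_false, true_and, false_and]
          at this ⊢ <;> (try split_ifs) <;> omega
    · ext i
      have := hm i
      by_cases hJ : i ∈ J <;>
        simp only [ind_apply, Finset.mem_filter, Finset.mem_sdiff, hJ, if_true, if_false,
          true_and, false_and] at this ⊢ <;> (try split_ifs) <;> omega
  · intros; rfl

omit [Fintype ι] [DecidableEq ι] in
theorem coeff_killCompl {ι' R : Type*} [CommRing R] {e : ι' → ι} (he : Function.Injective e)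
    (F : MvPolynomial ι R) (m : ι' →₀ ℕ) :
    MvPolynomial.coeff m (MvPolynomial.killCompl he F) =
      MvPolynomial.coeff (m.mapDomain e) F := by
  classical
  induction F using MvPolynomial.induction_on' with
  | monomial s c =>
    by_cases hs : (s.support : Set ι) ⊆ Set.range e
    · rw [MvPolynomial.killCompl_monomial_eq_monomial_comapDomain_of_subset he c hs,
        MvPolynomial.coeff_monomial, MvPolynomial.coeff_monomial]
      congr 1
      refine propext ⟨?_, ?_⟩
      · rintro rfl; exact (Finsupp.mapDomain_comapDomain e he s hs).symm
      · rintro rfl; exact Finsupp.comapDomain_mapDomain e he m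
    · rw [MvPolynomial.killCompl_monomial_eq_zero_of_not_subset he c hs,
        MvPolynomial.coeff_monomial, if_neg, MvPolynomial.coeff_zero]
      rintro rfl
      apply hs
      intro i hi
      have := Finsupp.mapDomain_support hi
      simp only [Finset.mem_image] at this
      obtain ⟨j, -, rfl⟩ := this
      exact ⟨j, rfl⟩
  | add p q hp hq => rw [map_add, MvPolynomial.coeff_add, MvPolynomial.coeff_add, hp, hq]

/-- The coefficient of the product of all weights in the square root of `det (1 + A X)`. It is the
Pfaffian of `X` up to sign. -/
noncomputable def pairPf (X : Matrix (ι × Bool) (ι × Bool) ℂ) : ℂ :=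
  MvPolynomial.coeff (ind Finset.univ) (pairRoot X)

omit [Fintype ι] [DecidableEq ι] in
theorem submatrix_skew {κ : Type*} {X : Matrix ι ι ℂ} (hX : Xᵀ = -X) (f : κ → ι) :
    (X.submatrix f f)ᵀ = -X.submatrix f f := by
  rw [transpose_submatrix, hX]; rfl

theorem killCompl_pairRoot {ι' : Type*} [Fintype ι'] [DecidableEq ι'] {e : ι' → ι}
    (he : Function.Injective e) {X : Matrix (ι × Bool) (ι × Bool) ℂ} (hX : Xᵀ = -X) :
    MvPolynomial.killCompl he (pairRoot X) =
      pairRoot (X.submatrix (Prod.map e id) (Prod.map e id)) := by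
  refine eq_pairRoot (submatrix_skew hX _) ?_ ?_
  · rw [← map_pow, (pairRoot_spec hX).1]
    have := map_pairDet (MvPolynomial.killCompl (R := ℂ) he).toRingHom
      (X.map MvPolynomial.C) MvPolynomial.X
    simp only [AlgHom.toRingHom_eq_coe, RingHom.coe_coe] at this
    rw [this, pairDet_extend he]
    · congr 1
      · ext s t; simp
      · ext i
        simp [MvPolynomial.killCompl, Equiv.ofInjective_symm_apply]
    · intro j hj
      rw [MvPolynomial.killCompl, MvPolynomial.aeval_X, dif_neg hj]
  · have h := coeff_killCompl he (pairRoot X) 0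
    rw [Finsupp.mapDomain_zero] at h
    rw [MvPolynomial.constantCoeff_eq, h, ← MvPolynomial.constantCoeff_eq, (pairRoot_spec hX).2]

theorem coeff_pairRoot_image {ι' : Type*} [Fintype ι'] [DecidableEq ι'] {e : ι' → ι}
    (he : Function.Injective e) {X : Matrix (ι × Bool) (ι × Bool) ℂ} (hX : Xᵀ = -X) (I : Finset ι)
    (hI : ∀ i, i ∈ I ↔ i ∈ Set.range e) :
    MvPolynomial.coeff (ind I) (pairRoot X) =
      pairPf (X.submatrix (Prod.map e id) (Prod.map e id)) := by
  rw [pairPf, ← killCompl_pairRoot he hX, coeff_killCompl]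
  congr 1
  ext i
  rw [ind_apply]
  by_cases h : i ∈ I
  · obtain ⟨j, rfl⟩ := (hI i).1 h
    rw [if_pos h, Finsupp.mapDomain_apply he]
    simp [ind_apply]
  · rw [if_neg h, Finsupp.mapDomain_of_notMem_range]
    rwa [← hI]

theorem degreeOf_pairDet_le (X : Matrix (ι × Bool) (ι × Bool) ℂ) (i : ι) :
    MvPolynomial.degreeOf i (pairDet (X.map MvPolynomial.C) MvPolynomial.X) ≤ 2 := by
  have entry : ∀ s t : ι × Bool, MvPolynomial.degreeOf i
      ((1 + pairForm (MvPolynomial.X : ι → MvPolynomial ι ℂ) * X.map MvPolynomial.C :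
        Matrix (ι × Bool) (ι × Bool) (MvPolynomial ι ℂ)) s t) ≤
      if s.1 = i then 1 else 0 := by
    intro s t
    rw [Matrix.add_apply, pairForm_mul_apply]
    have e1 : (1 : Matrix (ι × Bool) (ι × Bool) (MvPolynomial ι ℂ)) s t =
        MvPolynomial.C ((1 : Matrix (ι × Bool) (ι × Bool) ℂ) s t) := by
      rw [one_apply, one_apply]; split_ifs <;> simp
    have e2 : ((if s.2 then 1 else -1) * (X.map MvPolynomial.C) (s.1, !s.2) t :
        MvPolynomial ι ℂ) = MvPolynomial.C ((if s.2 then 1 else -1) * X (s.1, !s.2) t) := by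
      split_ifs <;> simp
    rw [e1, e2]
    refine (MvPolynomial.degreeOf_add_le _ _ _).trans ?_
    rw [MvPolynomial.degreeOf_C, max_eq_right (Nat.zero_le _)]
    refine (MvPolynomial.degreeOf_mul_le _ _ _).trans ?_
    rw [MvPolynomial.degreeOf_C, add_zero, MvPolynomial.degreeOf_X]
    simp only [eq_comm, le_refl]
  rw [pairDet, det_apply']
  refine (MvPolynomial.degreeOf_sum_le _ _ _).trans (Finset.sup_le fun σ _ => ?_)
  refine (MvPolynomial.degreeOf_mul_le _ _ _).trans ?_
  have e3 : ((Equiv.Perm.sign σ : ℤ) : MvPolynomial ι ℂ) =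
      MvPolynomial.C ((Equiv.Perm.sign σ : ℤ) : ℂ) := by
    simp
  rw [e3, MvPolynomial.degreeOf_C, zero_add]
  refine (MvPolynomial.degreeOf_prod_le _ _ _).trans ?_
  refine (Finset.sum_le_sum fun s _ => entry (σ s) s).trans ?_
  have e4 : ∑ s : ι × Bool, (if s.1 = i then 1 else 0) = 2 := by
    rw [Fintype.sum_prod_type, Fintype.sum_eq_single i fun x hx => by simp [hx]]
    simp
  exact ((Equiv.sum_comp σ (fun s => if s.1 = i then 1 else 0)).trans e4).le

theorem degreeOf_pairRoot_le {X : Matrix (ι × Bool) (ι × Bool) ℂ} (hX : Xᵀ = -X) (i : ι) :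
    MvPolynomial.degreeOf i (pairRoot X) ≤ 1 := by
  have h := degreeOf_pairDet_le X i
  have h0 : pairRoot X ≠ 0 := by
    intro h0
    have := (pairRoot_spec hX).2
    rw [h0, map_zero] at this
    exact zero_ne_one this
  rw [← (pairRoot_spec hX).1, MvPolynomial.degreeOf_pow_eq _ _ _ h0] at h
  omega

theorem pairPf_sq {X : Matrix (ι × Bool) (ι × Bool) ℂ} (hX : Xᵀ = -X) :
    pairPf X ^ 2 = (pairForm 1 * X).det := by
  let φ : MvPolynomial ι ℂ →+* Polynomial ℂ :=
    MvPolynomial.eval₂Hom Polynomial.C fun _ => Polynomial.X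
  have hsupp : ∀ m ∈ (pairRoot X).support, ∀ i, m i ≤ 1 := fun m hm i =>
    (MvPolynomial.monomial_le_degreeOf i hm).trans (degreeOf_pairRoot_le hX i)
  have hφ : φ (pairRoot X) = ∑ m ∈ (pairRoot X).support,
      Polynomial.C (MvPolynomial.coeff m (pairRoot X)) * Polynomial.X ^ (∑ i, m i) := by
    simp only [φ, MvPolynomial.coe_eval₂Hom, MvPolynomial.eval₂_eq', Finset.prod_pow_eq_pow_sum]
  have hsum : ∀ m ∈ (pairRoot X).support, ∑ i, m i ≤ Fintype.card ι := fun m hm =>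
    (Finset.sum_le_sum fun i _ => hsupp m hm i).trans (by simp)
  have hdeg : (φ (pairRoot X)).natDegree ≤ Fintype.card ι := by
    rw [hφ]
    exact Polynomial.natDegree_sum_le_of_forall_le _ _ fun m hm =>
      (Polynomial.natDegree_C_mul_X_pow_le _ _).trans (hsum m hm)
  have hcoeff : (φ (pairRoot X)).coeff (Fintype.card ι) = pairPf X := by
    rw [hφ, Polynomial.finsetSum_coeff]
    simp only [Polynomial.coeff_C_mul_X_pow]
    have key : ∀ m ∈ (pairRoot X).support, Fintype.card ι = ∑ i, m i → m = ind Finset.univ := by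
      intro m hm h
      have h1 : ∑ i, m i = ∑ i : ι, 1 := by rw [← h]; simp
      have := (Finset.sum_eq_sum_iff_of_le fun i _ => hsupp m hm i).1 h1
      ext i
      rw [this i (Finset.mem_univ i), ind_apply]; simp
    by_cases hm : ind Finset.univ ∈ (pairRoot X).support
    · rw [Finset.sum_eq_single_of_mem _ hm]
      · rw [if_pos, pairPf]; simp [ind_apply]
      · intro m hm' hne
        rw [if_neg fun h => hne (key m hm' h)]
    · rw [pairPf, MvPolynomial.notMem_support_iff.1 hm]
      refine Finset.sum_eq_zero fun m hm' => if_neg fun h => hm ?_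
      rw [← key m hm' h]; exact hm'
  have h1 : (φ (pairRoot X) ^ 2).coeff (Fintype.card ι + Fintype.card ι) = pairPf X ^ 2 := by
    rw [sq, Polynomial.coeff_mul_add_eq_of_natDegree_le hdeg hdeg, hcoeff, sq]
  rw [← h1, ← map_pow, (pairRoot_spec hX).1, map_pairDet, pairDet]
  have h2 := Polynomial.coeff_det_X_add_C_card (pairForm 1 * X) (1 : Matrix (ι × Bool) (ι × Bool) ℂ)
  rw [← h2, Fintype.card_prod, Fintype.card_bool, mul_two]
  congr 2
  rw [add_comm]
  congr 1
  · refine Matrix.ext fun s t => ?_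
    rw [pairForm_mul_apply]
    change φ (MvPolynomial.X s.1) * (_ * φ (MvPolynomial.C (X (s.1, !s.2) t))) =
      Polynomial.X *
        Polynomial.C ((pairForm 1 * X : Matrix (ι × Bool) (ι × Bool) ℂ) s t)
    rw [pairForm_mul_apply]
    simp only [φ, MvPolynomial.eval₂Hom_X', Pi.one_apply, one_mul, map_mul,
      MvPolynomial.eval₂Hom_C]
    split_ifs <;> simp
  · ext s t
    simp [one_apply, apply_ite]

end PairPf

section Hadamard

open Matrix
open scoped ComplexOrder

theorem norm_det_sq_le {N : Type*} [Fintype N] [DecidableEq N] {M : Matrix N N ℂ} {B : ℝ}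
    (hM : ∀ i j, ‖M i j‖ ≤ B) :
    ‖M.det‖ ^ 2 ≤ (Fintype.card N * B ^ 2) ^ Fintype.card N := by
  rcases isEmpty_or_nonempty N with hN | hN
  · simp
  have hB : 0 ≤ B := (norm_nonneg _).trans (hM hN.some hN.some)
  have hP : (Mᴴ * M).PosSemidef := posSemidef_conjTranspose_mul_self M
  have hdet : ((‖M.det‖ ^ 2 : ℝ) : ℂ) = ((∏ i, hP.1.eigenvalues i : ℝ) : ℂ) := by
    have h1 := hP.1.det_eq_prod_eigenvalues
    rw [det_mul, det_conjTranspose] at h1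
    push_cast
    rw [← Complex.conj_mul']
    simpa using h1
  have htr : ((∑ i, ∑ j, ‖M j i‖ ^ 2 : ℝ) : ℂ) = ((∑ i, hP.1.eigenvalues i : ℝ) : ℂ) := by
    have h1 := hP.1.trace_eq_sum_eigenvalues
    simp only [trace, diag_apply, mul_apply, conjTranspose_apply] at h1
    push_cast
    refine Eq.trans ?_ h1
    refine Finset.sum_congr rfl fun i _ => Finset.sum_congr rfl fun j _ => ?_
    rw [← Complex.conj_mul']; rfl
  have hdet := Complex.ofReal_injective hdet
  have htr := Complex.ofReal_injective htr
  set c : ℝ := (Fintype.card N : ℝ) with hc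
  have hcpos : 0 < c := by rw [hc]; exact_mod_cast Fintype.card_pos
  have hl : ∀ i, 0 ≤ hP.1.eigenvalues i := hP.eigenvalues_nonneg
  have amgm := Real.geom_mean_le_arith_mean_weighted Finset.univ (fun _ => 1 / c)
    hP.1.eigenvalues (fun _ _ => by positivity) (by simp [← hc, hcpos.ne']) (fun i _ => hl i)
  have hs : ∑ i, 1 / c * hP.1.eigenvalues i ≤ c * B ^ 2 := by
    rw [← Finset.mul_sum, ← htr]
    have : ∑ i, ∑ j, ‖M j i‖ ^ 2 ≤ ∑ i : N, ∑ j : N, B ^ 2 :=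
      Finset.sum_le_sum fun i _ => Finset.sum_le_sum fun j _ =>
        pow_le_pow_left₀ (norm_nonneg _) (hM j i) 2
    simp only [Finset.sum_const, Finset.card_univ, nsmul_eq_mul, ← hc] at this
    rw [one_div, inv_mul_le_iff₀ hcpos]
    exact this
  have h2 := pow_le_pow_left₀ (Finset.prod_nonneg fun i _ => Real.rpow_nonneg (hl i) _)
    (amgm.trans hs) (Fintype.card N)
  rw [← Finset.prod_pow] at h2
  rw [hdet]
  refine le_trans (le_of_eq ?_) h2
  refine Finset.prod_congr rfl fun i _ => ?_
  rw [← Real.rpow_natCast, ← Real.rpow_mul (hl i), ← hc, one_div_mul_cancel hcpos.ne',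
      Real.rpow_one]

variable {ι : Type*} [Fintype ι] [DecidableEq ι]

theorem norm_pairPf_pow_four_le {X : Matrix (ι × Bool) (ι × Bool) ℂ} (hX : Xᵀ = -X) {B : ℝ}
    (hB : ∀ s t, ‖X s t‖ ≤ B) :
    ‖pairPf X‖ ^ 4 ≤ (2 * Fintype.card ι * B ^ 2) ^ (2 * Fintype.card ι) := by
  have h := norm_det_sq_le (M := pairForm 1 * X) (B := B) (fun s t => by
    rw [pairForm_mul_apply]
    split_ifs <;> simpa using hB _ _)
  rw [← pairPf_sq hX, norm_pow, ← pow_mul, Fintype.card_prod, Fintype.card_bool] at h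
  have e : ((Fintype.card ι * 2 : ℕ) : ℝ) = 2 * Fintype.card ι := by push_cast; ring
  rw [e, mul_comm (Fintype.card ι)] at h
  exact h

end Hadamard

section PairExpansion

open Matrix

variable {ι : Type*} [Fintype ι] [DecidableEq ι]

theorem det_piecewise_graph (r : ι × Bool → ι × Bool → ℂ) (σ : ι → Bool) :
    det (Matrix.of ((Finset.univ.filter fun s : ι × Bool => s.2 = σ s.1).piecewise r
      (1 : Matrix (ι × Bool) (ι × Bool) ℂ))) =
      det (Matrix.of fun a b => r (a, σ a) (b, σ b)) := by
  set M : Matrix (ι × Bool) (ι × Bool) ℂ := Matrix.of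
    ((Finset.univ.filter fun s : ι × Bool => s.2 = σ s.1).piecewise r
      (1 : Matrix (ι × Bool) (ι × Bool) ℂ)) with hM
  have hM1 : ∀ s, s.2 = σ s.1 → ∀ t, M s t = r s t := fun s hs t => by
    simp [hM, Finset.piecewise, hs]
  have hM2 : ∀ s, s.2 ≠ σ s.1 → ∀ t, M s t = (1 : Matrix (ι × Bool) (ι × Bool) ℂ) s t :=
    fun s hs t => by simp [hM, Finset.piecewise, hs]
  rw [twoBlockTriangular_det M (fun s => s.2 = σ s.1)]
  · have h1 : (M.toSquareBlockProp fun s => ¬ s.2 = σ s.1) = 1 := by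
      ext s t
      rw [toSquareBlockProp_def, of_apply, hM2 _ s.2]
      simp [one_apply, Subtype.ext_iff]
    let e : ι ≃ {s : ι × Bool // s.2 = σ s.1} :=
      { toFun := fun i => ⟨(i, σ i), rfl⟩
        invFun := fun s => s.1.1
        left_inv := fun i => rfl
        right_inv := fun s => by
          rcases s with ⟨⟨i, b⟩, hb⟩
          simp only at hb
          simp [hb] }
    rw [h1, det_one, mul_one, ← det_submatrix_equiv_self e]
    congr 1
    ext a b
    simp [e, toSquareBlockProp_def, hM1]
  · intro s hs t ht
    rw [hM2 s hs, one_apply_ne]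
    rintro rfl
    exact hs ht

omit [Fintype ι] in
theorem sum_single_fst_apply (S : Finset (ι × Bool)) (i : ι) :
    (∑ s ∈ S, Finsupp.single s.1 1 : ι →₀ ℕ) i =
      (if (i, true) ∈ S then 1 else 0) + if (i, false) ∈ S then 1 else 0 := by
  rw [Finsupp.finsetSum_apply]
  simp only [Finsupp.single_apply]
  rw [Finset.sum_ite, Finset.sum_const_zero, add_zero, Finset.sum_const, smul_eq_mul, mul_one]
  have : (S.filter fun s => s.1 = i) =
      (if (i, true) ∈ S then {(i, true)} else ∅) ∪
        (if (i, false) ∈ S then {(i, false)} else ∅) := by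
    ext ⟨j, b⟩
    by_cases h1 : (i, true) ∈ S <;> by_cases h2 : (i, false) ∈ S <;> cases b <;>
      by_cases hj : j = i <;> simp_all
  rw [this, Finset.card_union_of_disjoint]
  · congr 1 <;> split_ifs <;> simp
  · split_ifs <;> simp

theorem det_add_eq_sum_piecewise {N R : Type*} [Fintype N] [DecidableEq N] [CommRing R]
    (m m' : N → N → R) :
    det (Matrix.of fun s t => m s t + m' s t) =
      ∑ S : Finset N, det (Matrix.of (S.piecewise m m')) :=
  (detRowAlternating (R := R) (n := N)).toMultilinearMap.map_add_univ m m'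

theorem det_smul_add_one {N R : Type*} [Fintype N] [DecidableEq N] [CommRing R]
    (a : N → R) (r : N → N → R) :
    det (Matrix.of fun s t => a s * r s t + (1 : Matrix N N R) s t) =
      ∑ S : Finset N, (∏ s ∈ S, a s) * det (Matrix.of (S.piecewise r (1 : Matrix N N R))) := by
  refine (det_add_eq_sum_piecewise (fun s t => a s * r s t) (1 : Matrix N N R)).trans ?_
  refine Finset.sum_congr rfl fun S _ => ?_
  have h := (detRowAlternating (R := R) (n := N)).toMultilinearMap.map_piecewise_smul a
    (S.piecewise r (1 : Matrix N N R)) S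
  refine Eq.trans ?_ h
  change det _ = det _
  congr 1
  refine Matrix.ext fun s t => ?_
  by_cases hs : s ∈ S
  · simp only [Finset.piecewise, hs, if_true, of_apply]; rfl
  · simp only [Finset.piecewise, hs, if_false, of_apply]

theorem coeff_ind_univ_pairDet (X : Matrix (ι × Bool) (ι × Bool) ℂ) :
    MvPolynomial.coeff (ind Finset.univ) (pairDet (X.map MvPolynomial.C) MvPolynomial.X) =
      ∑ σ : ι → Bool, det (Matrix.of fun a b : ι =>
        (if σ a then 1 else -1) * X (a, !σ a) (b, σ b)) := by
  set r : ι × Bool → ι × Bool → ℂ := fun s t => (if s.2 then 1 else -1) * X (s.1, !s.2) t with hr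
  have hD : pairDet (X.map MvPolynomial.C) MvPolynomial.X =
      ∑ S : Finset (ι × Bool), (∏ s ∈ S, (MvPolynomial.X s.1 : MvPolynomial ι ℂ)) *
        MvPolynomial.C (det (Matrix.of (S.piecewise r
          (1 : Matrix (ι × Bool) (ι × Bool) ℂ)))) := by
    have h1 : (1 + pairForm MvPolynomial.X * X.map MvPolynomial.C :
        Matrix (ι × Bool) (ι × Bool) (MvPolynomial ι ℂ)) =
        Matrix.of fun s t => (MvPolynomial.X s.1 : MvPolynomial ι ℂ) * MvPolynomial.C (r s t) +
          (1 : Matrix (ι × Bool) (ι × Bool) (MvPolynomial ι ℂ)) s t := by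
      refine Matrix.ext fun s t => ?_
      rw [Matrix.add_apply, pairForm_mul_apply, add_comm, of_apply]
      congr 2
      simp only [hr, Matrix.map_apply]
      split_ifs <;> simp
    rw [pairDet, h1, det_smul_add_one]
    refine Finset.sum_congr rfl fun S _ => ?_
    rw [RingHom.map_det]
    congr 2
    refine Matrix.ext fun s t => ?_
    by_cases hs : s ∈ S
    · simp only [Finset.piecewise, hs, if_true, of_apply, RingHom.mapMatrix_apply,
        Matrix.map_apply]
    · simp only [Finset.piecewise, hs, if_false, of_apply, RingHom.mapMatrix_apply,
        Matrix.map_apply, one_apply]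
      split_ifs <;> simp
  rw [hD, MvPolynomial.coeff_sum]
  have hc : ∀ S : Finset (ι × Bool), MvPolynomial.coeff (ind Finset.univ)
      ((∏ s ∈ S, (MvPolynomial.X s.1 : MvPolynomial ι ℂ)) *
        MvPolynomial.C (det (Matrix.of (S.piecewise r
          (1 : Matrix (ι × Bool) (ι × Bool) ℂ))))) =
      if (∑ s ∈ S, Finsupp.single s.1 1 : ι →₀ ℕ) = ind Finset.univ then
        det (Matrix.of (S.piecewise r (1 : Matrix (ι × Bool) (ι × Bool) ℂ))) else 0 := by
    intro S
    rw [mul_comm, MvPolynomial.coeff_C_mul]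
    have : (∏ s ∈ S, (MvPolynomial.X s.1 : MvPolynomial ι ℂ)) =
        MvPolynomial.monomial (∑ s ∈ S, Finsupp.single s.1 1) 1 := by
      rw [MvPolynomial.monomial_sum_one]; rfl
    rw [this, MvPolynomial.coeff_monomial]
    split_ifs <;> simp
  simp only [hc]
  symm
  refine Finset.sum_of_injOn (fun σ : ι → Bool => Finset.univ.filter fun s : ι × Bool =>
      s.2 = σ s.1)
    ?_ (by simp) ?_ ?_
  · intro σ _ τ _ h
    ext1 i
    have : (i, σ i) ∈ Finset.univ.filter fun s : ι × Bool => s.2 = τ s.1 := by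
      simp only at h
      rw [← h]; simp
    simpa using this
  · intro S _ hS
    rw [if_neg]
    intro h
    apply hS
    have h' : ∀ i, (if (i, true) ∈ S then 1 else 0) + (if (i, false) ∈ S then 1 else 0) = 1 := by
      intro i
      rw [← sum_single_fst_apply, h, ind_apply]; simp
    refine ⟨fun i => decide ((i, true) ∈ S), by simp, ?_⟩
    ext ⟨i, b⟩
    have := h' i
    by_cases h1 : (i, true) ∈ S <;> by_cases h2 : (i, false) ∈ S <;> cases b <;> simp_all
  · intro σ _
    rw [if_pos, det_piecewise_graph]
    ext i
    rw [sum_single_fst_apply, ind_apply]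
    cases h : σ i <;> simp [h]

theorem sum_coeff_pairRoot_mul {X : Matrix (ι × Bool) (ι × Bool) ℂ} (hX : Xᵀ = -X) (J : Finset ι) :
    ∑ I ∈ J.powerset, MvPolynomial.coeff (ind I) (pairRoot X) *
      MvPolynomial.coeff (ind (J \ I)) (pairRoot X) =
    MvPolynomial.coeff (ind J) (pairDet (X.map MvPolynomial.C) MvPolynomial.X) := by
  rw [← (pairRoot_spec hX).1, sq, ← MvPolynomial.coeff_coe, MvPolynomial.coe_mul, coeff_ind_mul]
  simp only [MvPolynomial.coeff_coe]

end PairExpansion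

section DerivationMatrix

open Matrix

variable {N A : Type*} [Fintype N] [DecidableEq N] [CommRing A] [Algebra ℂ A]
  (D : Derivation ℂ A A)

omit [DecidableEq N] in
theorem Derivation.matrix_map_mul (M M' : Matrix N N A) :
    (M * M').map D = M.map D * M' + M * M'.map D := by
  ext i j
  simp only [map_apply, mul_apply, Matrix.add_apply, map_sum, Derivation.leibniz, smul_eq_mul,
    ← Finset.sum_add_distrib]
  refine Finset.sum_congr rfl fun k _ => by ring

theorem Derivation.map_prod_eq_sum {κ : Type*} [DecidableEq κ] (s : Finset κ) (f : κ → A) :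
    D (∏ i ∈ s, f i) = ∑ j ∈ s, D (f j) * ∏ i ∈ s.erase j, f i := by
  induction s using Finset.induction_on with
  | empty => simp
  | insert a s ha ih =>
    rw [Finset.prod_insert ha, Derivation.leibniz, ih, Finset.sum_insert ha,
      Finset.erase_insert ha, smul_eq_mul, smul_eq_mul, Finset.mul_sum, add_comm, mul_comm]
    congr 1
    refine Finset.sum_congr rfl fun j hj => ?_
    have hja : a ≠ j := fun h => ha (h ▸ hj)
    rw [Finset.erase_insert_of_ne hja, Finset.prod_insert (by simp [ha])]
    ring

theorem Derivation.map_det (M : Matrix N N A) :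
    D M.det = (adjugate M * M.map D).trace := by
  have h1 : ∀ j, (M.updateCol j fun i => D (M i j)).det =
      ∑ σ : Equiv.Perm N, (Equiv.Perm.sign σ : ℤ) *
        (D (M (σ j) j) * ∏ i ∈ Finset.univ.erase j, M (σ i) i) := by
    intro j
    rw [det_apply']
    refine Finset.sum_congr rfl fun σ _ => ?_
    rw [← Finset.mul_prod_erase Finset.univ _ (Finset.mem_univ j), updateCol_self]
    congr 2
    refine Finset.prod_congr rfl fun i hi => ?_
    rw [updateCol_ne (Finset.ne_of_mem_erase hi)]
  have h2 : ∀ j, (adjugate M * M.map D) j j = (M.updateCol j fun i => D (M i j)).det := by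
    intro j
    rw [← cramer_apply, cramer_eq_adjugate_mulVec]
    simp [mul_apply, mulVec, dotProduct]
  simp only [trace, diag_apply, h2, h1]
  rw [Finset.sum_comm, det_apply', map_sum]
  refine Finset.sum_congr rfl fun σ _ => ?_
  rw [Derivation.leibniz, ← Finset.mul_sum, D.map_prod_eq_sum]
  simp

end DerivationMatrix

section Resolvent

open Matrix

variable {N A : Type*} [Fintype N] [DecidableEq N] [CommRing A] [Algebra ℂ A]
  (D : Derivation ℂ A A) {W X P : Matrix N N A}

/-- The skew resolvent `W (1 + X W)⁻¹`. -/
noncomputable def skewResolvent (W X : Matrix N N A) : Matrix N N A := W * (1 + X * W)⁻¹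

omit [Algebra ℂ A] in
theorem inv_one_add_eq (h : IsUnit (1 + X * W).det) :
    (1 + X * W)⁻¹ = 1 - X * skewResolvent W X := by
  have := mul_nonsing_inv _ h
  rw [add_mul, one_mul] at this
  rw [skewResolvent, ← Matrix.mul_assoc]
  exact eq_sub_of_add_eq this

omit [Algebra ℂ A] in
theorem inv_one_add_mul_eq (h : IsUnit (1 + X * W).det) :
    (1 + X * W)⁻¹ * (X * W) = X * skewResolvent W X := by
  have := nonsing_inv_mul _ h
  rw [mul_add, mul_one] at this
  rw [← sub_eq_iff_eq_add'.2 this.symm, inv_one_add_eq h]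
  abel

theorem map_skewResolvent (h : IsUnit (1 + X * W).det) (hX : X.map D = 0)
    (hW : W.map D = P * W + W * P) :
    (skewResolvent W X).map D = P * skewResolvent W X + skewResolvent W X * P -
      skewResolvent W X * (X * P + P * X) * skewResolvent W X := by
  set S := (1 + X * W)⁻¹ with hS
  set R := skewResolvent W X with hR
  have hR' : W * S = R := rfl
  have hSR : S = 1 - X * R := inv_one_add_eq h
  have h1 : (1 + X * W) * S = 1 := mul_nonsing_inv _ h
  have h1' : S * (1 + X * W) = 1 := nonsing_inv_mul _ h
  have hone : (1 : Matrix N N A).map D = 0 := by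
    ext i j; simp only [map_apply, one_apply, Matrix.zero_apply]; split_ifs <;> simp
  have h2 : (1 + X * W).map D = X * (P * W + W * P) := by
    rw [Matrix.map_add _ (map_add D), hone, D.matrix_map_mul, hX, hW]; simp
  have h3 : S.map D = -(S * (X * (P * W + W * P)) * S) := by
    have h4 := D.matrix_map_mul (1 + X * W) S
    rw [h1, hone, h2] at h4
    have h5 : S * ((1 + X * W) * S.map D) = S.map D := by
      rw [← Matrix.mul_assoc, h1', Matrix.one_mul]
    rw [← h5, eq_neg_of_add_eq_zero_right h4.symm]
    noncomm_ring
  have h6 : R.map D = (P * W + W * P) * S - R * X * (P * W + W * P) * S := by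
    rw [← hR', D.matrix_map_mul, hW, h3]
    noncomm_ring
  have h7 : R * X * W = W - R := by
    have h8 : S * (X * W) = X * R := inv_one_add_mul_eq h
    have h9 : X * R = 1 - S := by rw [hSR]; abel
    rw [← hR', Matrix.mul_assoc, Matrix.mul_assoc, h8, h9, mul_sub, mul_one]
  have h8 : (P * W + W * P) * S = P * R + W * P * S := by
    rw [add_mul, Matrix.mul_assoc, hR']
  have h9 : R * X * (P * W + W * P) * S = R * X * P * R + (W - R) * P * S := by
    rw [← h7, ← hR']
    noncomm_ring
  rw [h6, h8, h9, hSR]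
  noncomm_ring

theorem map_det_one_add (h : IsUnit (1 + X * W).det) (hX : X.map D = 0)
    (hW : W.map D = P * W + W * P) :
    D (1 + X * W).det = (1 + X * W).det * (skewResolvent W X * (X * P + P * X)).trace := by
  have hone : (1 : Matrix N N A).map D = 0 := by
    ext i j; simp only [map_apply, one_apply, Matrix.zero_apply]; split_ifs <;> simp
  have h2 : (1 + X * W).map D = X * (P * W + W * P) := by
    rw [Matrix.map_add _ (map_add D), hone, D.matrix_map_mul, hX, hW]; simp
  have hadj : adjugate (1 + X * W) = (1 + X * W).det • (1 + X * W)⁻¹ := by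
    rw [inv_def, smul_smul, Ring.mul_inverse_cancel _ h, one_smul]
  rw [D.map_det, h2, hadj, smul_mul, trace_smul, smul_eq_mul]
  congr 1
  have e1 : (1 + X * W)⁻¹ * (X * (P * W + W * P)) =
      (1 + X * W)⁻¹ * X * P * W + (1 + X * W)⁻¹ * (X * W) * P := by noncomm_ring
  rw [e1, inv_one_add_mul_eq h, trace_add, trace_mul_comm _ W, mul_add, trace_add, skewResolvent]
  congr 1
  · simp only [Matrix.mul_assoc]
  · rw [Matrix.mul_assoc, trace_mul_comm]
    simp only [Matrix.mul_assoc]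

/-- The bilinear form of the skew resolvent on constant vectors. -/
noncomputable def resolventForm (W X : Matrix N N A) (f f' : N → ℂ) : A :=
  (fun i => algebraMap ℂ A (f i)) ⬝ᵥ skewResolvent W X *ᵥ (fun i => algebraMap ℂ A (f' i))

theorem resolventForm_eq_sum (f f' : N → ℂ) : resolventForm W X f f' =
    ∑ i, ∑ j, algebraMap ℂ A (f i) * skewResolvent W X i j * algebraMap ℂ A (f' j) := by
  simp only [resolventForm, dotProduct, mulVec, Finset.mul_sum, mul_assoc]

theorem resolventForm_add_left (f f₂ f' : N → ℂ) :
    resolventForm W X (f + f₂) f' = resolventForm W X f f' + resolventForm W X f₂ f' := by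
  simp only [resolventForm_eq_sum, Pi.add_apply, map_add, add_mul, Finset.sum_add_distrib]

theorem resolventForm_smul_left (c : ℂ) (f f' : N → ℂ) :
    resolventForm W X (c • f) f' = algebraMap ℂ A c * resolventForm W X f f' := by
  simp only [resolventForm_eq_sum, Pi.smul_apply, smul_eq_mul, map_mul, Finset.mul_sum, mul_assoc]

theorem resolventForm_skew (hW : Wᵀ = -W) (hX : Xᵀ = -X) (h : IsUnit (1 + X * W).det)
    (f f' : N → ℂ) : resolventForm W X f f' = -resolventForm W X f' f :=
  dotProduct_mulVec_skew (resolvent_transpose hX hW h) _ _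

theorem resolventForm_self (h2 : IsUnit (2 : A)) (hW : Wᵀ = -W) (hX : Xᵀ = -X)
    (h : IsUnit (1 + X * W).det) (f : N → ℂ) : resolventForm W X f f = 0 :=
  dotProduct_mulVec_self h2 (resolvent_transpose hX hW h) _

theorem sum_vecMulVec_eq {n : ℕ} (p : N → ℂ) (b c : Fin n → N → ℂ)
    (hB : ∀ s t, X s t * algebraMap ℂ A (p s + p t) = algebraMap ℂ A (∑ l, b l s * c l t)) :
    X * diagonal (fun i => algebraMap ℂ A (p i)) + diagonal (fun i => algebraMap ℂ A (p i)) * X =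
      ∑ l, vecMulVec (fun i => algebraMap ℂ A (b l i)) (fun i => algebraMap ℂ A (c l i)) := by
  ext s t
  rw [Matrix.add_apply, mul_diagonal, diagonal_mul, Matrix.sum_apply]
  have := hB s t
  simp only [map_add, map_sum, map_mul] at this
  simp only [vecMulVec_apply, ← this]
  ring

/-- The derivative of the form of the resolvent, when `X P + P X` has finite rank. -/
theorem map_resolventForm {n : ℕ} (h : IsUnit (1 + X * W).det) (hX : X.map D = 0) (p : N → ℂ)
    (hW : W.map D = diagonal (fun i => algebraMap ℂ A (p i)) * W +
      W * diagonal (fun i => algebraMap ℂ A (p i))) (b c : Fin n → N → ℂ)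
    (hB : ∀ s t, X s t * algebraMap ℂ A (p s + p t) = algebraMap ℂ A (∑ l, b l s * c l t))
    (f f' : N → ℂ) :
    D (resolventForm W X f f') = resolventForm W X (p * f) f' + resolventForm W X f (p * f') -
      ∑ l, resolventForm W X f (b l) * resolventForm W X (c l) f' := by
  have hR := map_skewResolvent D h hX hW
  set R := skewResolvent W X with hRdef
  set P := diagonal (fun i => algebraMap ℂ A (p i)) with hP
  have hXP : X * P + P * X = ∑ l, vecMulVec (fun i => algebraMap ℂ A (b l i))
      (fun i => algebraMap ℂ A (c l i)) := by
    exact sum_vecMulVec_eq p b c hB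
  have h1 : D (resolventForm W X f f') = (fun i => algebraMap ℂ A (f i)) ⬝ᵥ (R.map D) *ᵥ
      (fun i => algebraMap ℂ A (f' i)) := by
    simp only [resolventForm, dotProduct, mulVec, map_sum, Derivation.leibniz, smul_eq_mul,
      Derivation.map_algebraMap, mul_zero, add_zero, map_apply, hRdef, zero_add, zero_mul, mul_comm]
  have h2 : (fun i => algebraMap ℂ A (f i)) ⬝ᵥ (P * R) *ᵥ (fun i => algebraMap ℂ A (f' i)) =
      resolventForm W X (p * f) f' := by
    simp only [resolventForm, hP, ← mulVec_mulVec, dotProduct, mulVec_diagonal, ← hRdef,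
      Pi.mul_apply, map_mul]
    refine Finset.sum_congr rfl fun i _ => by ring
  have h3 : (fun i => algebraMap ℂ A (f i)) ⬝ᵥ (R * P) *ᵥ (fun i => algebraMap ℂ A (f' i)) =
      resolventForm W X f (p * f') := by
    simp only [resolventForm, hP, ← mulVec_mulVec, ← hRdef]
    congr 2
    ext i
    rw [mulVec_diagonal, Pi.mul_apply, map_mul]
  have h4 : (fun i => algebraMap ℂ A (f i)) ⬝ᵥ (R * (X * P + P * X) * R) *ᵥ
      (fun i => algebraMap ℂ A (f' i)) =
      ∑ l, resolventForm W X f (b l) * resolventForm W X (c l) f' := by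
    rw [hXP, ← mulVec_mulVec, ← mulVec_mulVec, Matrix.sum_mulVec, mulVec_sum, dotProduct_sum]
    refine Finset.sum_congr rfl fun l _ => ?_
    rw [vecMulVec_mulVec, mulVec_smul, dotProduct_smul]
    simp [resolventForm, hRdef]
  rw [h1, hR, sub_mulVec, add_mulVec, dotProduct_sub, dotProduct_add, h2, h3, h4]

theorem map_det_one_add_eq_sum {n : ℕ} (h : IsUnit (1 + X * W).det) (hX : X.map D = 0) (p : N → ℂ)
    (hW : W.map D = diagonal (fun i => algebraMap ℂ A (p i)) * W +
      W * diagonal (fun i => algebraMap ℂ A (p i))) (b c : Fin n → N → ℂ)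
    (hB : ∀ s t, X s t * algebraMap ℂ A (p s + p t) = algebraMap ℂ A (∑ l, b l s * c l t)) :
    D (1 + X * W).det = (1 + X * W).det * ∑ l, resolventForm W X (c l) (b l) := by
  rw [map_det_one_add D h hX hW]
  congr 1
  rw [sum_vecMulVec_eq p b c hB, Matrix.mul_sum, trace_sum]
  refine Finset.sum_congr rfl fun l _ => ?_
  rw [mul_vecMulVec, trace_vecMulVec, dotProduct_comm, resolventForm]

end Resolvent

section HirotaAlgebra

variable {A : Type*} [CommRing A] [Algebra ℂ A] (d1 d2 d3 : Derivation ℂ A A) (E g : A)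
  (a b c : ℤ → ℤ → A) (τ : A)

/-- The first Hirota equation in a differential ring, where `a`, `b`, `c` stand for the forms of the
resolvent on the functions `K ^ i`, `k K ^ i`. -/
theorem hirota_first (z0 : ∀ i, a i i = 0) (z1 : ∀ i, c i i = 0) (d1E : d1 E = 0) (d1g : d1 g = 0)
    (aa : ∀ i j, a i j = -a j i) (cc : ∀ i j, c i j = -c j i)
    (d1a : ∀ i j, d1 (a i j) = -b j i + b i j - (a i 1 * a 0 j - a i 0 * a 1 j))
    (d1b : ∀ i j, d1 (b i j) = c i j + (a i (j + 1) + E * a i j + g * a i (j - 1)) -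
      (a i 1 * b 0 j - a i 0 * b 1 j))
    (d1c : ∀ i j, d1 (c i j) = (b (i + 1) j + E * b i j + g * b (i - 1) j) -
      (b (j + 1) i + E * b j i + g * b (j - 1) i) - (-b 1 i * b 0 j + b 0 i * b 1 j))
    (d2b : ∀ i j, d2 (b i j) = (b (i + 1) j - g * b (i - 1) j) + (b i (j + 1) - g * b i (j - 1)) -
      (b i 1 * b 0 j - a i 0 * c 1 j + b i 0 * b 1 j - a i 1 * c 0 j))
    (d1t : d1 τ = τ * a 0 1) (d2t : d2 τ = τ * (b 0 1 + b 1 0))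
    (d3t : d3 τ = τ * (a 0 2 + E * a 0 1 - c 0 1 + (E * a 0 1 + g * a (-1) 1))) :
    (d1 (d1 (d1 (d1 τ))) * τ - 4 * (d1 (d1 (d1 τ)) * d1 τ) + 6 * (d1 (d1 τ) * d1 (d1 τ)) -
        4 * (d1 τ * d1 (d1 (d1 τ))) + τ * d1 (d1 (d1 (d1 τ)))) -
      4 * (d1 (d3 τ) * τ - d1 τ * d3 τ - d3 τ * d1 τ + τ * d1 (d3 τ)) +
      3 * (d2 (d2 τ) * τ - 2 * (d2 τ * d2 τ) + τ * d2 (d2 τ)) =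
      24 * ((τ * (g + b 1 1)) * (τ * (1 - b 0 0)) - g * (τ * τ)) := by
  simp only [d1t, d2t, d3t, Derivation.leibniz, smul_eq_mul, map_add, map_sub, map_neg, d1a, d1b,
    d1c, d2b, d1E, d1g, mul_zero, add_zero]
  norm_num only []
  simp only [aa 1 0, aa 0 (-1), aa 1 (-1), cc 1 0, z0, z1]
  ring_nf

/-- The second and third Hirota equations in a differential ring. -/
theorem hirota_second_third (z0 : ∀ i, a i i = 0) (z1 : ∀ i, c i i = 0) (d1E : d1 E = 0)
    (d1g : d1 g = 0) (d2g : d2 g = 0) (d3g : d3 g = 0)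
    (aa : ∀ i j, a i j = -a j i) (cc : ∀ i j, c i j = -c j i)
    (d1a : ∀ i j, d1 (a i j) = -b j i + b i j - (a i 1 * a 0 j - a i 0 * a 1 j))
    (d1b : ∀ i j, d1 (b i j) = c i j + (a i (j + 1) + E * a i j + g * a i (j - 1)) -
      (a i 1 * b 0 j - a i 0 * b 1 j))
    (d1c : ∀ i j, d1 (c i j) = (b (i + 1) j + E * b i j + g * b (i - 1) j) -
      (b (j + 1) i + E * b j i + g * b (j - 1) i) - (-b 1 i * b 0 j + b 0 i * b 1 j))
    (d2b : ∀ i j, d2 (b i j) = (b (i + 1) j - g * b (i - 1) j) + (b i (j + 1) - g * b i (j - 1)) -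
      (b i 1 * b 0 j - a i 0 * c 1 j + b i 0 * b 1 j - a i 1 * c 0 j))
    (d3b : ∀ i j, d3 (b i j) = c (i + 1) j + E * c i j + g * c (i - 1) j +
      (a i (j + 2) + 2 * E * a i (j + 1) + (E ^ 2 + 2 * g) * a i j + 2 * E * g * a i (j - 1) +
        g ^ 2 * a i (j - 2)) -
      ((a i 2 + E * a i 1 + g * a i 0) * b 0 j - b i 1 * c 0 j +
        a i 1 * (b 1 j + E * b 0 j + g * b (-1) j) -
        a i 0 * (b 2 j + E * b 1 j + g * b 0 j) + b i 0 * c 1 j -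
        (a i 1 + E * a i 0 + g * a i (-1)) * b 1 j))
    (d1t : d1 τ = τ * a 0 1) (d2t : d2 τ = τ * (b 0 1 + b 1 0))
    (d3t : d3 τ = τ * (a 0 2 + E * a 0 1 - c 0 1 + (E * a 0 1 + g * a (-1) 1))) :
    (∀ F, F = τ * (g + b 1 1) →
      (d1 (d1 (d1 F)) * τ - 3 * (d1 (d1 F) * d1 τ) + 3 * (d1 F * d1 (d1 τ)) -
        F * d1 (d1 (d1 τ))) + 2 * (d3 F * τ - F * d3 τ) -
        3 * (d1 (d2 F) * τ - d1 F * d2 τ - d2 F * d1 τ + F * d1 (d2 τ)) -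
        6 * E * (d1 F * τ - F * d1 τ) = 0) ∧
    (∀ F, F = τ * (1 - b 0 0) →
      (d1 (d1 (d1 F)) * τ - 3 * (d1 (d1 F) * d1 τ) + 3 * (d1 F * d1 (d1 τ)) -
        F * d1 (d1 (d1 τ))) + 2 * (d3 F * τ - F * d3 τ) +
        3 * (d1 (d2 F) * τ - d1 F * d2 τ - d2 F * d1 τ + F * d1 (d2 τ)) -
        6 * E * (d1 F * τ - F * d1 τ) = 0) := by
  refine ⟨?_, ?_⟩ <;> rintro F rfl
  all_goals
    simp only [d1t, d2t, d3t, Derivation.leibniz, smul_eq_mul, map_add, map_sub, map_neg, d1a, d1b,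
      d1c, d2b, d3b, d1E, d1g, d2g, d3g, mul_zero, add_zero, Derivation.map_one_eq_zero]
    norm_num only []
    simp only [map_zero, aa 1 0, aa 2 0, aa 2 1, aa 0 (-1), aa 1 (-1), aa 0 (-2), cc 1 0,
      cc 0 (-1), cc 2 1, z0, z1]
    ring_nf

end HirotaAlgebra

section Weights

variable {ι : Type*} [Fintype ι]

/-- The derivation of the power series ring that multiplies the variable `X i` by `w i`. -/
noncomputable def weightDer (w : ι → ℂ) :
    Derivation ℂ (MvPowerSeries ι ℂ) (MvPowerSeries ι ℂ) :=
  Derivation.mk'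
    { toFun := fun f m => (∑ i, m i * w i) * MvPowerSeries.coeff m f
      map_add' := fun f f' => by ext m; simp only [map_add, mul_add]; rfl
      map_smul' := fun r f => by
        ext m
        change (∑ i, m i * w i) * MvPowerSeries.coeff m (r • f) =
          r * ((∑ i, m i * w i) * MvPowerSeries.coeff m f)
        rw [MvPowerSeries.coeff_smul]; ring }
    (fun f f' => by
      classical
      ext m
      change (∑ i, m i * w i) * MvPowerSeries.coeff m (f * f') = MvPowerSeries.coeff m _
      rw [map_add, smul_eq_mul, smul_eq_mul, MvPowerSeries.coeff_mul, mul_comm f',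
        MvPowerSeries.coeff_mul, MvPowerSeries.coeff_mul, ← Finset.sum_add_distrib, Finset.mul_sum]
      refine Finset.sum_congr rfl fun p hp => ?_
      rw [Finset.HasAntidiagonal.mem_antidiagonal] at hp
      change _ = MvPowerSeries.coeff p.1 f * ((∑ i, p.2 i * w i) * MvPowerSeries.coeff p.2 f') +
        ((∑ i, p.1 i * w i) * MvPowerSeries.coeff p.1 f) * MvPowerSeries.coeff p.2 f'
      have : (∑ i, m i * w i) = (∑ i, p.1 i * w i) + ∑ i, p.2 i * w i := by
        rw [← Finset.sum_add_distrib, ← hp]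
        refine Finset.sum_congr rfl fun i _ => ?_
        rw [Finsupp.add_apply]; push_cast; ring
      rw [this]; ring)

theorem coeff_weightDer (w : ι → ℂ) (f : MvPowerSeries ι ℂ) (m : ι →₀ ℕ) :
    MvPowerSeries.coeff m (weightDer w f) = (∑ i, m i * w i) * MvPowerSeries.coeff m f := rfl

variable [DecidableEq ι]

theorem coeff_ind_weightDer (w : ι → ℂ) (f : MvPowerSeries ι ℂ) (I : Finset ι) :
    MvPowerSeries.coeff (ind I) (weightDer w f) =
      (∑ i ∈ I, w i) * MvPowerSeries.coeff (ind I) f := by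
  rw [coeff_weightDer]
  congr 1
  simp [ind_apply]

theorem weightDer_X (w : ι → ℂ) (i : ι) :
    weightDer w (MvPowerSeries.X i) = algebraMap ℂ _ (w i) * MvPowerSeries.X i := by
  ext m
  rw [coeff_weightDer, ← MvPowerSeries.c_eq_algebraMap, MvPowerSeries.coeff_C_mul,
    MvPowerSeries.coeff_X]
  split_ifs with h
  · subst h
    rw [Finset.sum_eq_single i (fun j _ hj => by simp [Ne.symm hj]) (by simp)]
    simp
  · simp

omit [Fintype ι] in
theorem coeff_ind_rescale (c : ι → ℂ) (f : MvPowerSeries ι ℂ) (I : Finset ι) :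
    MvPowerSeries.coeff (ind I) (MvPowerSeries.rescale c f) =
      (∏ i ∈ I, c i) * MvPowerSeries.coeff (ind I) f := by
  rw [MvPowerSeries.coeff_rescale]
  congr 1
  rw [Finsupp.prod_of_support_subset _ (s := I)]
  · refine Finset.prod_congr rfl fun i hi => ?_
    rw [ind_apply, if_pos hi, pow_one]
  · intro i hi
    rw [Finsupp.mem_support_iff, ind_apply] at hi
    by_contra h
    exact hi (if_neg h)
  · simp

omit [Fintype ι] in
theorem rescale_X (c : ι → ℂ) (i : ι) : MvPowerSeries.rescale c (MvPowerSeries.X i) =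
    algebraMap ℂ _ (c i) * MvPowerSeries.X i := by
  ext m
  rw [MvPowerSeries.coeff_rescale, ← MvPowerSeries.c_eq_algebraMap, MvPowerSeries.coeff_C_mul,
    MvPowerSeries.coeff_X]
  split_ifs with h
  · subst h; simp
  · simp

omit [Fintype ι] in
theorem rescale_algebraMap (c : ι → ℂ) (r : ℂ) : MvPowerSeries.rescale c (algebraMap ℂ _ r) =
    algebraMap ℂ (MvPowerSeries ι ℂ) r := by
  ext m
  rw [MvPowerSeries.coeff_rescale, ← MvPowerSeries.c_eq_algebraMap, MvPowerSeries.coeff_C]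
  split_ifs with h
  · subst h; simp
  · simp

end Weights

section CauchyMatrix

open Matrix

/-- The relations satisfied by the matrix `X` of values of the kernel at points with coordinates
`(k, K)` on the elliptic curve. -/
structure IsCauchyMatrix {N : Type*} (E g : ℂ) (k K : N → ℂ) (X : Matrix N N ℂ) : Prop where
  skew : Xᵀ = -X
  g_ne_zero : g ≠ 0
  ne_zero : ∀ s, K s ≠ 0
  curve : ∀ s, k s ^ 2 = K s + E + g / K s
  kernel_mul_add : ∀ s t, X s t * (k s + k t) = K s - K t
  kernel_mul_sub : ∀ s t, X s t * (K s * K t - g) = K s * K t * (k s - k t)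

variable {ι : Type*} [Fintype ι] [DecidableEq ι] (X : Matrix (ι × Bool) (ι × Bool) ℂ)

/-- A matrix of constants, over the power series ring. -/
noncomputable def constMatrix : Matrix (ι × Bool) (ι × Bool) (MvPowerSeries ι ℂ) :=
  X.map (algebraMap ℂ (MvPowerSeries ι ℂ))

/-- The square root of `det (1 + A X)` as a power series. -/
noncomputable def pairSeries : MvPowerSeries ι ℂ := (pairRoot X : MvPowerSeries ι ℂ)

variable {X}

theorem coeff_pairSeries (m : ι →₀ ℕ) :
    MvPowerSeries.coeff m (pairSeries X) = MvPolynomial.coeff m (pairRoot X) :=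
  MvPolynomial.coeff_coe _ _

omit [Fintype ι] [DecidableEq ι] in
theorem constMatrix_skew (hX : Xᵀ = -X) : (constMatrix X)ᵀ = -constMatrix X := by
  ext s t
  have := congrFun (congrFun hX s) t
  simp only [transpose_apply, Matrix.neg_apply] at this
  simp [constMatrix, this]

theorem pairSeries_sq (hX : Xᵀ = -X) : pairSeries X ^ 2 =
    (1 + constMatrix X * (pairForm (MvPowerSeries.X : ι → MvPowerSeries ι ℂ))).det := by
  have h := congrArg MvPolynomial.coeToMvPowerSeries.ringHom (pairRoot_spec hX).1
  rw [map_pow, map_pairDet, MvPolynomial.coeToMvPowerSeries.ringHom_apply] at h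
  rw [pairSeries, h, pairDet, det_one_add_mul_comm]
  congr 3
  · ext s t
    simp [constMatrix, MvPowerSeries.c_eq_algebraMap]
  · simp

theorem constantCoeff_pairSeries (hX : Xᵀ = -X) :
    MvPowerSeries.constantCoeff (pairSeries X) = 1 := by
  rw [← MvPowerSeries.coeff_zero_eq_constantCoeff_apply, coeff_pairSeries,
    ← MvPolynomial.constantCoeff_eq, (pairRoot_spec hX).2]

theorem isUnit_pairSeries (hX : Xᵀ = -X) : IsUnit (pairSeries X) := by
  rw [MvPowerSeries.isUnit_iff_constantCoeff, constantCoeff_pairSeries hX]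
  exact isUnit_one

theorem isUnit_det_constMatrix (hX : Xᵀ = -X) : IsUnit (1 + constMatrix X *
    (pairForm (MvPowerSeries.X : ι → MvPowerSeries ι ℂ))).det := by
  rw [← pairSeries_sq hX]
  exact (isUnit_pairSeries hX).pow 2

omit [Fintype ι] [DecidableEq ι] in
theorem isUnit_two_mvPowerSeries : IsUnit (2 : MvPowerSeries ι ℂ) := by
  rw [MvPowerSeries.isUnit_iff_constantCoeff, map_ofNat]
  exact IsUnit.mk0 _ two_ne_zero

omit [DecidableEq ι] in
theorem map_constMatrix (w : ι → ℂ) : (constMatrix X).map (weightDer w) = 0 := by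
  ext s t : 2
  simp [constMatrix]

theorem map_pairForm_X (p : ι × Bool → ℂ) :
    (pairForm (MvPowerSeries.X : ι → MvPowerSeries ι ℂ)).map
        (weightDer fun i => p (i, true) + p (i, false)) =
      diagonal (fun s => algebraMap ℂ (MvPowerSeries ι ℂ) (p s)) *
          (pairForm (MvPowerSeries.X : ι → MvPowerSeries ι ℂ)) +
              (pairForm (MvPowerSeries.X : ι → MvPowerSeries ι ℂ)) *
                  diagonal (fun s => algebraMap ℂ (MvPowerSeries ι ℂ) (p s)) := by
  refine Matrix.ext fun s t => ?_
  rcases s with ⟨i, s⟩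
  rcases t with ⟨j, t⟩
  rw [Matrix.add_apply, diagonal_mul, mul_diagonal, map_apply, pairForm_apply]
  by_cases hij : i = j
  · subst hij
    cases s <;> cases t <;> simp [weightDer_X] <;> ring
  · simp [hij]

/-- The form of the resolvent at the weights `X i`. -/
noncomputable def pairResolvent (X : Matrix (ι × Bool) (ι × Bool) ℂ) (f f' : ι × Bool → ℂ) :
    MvPowerSeries ι ℂ := resolventForm (pairForm MvPowerSeries.X) (constMatrix X) f f'

theorem weightDer_pairResolvent (hX : Xᵀ = -X) {n : ℕ} (p : ι × Bool → ℂ)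
    (b c : Fin n → ι × Bool → ℂ) (hB : ∀ s t, X s t * (p s + p t) = ∑ l, b l s * c l t)
    (f f' : ι × Bool → ℂ) :
    weightDer (fun i => p (i, true) + p (i, false)) (pairResolvent X f f') =
      pairResolvent X (p * f) f' + pairResolvent X f (p * f') -
        ∑ l, pairResolvent X f (b l) * pairResolvent X (c l) f' :=
  map_resolventForm _ (isUnit_det_constMatrix hX) (map_constMatrix _) p (map_pairForm_X p) b c
    (fun s t => by rw [← hB, map_mul]; rfl) f f'

theorem weightDer_pairSeries (hX : Xᵀ = -X) {n : ℕ} (p : ι × Bool → ℂ)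
    (b c : Fin n → ι × Bool → ℂ) (hB : ∀ s t, X s t * (p s + p t) =
        ∑ l, b l s * c l t) (v : MvPowerSeries ι ℂ)
    (hv : ∑ l, pairResolvent X (c l) (b l) = 2 * v) :
    weightDer (fun i => p (i, true) + p (i, false)) (pairSeries X) = pairSeries X * v := by
  have h := map_det_one_add_eq_sum (weightDer fun i => p (i, true) + p (i, false))
    (isUnit_det_constMatrix hX) (map_constMatrix _) p (map_pairForm_X p) b c
    (fun s t => by rw [← hB, map_mul]; rfl)
  rw [← pairSeries_sq hX] at h
  have h' : ∑ l, resolventForm (pairForm (MvPowerSeries.X :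
      ι → MvPowerSeries ι ℂ)) (constMatrix X) (c l) (b l) = 2 * v := hv
  rw [h', sq, Derivation.leibniz, smul_eq_mul] at h
  refine ((isUnit_two_mvPowerSeries (ι := ι)).mul (isUnit_pairSeries hX)).mul_left_cancel ?_
  linear_combination h

theorem pairResolvent_skew (hX : Xᵀ = -X) (f f' : ι × Bool → ℂ) :
    pairResolvent X f f' = -pairResolvent X f' f :=
  resolventForm_skew (pairForm_transpose _) (constMatrix_skew hX) (isUnit_det_constMatrix hX) f f'

theorem pairResolvent_self (hX : Xᵀ = -X) (f : ι × Bool → ℂ) : pairResolvent X f f = 0 :=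
  resolventForm_self isUnit_two_mvPowerSeries (pairForm_transpose _) (constMatrix_skew hX)
    (isUnit_det_constMatrix hX) f

theorem pairResolvent_add_left (f f₂ f' : ι × Bool → ℂ) :
    pairResolvent X (f + f₂) f' = pairResolvent X f f' + pairResolvent X f₂ f' :=
  resolventForm_add_left _ _ _

theorem pairResolvent_smul_left (r : ℂ) (f f' : ι × Bool → ℂ) :
    pairResolvent X (r • f) f' = algebraMap ℂ (MvPowerSeries ι ℂ) r * pairResolvent X f f' :=
  resolventForm_smul_left _ _ _

theorem pairResolvent_add_right (hX : Xᵀ = -X) (f f₂ f' : ι × Bool → ℂ) :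
    pairResolvent X f' (f + f₂) = pairResolvent X f' f + pairResolvent X f' f₂ := by
  rw [pairResolvent_skew hX, pairResolvent_add_left, pairResolvent_skew hX f,
    pairResolvent_skew hX f₂]; ring

theorem pairResolvent_smul_right (hX : Xᵀ = -X) (r : ℂ) (f f' : ι × Bool → ℂ) :
    pairResolvent X f' (r • f) = algebraMap ℂ (MvPowerSeries ι ℂ) r * pairResolvent X f' f := by
  rw [pairResolvent_skew hX, pairResolvent_smul_left, pairResolvent_skew hX f]; ring

/-- The change of the square root under a rescaling of the weights, when this amounts to a change of
`X` of rank two. -/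
theorem rescale_pairSeries (hX : Xᵀ = -X) (r : ℂ) (q : ι × Bool → ℂ) (b c : ι × Bool → ℂ)
    (hV : ∀ s t, X s t * (r * (q s * q t) - 1) = b s * c t - c s * b t) :
    MvPowerSeries.rescale (fun i => r * (q (i, true) * q (i, false))) (pairSeries X) =
      pairSeries X * (1 + pairResolvent X c b) := by
  have hu := isUnit_det_constMatrix hX
  set am := algebraMap ℂ (MvPowerSeries ι ℂ) with ham
  have hT : ∀ s t, MvPowerSeries.rescale (fun i => r * (q (i, true) *
      q (i, false))) (pairForm (MvPowerSeries.X : ι → MvPowerSeries ι ℂ) s t) =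
      am r * (am (q s) * pairForm (MvPowerSeries.X : ι → MvPowerSeries ι ℂ) s t * am (q t)) := by
    rintro ⟨i, s⟩ ⟨j, t⟩
    rw [pairForm_apply]
    by_cases hij : i = j
    · subst hij
      cases s <;> cases t <;> simp [rescale_X, ham] <;> ring
    · simp [hij]
  set Q : Matrix (ι × Bool) (ι × Bool) (MvPowerSeries ι ℂ) := diagonal fun s => am (q s) with hQ
  have hT' : (pairForm (MvPowerSeries.X : ι → MvPowerSeries ι ℂ)).map
      (MvPowerSeries.rescale fun i => r * (q (i, true) * q (i, false))) =
      am r • (Q * (pairForm (MvPowerSeries.X : ι → MvPowerSeries ι ℂ)) * Q) := by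
    refine Matrix.ext fun s t => ?_
    rw [map_apply, hT, Matrix.smul_apply, hQ, mul_diagonal, diagonal_mul, smul_eq_mul]
  have hV' : am r • (Q * constMatrix X * Q) = constMatrix X +
      (vecMulVec (fun s => am (b s)) (fun s => am (c s)) -
        vecMulVec (fun s => am (c s)) (fun s => am (b s))) := by
    refine Matrix.ext fun s t => ?_
    rw [Matrix.smul_apply, hQ, mul_diagonal, diagonal_mul, smul_eq_mul, Matrix.add_apply,
      Matrix.sub_apply, vecMulVec_apply, vecMulVec_apply]
    have h := congrArg am (hV s t)
    simp only [map_mul, map_sub, map_one] at h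
    have hc : constMatrix X s t = am (X s t) := rfl
    rw [hc]
    linear_combination h
  have key : (1 + constMatrix X * (am r • (Q * (pairForm (MvPowerSeries.X :
      ι → MvPowerSeries ι ℂ)) * Q))).det =
      (1 + (am r • (Q * constMatrix X * Q)) * (pairForm (MvPowerSeries.X :
          ι → MvPowerSeries ι ℂ))).det := by
    have e1 : constMatrix X * (am r • (Q * (pairForm (MvPowerSeries.X : ι → MvPowerSeries ι ℂ)) *
        Q)) = (am r • (constMatrix X * Q * (pairForm (MvPowerSeries.X : ι → MvPowerSeries ι ℂ)))) *
            Q := by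
      rw [Matrix.mul_smul, Matrix.smul_mul]; simp only [Matrix.mul_assoc]
    rw [e1, det_one_add_mul_comm, Matrix.mul_smul, Matrix.smul_mul]
    simp only [Matrix.mul_assoc]
  have : IsDomain (MvPowerSeries ι ℂ) := NoZeroDivisors.to_isDomain _
  have hR0 : ∀ s t, MvPowerSeries.constantCoeff (skewResolvent (pairForm (MvPowerSeries.X :
      ι → MvPowerSeries ι ℂ)) (constMatrix X) s t) = 0 := by
    intro s t
    rw [skewResolvent, pairForm_mul_apply]
    split_ifs <;> simp
  refine eq_of_sq_eq_sq_of_map_eq_one MvPowerSeries.constantCoeff two_ne_zero ?_ ?_ ?_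
  · rw [← map_pow, pairSeries_sq hX, RingHom.map_det, _root_.map_add, _root_.map_one,
        _root_.map_mul]
    simp only [RingHom.mapMatrix_apply]
    have hcm : (constMatrix X).map (MvPowerSeries.rescale fun i =>
        r * (q (i, true) * q (i, false))) = constMatrix X := by
      refine Matrix.ext fun s t => ?_
      rw [map_apply, constMatrix, map_apply, rescale_algebraMap]
    rw [hT', hcm, key, hV', mul_pow, pairSeries_sq hX, det_one_add_skew_update
      isUnit_two_mvPowerSeries (constMatrix_skew hX) (pairForm_transpose _) hu]
    rfl
  · rw [← MvPowerSeries.coeff_zero_eq_constantCoeff_apply, MvPowerSeries.coeff_rescale]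
    simp [constantCoeff_pairSeries hX]
  · rw [_root_.map_mul, constantCoeff_pairSeries hX, _root_.map_add, _root_.map_one, pairResolvent,
      resolventForm_eq_sum]
    simp [hR0]

end CauchyMatrix

section CauchyHirota

open Matrix

variable {ι : Type*} {X : Matrix (ι × Bool) (ι × Bool) ℂ} {E g : ℂ} {k K : ι × Bool → ℂ}

/-- The function `K ^ j` on the points. -/
noncomputable def powK (K : ι × Bool → ℂ) (j : ℤ) : ι × Bool → ℂ := fun s => K s ^ j

/-- The function `k K ^ j` on the points. -/
noncomputable def mulPowK (k K : ι × Bool → ℂ) (j : ℤ) : ι × Bool → ℂ := fun s => k s * K s ^ j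

theorem mul_powK (k K : ι × Bool → ℂ) (j : ℤ) : k * powK K j = mulPowK k K j := rfl

namespace IsCauchyMatrix

theorem mul_mulPowK (h : IsCauchyMatrix E g k K X) (j : ℤ) :
    k * mulPowK k K j = powK K (j + 1) + E • powK K j + g • powK K (j - 1) := by
  ext s
  simp only [powK, mulPowK, Pi.mul_apply, Pi.add_apply, Pi.smul_apply, smul_eq_mul]
  have hK := h.ne_zero s
  rw [zpow_add_one₀ hK, zpow_sub_one₀ hK]
  have := h.curve s
  field_simp at this ⊢
  linear_combination this

theorem two_mul_powK (h : IsCauchyMatrix E g k K X) (j : ℤ) :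
    (fun s => K s - g / K s) * powK K j = powK K (j + 1) + (-g) • powK K (j - 1) := by
  ext s
  simp only [powK, Pi.mul_apply, Pi.add_apply, Pi.smul_apply, smul_eq_mul]
  have hK := h.ne_zero s
  rw [zpow_add_one₀ hK, zpow_sub_one₀ hK]
  field_simp
  ring

theorem two_mul_mulPowK (h : IsCauchyMatrix E g k K X) (j : ℤ) :
    (fun s => K s - g / K s) * mulPowK k K j =
      mulPowK k K (j + 1) + (-g) • mulPowK k K (j - 1) := by
  rw [← mul_powK, ← mul_powK, ← mul_powK, mul_left_comm, h.two_mul_powK, mul_add, mul_smul_comm]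

theorem sq_mul_powK (h : IsCauchyMatrix E g k K X) (j : ℤ) :
    k ^ 2 * powK K j = powK K (j + 1) + E • powK K j + g • powK K (j - 1) := by
  rw [sq, mul_assoc, mul_powK, h.mul_mulPowK]

theorem cube_mul_powK (h : IsCauchyMatrix E g k K X) (j : ℤ) :
    (fun s => k s ^ 3) * powK K j =
      mulPowK k K (j + 1) + E • mulPowK k K j + g • mulPowK k K (j - 1) := by
  have e : (fun s => k s ^ 3) = k * k ^ 2 := by ext s; simp; ring
  rw [e, mul_assoc, h.sq_mul_powK]
  simp only [mul_add, mul_smul_comm, mul_powK]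

theorem cube_mul_mulPowK (h : IsCauchyMatrix E g k K X) (j : ℤ) :
    (fun s => k s ^ 3) * mulPowK k K j =
      powK K (j + 2) + (2 * E) • powK K (j + 1) + (E ^ 2 + 2 * g) • powK K j +
        (2 * E * g) • powK K (j - 1) + (g ^ 2) • powK K (j - 2) := by
  have e : (fun s => k s ^ 3) = k ^ 2 * k := by ext s; simp; ring
  rw [e, mul_assoc, h.mul_mulPowK]
  simp only [mul_add, mul_smul_comm, h.sq_mul_powK, smul_add, smul_smul]
  rw [show j + 1 + 1 = j + 2 by ring, show j + 1 - 1 = j by ring, show j - 1 + 1 = j by ring,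
    show j - 1 - 1 = j - 2 by ring]
  module

theorem rank_first (h : IsCauchyMatrix E g k K X) (s t : ι × Bool) :
    X s t * (k s + k t) =
      ∑ l, ![powK K 1, (-1 : ℂ) • powK K 0] l s * ![powK K 0, powK K 1] l t := by
  rw [h.kernel_mul_add]
  simp [Fin.sum_univ_succ, powK]
  ring

theorem rank_second (h : IsCauchyMatrix E g k K X) (s t : ι × Bool) :
    X s t * ((K s - g / K s) + (K t - g / K t)) =
      ∑ l, ![mulPowK k K 1, (-1 : ℂ) • powK K 1, mulPowK k K 0, (-1 : ℂ) • powK K 0] l s *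
        ![powK K 0, mulPowK k K 0, powK K 1, mulPowK k K 1] l t := by
  have h1 := h.kernel_mul_sub s t
  have hs := h.ne_zero s
  have ht := h.ne_zero t
  simp [Fin.sum_univ_succ, powK, mulPowK]
  field_simp
  linear_combination (K s + K t) * h1

theorem rank_third (h : IsCauchyMatrix E g k K X) (s t : ι × Bool) :
    X s t * (k s ^ 3 + k t ^ 3) =
      ∑ l, ![powK K 2 + E • powK K 1 + g • powK K 0, (-1 : ℂ) • mulPowK k K 1, powK K 1,
          (-1 : ℂ) • powK K 0, mulPowK k K 0,
          (-1 : ℂ) • (powK K 1 + E • powK K 0 + g • powK K (-1))] l s *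
        ![powK K 0, mulPowK k K 0, powK K 1 + E • powK K 0 + g • powK K (-1),
          powK K 2 + E • powK K 1 + g • powK K 0, mulPowK k K 1, powK K 1] l t := by
  have h1 := h.kernel_mul_add s t
  have hs := h.ne_zero s
  have ht := h.ne_zero t
  have h2 : K s + E + g * (K s)⁻¹ = k s ^ 2 := by rw [h.curve, div_eq_mul_inv]
  have h3 : K t + E + g * (K t)⁻¹ = k t ^ 2 := by rw [h.curve, div_eq_mul_inv]
  have h4 : K s ^ 2 + E * K s + g = K s * k s ^ 2 := by rw [← h2]; field_simp
  have h5 : K t ^ 2 + E * K t + g = K t * k t ^ 2 := by rw [← h3]; field_simp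
  have h6 : ∀ x : ℂ, x ^ (2 : ℤ) = x ^ 2 := fun x => by norm_cast
  simp [Fin.sum_univ_succ, powK, mulPowK, h6]
  linear_combination (k s ^ 2 - k s * k t + k t ^ 2) * h1 - h4 - K s * h3 + h5 + K t * h2

variable [Fintype ι] [DecidableEq ι]

/-- The derivation of the first flow. -/
noncomputable def der₁ (k : ι × Bool → ℂ) :
    Derivation ℂ (MvPowerSeries ι ℂ) (MvPowerSeries ι ℂ) :=
  weightDer fun i => k (i, true) + k (i, false)

/-- The derivation of the second flow. -/
noncomputable def der₂ (g : ℂ) (K : ι × Bool → ℂ) :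
    Derivation ℂ (MvPowerSeries ι ℂ) (MvPowerSeries ι ℂ) :=
  weightDer fun i => (K (i, true) - g / K (i, true)) + (K (i, false) - g / K (i, false))

/-- The derivation of the third flow. -/
noncomputable def der₃ (k : ι × Bool → ℂ) :
    Derivation ℂ (MvPowerSeries ι ℂ) (MvPowerSeries ι ℂ) :=
  weightDer fun i => k (i, true) ^ 3 + k (i, false) ^ 3

/-- Forms of the resolvent on the functions `K ^ i`. -/
noncomputable def fa (K : ι × Bool → ℂ) (X : Matrix (ι × Bool) (ι × Bool) ℂ) (i j : ℤ) :
    MvPowerSeries ι ℂ := pairResolvent X (powK K i) (powK K j)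

/-- Forms of the resolvent on the functions `K ^ i` and `k K ^ j`. -/
noncomputable def fb (k K : ι × Bool → ℂ) (X : Matrix (ι × Bool) (ι × Bool) ℂ) (i j : ℤ) :
    MvPowerSeries ι ℂ := pairResolvent X (powK K i) (mulPowK k K j)

/-- Forms of the resolvent on the functions `k K ^ i`. -/
noncomputable def fc (k K : ι × Bool → ℂ) (X : Matrix (ι × Bool) (ι × Bool) ℂ) (i j : ℤ) :
    MvPowerSeries ι ℂ := pairResolvent X (mulPowK k K i) (mulPowK k K j)

theorem fb_swap (h : IsCauchyMatrix E g k K X) (i j : ℤ) :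
    pairResolvent X (mulPowK k K i) (powK K j) = -fb k K X j i :=
  pairResolvent_skew h.skew _ _

theorem fa_fold (i j : ℤ) : pairResolvent X (powK K i) (powK K j) = fa K X i j := rfl

theorem fb_fold (i j : ℤ) : pairResolvent X (powK K i) (mulPowK k K j) = fb k K X i j := rfl

theorem fc_fold (i j : ℤ) : pairResolvent X (mulPowK k K i) (mulPowK k K j) = fc k K X i j := rfl

theorem der₁_fa (h : IsCauchyMatrix E g k K X) (i j : ℤ) :
    der₁ k (fa K X i j) = -fb k K X j i + fb k K X i j -
      (fa K X i 1 * fa K X 0 j - fa K X i 0 * fa K X 1 j) := by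
  refine (weightDer_pairResolvent h.skew k _ _ h.rank_first (powK K i) (powK K j)).trans ?_
  simp only [Fin.sum_univ_succ, Fin.sum_univ_zero, cons_val_zero, cons_val_succ, mul_powK,
    pairResolvent_smul_right h.skew, h.fb_swap, fa_fold, fb_fold, map_neg, map_one]
  ring

theorem der₁_fb (h : IsCauchyMatrix E g k K X) (i j : ℤ) :
    der₁ k (fb k K X i j) = fc k K X i j + (fa K X i (j + 1) + algebraMap ℂ _ E * fa K X i j +
      algebraMap ℂ _ g * fa K X i (j - 1)) - (fa K X i 1 * fb k K X 0 j - fa K X i 0 *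
          fb k K X 1 j) := by
  refine (weightDer_pairResolvent h.skew k _ _ h.rank_first (powK K i) (mulPowK k K j)).trans ?_
  simp only [Fin.sum_univ_succ, Fin.sum_univ_zero, cons_val_zero, cons_val_succ, mul_powK,
    h.mul_mulPowK, pairResolvent_add_right h.skew,
    pairResolvent_smul_right h.skew, fa_fold, fb_fold, fc_fold, map_neg, map_one]
  ring

theorem der₁_fc (h : IsCauchyMatrix E g k K X) (i j : ℤ) :
    der₁ k (fc k K X i j) = (fb k K X (i + 1) j + algebraMap ℂ _ E * fb k K X i j +
      algebraMap ℂ _ g * fb k K X (i - 1) j) - (fb k K X (j + 1) i + algebraMap ℂ _ E *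
          fb k K X j i +
      algebraMap ℂ _ g * fb k K X (j - 1) i) -
      (-fb k K X 1 i * fb k K X 0 j + fb k K X 0 i * fb k K X 1 j) := by
  refine (weightDer_pairResolvent h.skew k _ _ h.rank_first (mulPowK k K i) (mulPowK k K j)).trans
      ?_
  simp only [Fin.sum_univ_succ, Fin.sum_univ_zero, cons_val_zero, cons_val_succ,
    h.mul_mulPowK, pairResolvent_add_right h.skew, pairResolvent_add_left, pairResolvent_smul_left,
    pairResolvent_smul_right h.skew, h.fb_swap, fb_fold, map_neg, map_one]
  ring

theorem der₂_fb (h : IsCauchyMatrix E g k K X) (i j : ℤ) :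
    der₂ g K (fb k K X i j) = (fb k K X (i + 1) j - algebraMap ℂ _ g * fb k K X (i - 1) j) +
      (fb k K X i (j + 1) - algebraMap ℂ _ g * fb k K X i (j - 1)) -
      (fb k K X i 1 * fb k K X 0 j - fa K X i 0 * fc k K X 1 j + fb k K X i 0 * fb k K X 1 j -
        fa K X i 1 * fc k K X 0 j) := by
  refine (weightDer_pairResolvent h.skew _ _ _ h.rank_second (powK K i) (mulPowK k K j)).trans ?_
  simp only [Fin.sum_univ_succ, Fin.sum_univ_zero, cons_val_zero, cons_val_succ,
    h.two_mul_mulPowK, h.two_mul_powK, pairResolvent_add_right h.skew, pairResolvent_add_left,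
    pairResolvent_smul_left, pairResolvent_smul_right h.skew, fa_fold, fb_fold, fc_fold,
    map_neg, map_one]
  ring

theorem der₃_fb (h : IsCauchyMatrix E g k K X) (i j : ℤ) :
    der₃ k (fb k K X i j) = fc k K X (i + 1) j + algebraMap ℂ _ E * fc k K X i j +
      algebraMap ℂ _ g * fc k K X (i - 1) j + (fa K X i (j + 2) +
        2 * algebraMap ℂ _ E * fa K X i (j + 1) +
        (algebraMap ℂ _ E ^ 2 + 2 * algebraMap ℂ _ g) * fa K X i j +
        2 * algebraMap ℂ _ E * algebraMap ℂ _ g * fa K X i (j - 1) +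
        algebraMap ℂ _ g ^ 2 * fa K X i (j - 2)) -
      ((fa K X i 2 + algebraMap ℂ _ E * fa K X i 1 + algebraMap ℂ _ g * fa K X i 0) * fb k K X 0 j -
        fb k K X i 1 * fc k K X 0 j +
        fa K X i 1 * (fb k K X 1 j + algebraMap ℂ _ E * fb k K X 0 j +
          algebraMap ℂ _ g * fb k K X (-1) j) -
        fa K X i 0 * (fb k K X 2 j + algebraMap ℂ _ E * fb k K X 1 j +
          algebraMap ℂ _ g * fb k K X 0 j) + fb k K X i 0 * fc k K X 1 j -
        (fa K X i 1 + algebraMap ℂ _ E * fa K X i 0 + algebraMap ℂ _ g * fa K X i (-1)) *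
          fb k K X 1 j) := by
  refine (weightDer_pairResolvent h.skew _ _ _ h.rank_third (powK K i) (mulPowK k K j)).trans ?_
  simp only [Fin.sum_univ_succ, Fin.sum_univ_zero, cons_val_zero, cons_val_succ,
    h.cube_mul_powK, h.cube_mul_mulPowK, pairResolvent_add_right h.skew, pairResolvent_add_left,
    pairResolvent_smul_left, pairResolvent_smul_right h.skew, fa_fold, fb_fold, fc_fold,
    map_neg, map_one, map_mul, map_add, map_pow, map_ofNat]
  ring

theorem fa_self (h : IsCauchyMatrix E g k K X) (i : ℤ) : fa K X i i = 0 :=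
  pairResolvent_self h.skew _

theorem fc_self (h : IsCauchyMatrix E g k K X) (i : ℤ) : fc k K X i i = 0 :=
  pairResolvent_self h.skew _

theorem fa_skew (h : IsCauchyMatrix E g k K X) (i j : ℤ) : fa K X i j = -fa K X j i :=
  pairResolvent_skew h.skew _ _

theorem fc_skew (h : IsCauchyMatrix E g k K X) (i j : ℤ) : fc k K X i j = -fc k K X j i :=
  pairResolvent_skew h.skew _ _

theorem der₁_pairSeries (h : IsCauchyMatrix E g k K X) :
    der₁ k (pairSeries X) = pairSeries X * fa K X 0 1 := by
  refine weightDer_pairSeries h.skew k _ _ h.rank_first _ ?_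
  simp only [Fin.sum_univ_succ, Fin.sum_univ_zero, cons_val_zero, cons_val_succ,
    pairResolvent_smul_right h.skew, fa_fold, map_neg, map_one, h.fa_skew 1 0]
  ring

theorem der₂_pairSeries (h : IsCauchyMatrix E g k K X) :
    der₂ g K (pairSeries X) = pairSeries X * (fb k K X 0 1 + fb k K X 1 0) := by
  refine weightDer_pairSeries h.skew _ _ _ h.rank_second _ ?_
  simp only [Fin.sum_univ_succ, Fin.sum_univ_zero, cons_val_zero, cons_val_succ,
    pairResolvent_smul_right h.skew, h.fb_swap, fb_fold, map_neg, map_one]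
  ring

theorem der₃_pairSeries (h : IsCauchyMatrix E g k K X) :
    der₃ k (pairSeries X) = pairSeries X * (fa K X 0 2 + algebraMap ℂ _ E * fa K X 0 1 -
      fc k K X 0 1 + (algebraMap ℂ _ E * fa K X 0 1 + algebraMap ℂ _ g * fa K X (-1) 1)) := by
  refine weightDer_pairSeries h.skew _ _ _ h.rank_third _ ?_
  simp only [Fin.sum_univ_succ, Fin.sum_univ_zero, cons_val_zero, cons_val_succ,
    pairResolvent_add_right h.skew, pairResolvent_add_left, pairResolvent_smul_left,
    pairResolvent_smul_right h.skew, fa_fold, fc_fold, map_neg, map_one, h.fa_self,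
    h.fa_skew 1 0, h.fa_skew 2 0, h.fa_skew 1 (-1), h.fc_skew 1 0]
  ring

/-- The ring endomorphism of the shift `n ↦ n + 1`. -/
noncomputable def shiftUp (g : ℂ) (K : ι × Bool → ℂ) : MvPowerSeries ι ℂ →+* MvPowerSeries ι ℂ :=
  MvPowerSeries.rescale fun i => g⁻¹ * (K (i, true) * K (i, false))

/-- The ring endomorphism of the shift `n ↦ n - 1`. -/
noncomputable def shiftDown (g : ℂ) (K : ι × Bool → ℂ) : MvPowerSeries ι ℂ →+* MvPowerSeries ι ℂ :=
  MvPowerSeries.rescale fun i => g * ((K (i, true))⁻¹ * (K (i, false))⁻¹)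

theorem shiftUp_pairSeries (h : IsCauchyMatrix E g k K X) :
    algebraMap ℂ _ g * shiftUp g K (pairSeries X) =
      pairSeries X * (algebraMap ℂ _ g + fb k K X 1 1) := by
  have hg := h.g_ne_zero
  rw [shiftUp, rescale_pairSeries h.skew g⁻¹ K (g⁻¹ • mulPowK k K 1) (powK K 1),
    pairResolvent_smul_right h.skew, fb_fold]
  · have : algebraMap ℂ (MvPowerSeries ι ℂ) g * algebraMap ℂ _ g⁻¹ = 1 := by
      rw [← map_mul, mul_inv_cancel₀ hg, map_one]
    linear_combination pairSeries X * fb k K X 1 1 * this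
  · intro s t
    have := h.kernel_mul_sub s t
    simp [powK, mulPowK]
    field_simp
    linear_combination this

theorem shiftDown_pairSeries (h : IsCauchyMatrix E g k K X) :
    shiftDown g K (pairSeries X) = pairSeries X * (1 - fb k K X 0 0) := by
  rw [shiftDown, rescale_pairSeries h.skew g (fun s => (K s)⁻¹)
      ((-1 : ℂ) • mulPowK k K 0) (powK K 0),
    pairResolvent_smul_right h.skew, fb_fold, map_neg, map_one]
  · ring
  · intro s t
    have := h.kernel_mul_sub s t
    have hs := h.ne_zero s
    have ht := h.ne_zero t
    simp [powK, mulPowK]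
    field_simp
    linear_combination -this

end IsCauchyMatrix

end CauchyHirota

section CoefficientIdentities

namespace IsCauchyMatrix

variable {ι : Type*} [DecidableEq ι] {X : Matrix (ι × Bool) (ι × Bool) ℂ}
  {E g : ℂ} {k K : ι × Bool → ℂ}

/-- The total weight of the first flow on a set of pairs. -/
noncomputable def wt₁ (k : ι × Bool → ℂ) (I : Finset ι) : ℂ :=
  ∑ i ∈ I, (k (i, true) + k (i, false))

/-- The total weight of the second flow on a set of pairs. -/
noncomputable def wt₂ (g : ℂ) (K : ι × Bool → ℂ) (I : Finset ι) : ℂ :=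
  ∑ i ∈ I, ((K (i, true) - g / K (i, true)) + (K (i, false) - g / K (i, false)))

/-- The total weight of the third flow on a set of pairs. -/
noncomputable def wt₃ (k : ι × Bool → ℂ) (I : Finset ι) : ℂ :=
  ∑ i ∈ I, (k (i, true) ^ 3 + k (i, false) ^ 3)

/-- The factor of the shift of `n` on a set of pairs. -/
noncomputable def shiftFactor (g : ℂ) (K : ι × Bool → ℂ) (I : Finset ι) : ℂ :=
  ∏ i ∈ I, g⁻¹ * (K (i, true) * K (i, false))

variable [Fintype ι]

theorem coeff_der₁ (f : MvPowerSeries ι ℂ) (I : Finset ι) :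
    MvPowerSeries.coeff (ind I) (der₁ k f) = wt₁ k I * MvPowerSeries.coeff (ind I) f :=
  coeff_ind_weightDer _ _ _

theorem coeff_der₂ (f : MvPowerSeries ι ℂ) (I : Finset ι) :
    MvPowerSeries.coeff (ind I) (der₂ g K f) = wt₂ g K I * MvPowerSeries.coeff (ind I) f :=
  coeff_ind_weightDer _ _ _

theorem coeff_der₃ (f : MvPowerSeries ι ℂ) (I : Finset ι) :
    MvPowerSeries.coeff (ind I) (der₃ k f) = wt₃ k I * MvPowerSeries.coeff (ind I) f :=
  coeff_ind_weightDer _ _ _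

omit [Fintype ι] in
theorem coeff_shiftUp (f : MvPowerSeries ι ℂ) (I : Finset ι) :
    MvPowerSeries.coeff (ind I) (shiftUp g K f) =
      shiftFactor g K I * MvPowerSeries.coeff (ind I) f :=
  coeff_ind_rescale _ _ _

omit [Fintype ι] [DecidableEq ι] in
theorem shiftFactor_inv (I : Finset ι) :
    (shiftFactor g K I)⁻¹ = ∏ i ∈ I, g * ((K (i, true))⁻¹ * (K (i, false))⁻¹) := by
  rw [shiftFactor, ← Finset.prod_inv_distrib]
  refine Finset.prod_congr rfl fun i _ => ?_
  rw [mul_inv, mul_inv, inv_inv]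

omit [Fintype ι] in
theorem coeff_shiftDown (f : MvPowerSeries ι ℂ) (I : Finset ι) :
    MvPowerSeries.coeff (ind I) (shiftDown g K f) =
      (shiftFactor g K I)⁻¹ * MvPowerSeries.coeff (ind I) f := by
  rw [shiftFactor_inv]
  exact coeff_ind_rescale _ _ _

omit [Fintype ι] [DecidableEq ι] in
theorem coeff_ind_algebraMap_mul (r : ℂ) (f : MvPowerSeries ι ℂ) (I : Finset ι) :
    MvPowerSeries.coeff (ind I) (algebraMap ℂ _ r * f) = r * MvPowerSeries.coeff (ind I) f := by
  rw [← MvPowerSeries.c_eq_algebraMap, MvPowerSeries.coeff_C_mul]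

theorem sum_first (h : IsCauchyMatrix E g k K X) (J : Finset ι) :
    ∑ I ∈ J.powerset, ((wt₁ k I - wt₁ k (J \ I)) ^ 4 -
        4 * ((wt₁ k I - wt₁ k (J \ I)) * (wt₃ k I - wt₃ k (J \ I))) +
        3 * (wt₂ g K I - wt₂ g K (J \ I)) ^ 2 -
        24 * g * (shiftFactor g K I * (shiftFactor g K (J \ I))⁻¹ - 1)) *
      (MvPolynomial.coeff (ind I) (pairRoot X) * MvPolynomial.coeff (ind (J \ I)) (pairRoot X)) =
      0 := by
  have H := hirota_first (der₁ k) (der₂ g K) (der₃ k) (algebraMap ℂ (MvPowerSeries ι ℂ) E)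
    (algebraMap ℂ (MvPowerSeries ι ℂ) g) (fa K X) (fb k K X) (fc k K X) (pairSeries X)
    h.fa_self h.fc_self (Derivation.map_algebraMap _ _) (Derivation.map_algebraMap _ _)
    h.fa_skew h.fc_skew h.der₁_fa h.der₁_fb h.der₁_fc h.der₂_fb h.der₁_pairSeries h.der₂_pairSeries
    h.der₃_pairSeries
  rw [← h.shiftUp_pairSeries, ← h.shiftDown_pairSeries] at H
  have e4 : (4 : MvPowerSeries ι ℂ) = algebraMap ℂ _ 4 := (map_ofNat _ 4).symm
  have e6 : (6 : MvPowerSeries ι ℂ) = algebraMap ℂ _ 6 := (map_ofNat _ 6).symm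
  have e3 : (3 : MvPowerSeries ι ℂ) = algebraMap ℂ _ 3 := (map_ofNat _ 3).symm
  have e2 : (2 : MvPowerSeries ι ℂ) = algebraMap ℂ _ 2 := (map_ofNat _ 2).symm
  have e24 : (24 : MvPowerSeries ι ℂ) = algebraMap ℂ _ 24 := (map_ofNat _ 24).symm
  rw [e4, e6, e3, e2, e24, mul_assoc (algebraMap ℂ (MvPowerSeries ι ℂ) g)] at H
  have H' := congrArg (MvPowerSeries.coeff (ind J)) H
  simp only [map_add, map_sub, coeff_ind_algebraMap_mul] at H'
  simp only [coeff_ind_mul, coeff_der₁, coeff_der₂,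
    coeff_der₃, coeff_shiftUp, coeff_shiftDown, coeff_pairSeries] at H'
  rw [← sub_eq_zero] at H'
  rw [← H']
  simp only [Finset.mul_sum, ← Finset.sum_add_distrib, ← Finset.sum_sub_distrib]
  refine Finset.sum_congr rfl fun I _ => by ring

theorem sum_second (h : IsCauchyMatrix E g k K X) (J : Finset ι) :
    ∑ I ∈ J.powerset, ((wt₁ k I - wt₁ k (J \ I)) ^ 3 + 2 * (wt₃ k I - wt₃ k (J \ I)) -
        3 * ((wt₁ k I - wt₁ k (J \ I)) * (wt₂ g K I - wt₂ g K (J \ I))) -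
        6 * E * (wt₁ k I - wt₁ k (J \ I))) * shiftFactor g K I *
      (MvPolynomial.coeff (ind I) (pairRoot X) * MvPolynomial.coeff (ind (J \ I)) (pairRoot X)) =
      0 := by
  have H := (hirota_second_third (der₁ k) (der₂ g K) (der₃ k) (algebraMap ℂ (MvPowerSeries ι ℂ) E)
    (algebraMap ℂ (MvPowerSeries ι ℂ) g) (fa K X) (fb k K X) (fc k K X) (pairSeries X)
    h.fa_self h.fc_self (Derivation.map_algebraMap _ _) (Derivation.map_algebraMap _ _)
    (Derivation.map_algebraMap _ _) (Derivation.map_algebraMap _ _)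
    h.fa_skew h.fc_skew h.der₁_fa h.der₁_fb h.der₁_fc h.der₂_fb h.der₃_fb h.der₁_pairSeries
    h.der₂_pairSeries h.der₃_pairSeries).1 (algebraMap ℂ _ g *
        shiftUp g K (pairSeries X)) h.shiftUp_pairSeries
  have hF (I : Finset ι) : MvPowerSeries.coeff (ind I) (algebraMap ℂ _ g *
      shiftUp g K (pairSeries X)) =
      g * (shiftFactor g K I * MvPolynomial.coeff (ind I) (pairRoot X)) := by
    rw [coeff_ind_algebraMap_mul, coeff_shiftUp, coeff_pairSeries]
  generalize algebraMap ℂ _ g * shiftUp g K (pairSeries X) = F at H hF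
  have e6 : (6 : MvPowerSeries ι ℂ) = algebraMap ℂ _ 6 := (map_ofNat _ 6).symm
  have e3 : (3 : MvPowerSeries ι ℂ) = algebraMap ℂ _ 3 := (map_ofNat _ 3).symm
  have e2 : (2 : MvPowerSeries ι ℂ) = algebraMap ℂ _ 2 := (map_ofNat _ 2).symm
  rw [e6, e3, e2, mul_assoc (algebraMap ℂ (MvPowerSeries ι ℂ) 6)] at H
  have H' := congrArg (MvPowerSeries.coeff (ind J)) H
  simp only [map_add, map_sub, coeff_ind_algebraMap_mul] at H'
  simp only [coeff_ind_mul, coeff_der₁, coeff_der₂,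
    coeff_der₃, hF, coeff_pairSeries, map_zero] at H'
  refine (mul_eq_zero.1 ((?_ : g * _ = _).trans H')).resolve_left h.g_ne_zero
  simp only [Finset.mul_sum, ← Finset.sum_add_distrib, ← Finset.sum_sub_distrib]
  refine Finset.sum_congr rfl fun I _ => by ring

theorem sum_third (h : IsCauchyMatrix E g k K X) (J : Finset ι) :
    ∑ I ∈ J.powerset, ((wt₁ k I - wt₁ k (J \ I)) ^ 3 + 2 * (wt₃ k I - wt₃ k (J \ I)) +
        3 * ((wt₁ k I - wt₁ k (J \ I)) * (wt₂ g K I - wt₂ g K (J \ I))) -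
        6 * E * (wt₁ k I - wt₁ k (J \ I))) * (shiftFactor g K I)⁻¹ *
      (MvPolynomial.coeff (ind I) (pairRoot X) * MvPolynomial.coeff (ind (J \ I)) (pairRoot X)) =
      0 := by
  have H := (hirota_second_third (der₁ k) (der₂ g K) (der₃ k) (algebraMap ℂ (MvPowerSeries ι ℂ) E)
    (algebraMap ℂ (MvPowerSeries ι ℂ) g) (fa K X) (fb k K X) (fc k K X) (pairSeries X)
    h.fa_self h.fc_self (Derivation.map_algebraMap _ _) (Derivation.map_algebraMap _ _)
    (Derivation.map_algebraMap _ _) (Derivation.map_algebraMap _ _)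
    h.fa_skew h.fc_skew h.der₁_fa h.der₁_fb h.der₁_fc h.der₂_fb h.der₃_fb h.der₁_pairSeries
    h.der₂_pairSeries h.der₃_pairSeries).2 (shiftDown g K (pairSeries X)) h.shiftDown_pairSeries
  have e6 : (6 : MvPowerSeries ι ℂ) = algebraMap ℂ _ 6 := (map_ofNat _ 6).symm
  have e3 : (3 : MvPowerSeries ι ℂ) = algebraMap ℂ _ 3 := (map_ofNat _ 3).symm
  have e2 : (2 : MvPowerSeries ι ℂ) = algebraMap ℂ _ 2 := (map_ofNat _ 2).symm
  rw [e6, e3, e2, mul_assoc (algebraMap ℂ (MvPowerSeries ι ℂ) 6)] at H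
  have H' := congrArg (MvPowerSeries.coeff (ind J)) H
  simp only [map_add, map_sub, coeff_ind_algebraMap_mul] at H'
  simp only [coeff_ind_mul, coeff_der₁, coeff_der₂,
    coeff_der₃, coeff_shiftDown, coeff_pairSeries, map_zero] at H'
  rw [← H']
  simp only [Finset.mul_sum, ← Finset.sum_add_distrib, ← Finset.sum_sub_distrib]
  refine Finset.sum_congr rfl fun I _ => by ring

end IsCauchyMatrix

end CoefficientIdentities

section SkewIntegration

variable {α : Type*} [MeasurableSpace α] {μ : Measure α}

/-- If the complex measure `θ dμ` changes sign under the involution `s`, so do the integrals of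
bounded functions. -/
theorem integral_mul_comp_eq_neg {θ : α → ℂ} (hθ : Integrable θ μ) {s : α → α} (hs : Measurable s)
    (hskew : ∀ A : Set α, MeasurableSet A → ∫ p in s ⁻¹' A, θ p ∂μ = -∫ p in A, θ p ∂μ)
    {h : α → ℂ} (hm : Measurable h) {c : ℝ} (hc : ∀ p, ‖h p‖ ≤ c) :
    ∫ p, θ p * h (s p) ∂μ = -∫ p, θ p * h p ∂μ := by
  have hbd : ∀ f : α → ℂ, Measurable f → (∀ p, ‖f p‖ ≤ c) → Integrable (fun p => θ p * f p) μ :=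
    fun f hf hb => hθ.mul_bdd hf.aestronglyMeasurable (Filter.Eventually.of_forall hb)
  have hsimple : ∀ f : SimpleFunc α ℂ, ∫ p, θ p * f (s p) ∂μ = -∫ p, θ p * f p ∂μ := by
    intro f
    have hint : ∀ f : SimpleFunc α ℂ, Integrable (fun p => θ p * f p) μ ∧
        Integrable (fun p => θ p * f (s p)) μ := by
      intro f
      obtain ⟨C, hC⟩ := f.exists_forall_norm_le
      exact ⟨hθ.mul_bdd f.measurable.aestronglyMeasurable (Filter.Eventually.of_forall hC),
        hθ.mul_bdd (f.measurable.comp hs).aestronglyMeasurable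
          (Filter.Eventually.of_forall fun p => hC _)⟩
    induction f using SimpleFunc.induction with
    | const c hA =>
      rename_i A
      have e1 : ∀ p, θ p * (SimpleFunc.piecewise A hA (SimpleFunc.const α c)
          (SimpleFunc.const α 0)) p = A.indicator (fun p => θ p * c) p := by
        intro p
        by_cases hp : p ∈ A <;> simp [hp]
      have e2 : ∀ p, θ p * (SimpleFunc.piecewise A hA (SimpleFunc.const α c)
          (SimpleFunc.const α 0)) (s p) = (s ⁻¹' A).indicator (fun p => θ p * c) p := by
        intro p
        by_cases hp : s p ∈ A <;> simp [hp]
      simp_rw [e1, e2]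
      rw [integral_indicator hA, integral_indicator (hs hA), integral_mul_const,
        integral_mul_const, hskew A hA, neg_mul]
    | add _ hf hg =>
      rename_i f g _
      simp only [SimpleFunc.coe_add, Pi.add_apply, mul_add]
      rw [integral_add (hint f).2 (hint g).2, integral_add (hint f).1 (hint g).1, hf, hg, neg_add]
  have hsm : StronglyMeasurable h := hm.stronglyMeasurable
  rcases isEmpty_or_nonempty α with hα | ⟨⟨p₀⟩⟩
  · simp [Measure.eq_zero_of_isEmpty μ]
  have hc0 : 0 ≤ c := (norm_nonneg _).trans (hc p₀)
  have hlim : ∀ t : α → α, Measurable t → Filter.Tendsto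
      (fun n => ∫ p, θ p * hsm.approxBounded c n (t p) ∂μ) Filter.atTop
      (nhds (∫ p, θ p * h (t p) ∂μ)) := by
    intro t ht
    refine tendsto_integral_of_dominated_convergence (fun p => ‖θ p‖ * c) (fun n => ?_)
      (hθ.norm.mul_const c) (fun n => ?_) ?_
    · exact hθ.aestronglyMeasurable.mul
        (((hsm.approxBounded c n).measurable.comp ht).aestronglyMeasurable)
    · refine Filter.Eventually.of_forall fun p => ?_
      rw [norm_mul]
      exact mul_le_mul_of_nonneg_left (hsm.norm_approxBounded_le hc0 n _) (norm_nonneg _)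
    · exact Filter.Eventually.of_forall fun p =>
        (hsm.tendsto_approxBounded_of_norm_le (hc (t p))).const_mul _
  refine tendsto_nhds_unique (hlim s hs) ?_
  simp_rw [hsimple]
  exact (hlim id measurable_id).neg

variable [SigmaFinite μ]

theorem integral_pi_mul_comp_update {θ : α → ℂ} (hθ : Integrable θ μ) {s : α → α}
    (hs : Measurable s)
    (hskew : ∀ A : Set α, MeasurableSet A → ∫ p in s ⁻¹' A, θ p ∂μ = -∫ p in A, θ p ∂μ) {m : ℕ}
    {h : (Fin m → α) → ℂ} (hm : Measurable h) {c : ℝ} (hc : ∀ p, ‖h p‖ ≤ c) (i : Fin m) :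
    ∫ p, (∏ a, θ (p a)) * h (Function.update p i (s (p i))) ∂(Measure.pi fun _ => μ) =
      -∫ p, (∏ a, θ (p a)) * h p ∂(Measure.pi fun _ => μ) := by
  obtain ⟨m, rfl⟩ : ∃ m', m = m' + 1 := ⟨m - 1, by have := i.pos; omega⟩
  have hprod : Integrable (fun p : Fin (m + 1) → α => ∏ a, θ (p a)) (Measure.pi fun _ => μ) :=
    Integrable.fintype_prod fun _ => hθ
  have hup : Measurable fun p : Fin (m + 1) → α => Function.update p i (s (p i)) := by
    refine measurable_pi_lambda _ fun a => ?_
    by_cases ha : a = i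
    · subst ha
      simpa [Function.comp_def] using hs.comp (measurable_pi_apply a)
    · simpa [ha] using measurable_pi_apply a
  set e := MeasurableEquiv.piFinSuccAbove (fun _ : Fin (m + 1) => α) i
  have mp := measurePreserving_piFinSuccAbove (fun _ : Fin (m + 1) => μ) i
  have key : ∀ H : (Fin (m + 1) → α) → ℂ, Measurable H → (∀ p, ‖H p‖ ≤ c) →
      ∫ p, (∏ a, θ (p a)) * H p ∂(Measure.pi fun _ => μ) =
        ∫ q : Fin m → α, (∏ a, θ (q a)) * ∫ z, θ z * H (i.insertNth z q) ∂μ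
          ∂(Measure.pi fun _ => μ) := by
    intro H hH hHc
    have hI : Integrable (fun p : Fin (m + 1) → α => (∏ a, θ (p a)) * H p)
        (Measure.pi fun _ => μ) :=
      hprod.mul_bdd hH.aestronglyMeasurable (Filter.Eventually.of_forall hHc)
    have h1 := mp.symm.integral_comp' (fun p : Fin (m + 1) → α => (∏ a, θ (p a)) * H p)
    rw [← h1, integral_prod_symm]
    · refine integral_congr_ae (Filter.Eventually.of_forall fun q => ?_)
      simp only
      rw [← integral_const_mul]
      refine integral_congr_ae (Filter.Eventually.of_forall fun z => ?_)
      simp only [MeasurableEquiv.piFinSuccAbove_symm_apply, Fin.insertNthEquiv_apply]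
      rw [Fin.prod_univ_succAbove _ i, Fin.insertNth_apply_same]
      simp only [Fin.insertNth_apply_succAbove]
      rw [show (Fin.insertNthEquiv (fun _ => α) i) (z, q) = i.insertNth z q from rfl]
      ring
    · exact (mp.symm.integrable_comp_emb (MeasurableEquiv.measurableEmbedding _)).2 hI
  rw [key (fun p => h (Function.update p i (s (p i)))) (hm.comp hup) fun p => hc _, key _ hm hc,
      ← integral_neg]
  refine integral_congr_ae (Filter.Eventually.of_forall fun q => ?_)
  simp only [Fin.insertNth_apply_same, Fin.update_insertNth]
  rw [integral_mul_comp_eq_neg hθ hs hskew (h := fun z => h (i.insertNth z q)) _ fun p => hc _,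
    mul_neg]
  exact hm.comp (measurable_pi_iff.2 fun a => by
    refine Fin.succAboveCases i ?_ (fun b => ?_) a
    · simpa using measurable_id'
    · simp)

/-- Apply the map `s` to the coordinates in the set `I`. -/
def mapOn {ι : Type*} [DecidableEq ι] (s : α → α) (I : Finset ι) (p : ι → α) : ι → α :=
  fun a => if a ∈ I then s (p a) else p a

omit [MeasurableSpace α] in
theorem mapOn_insert {ι : Type*} [DecidableEq ι] (s : α → α) {I : Finset ι} {i : ι} (hi : i ∉ I)
    (p : ι → α) : mapOn s (insert i I) p = mapOn s I (Function.update p i (s (p i))) := by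
  ext a
  by_cases ha : a = i
  · subst ha; simp [mapOn, hi]
  · simp [mapOn, ha]

theorem measurable_mapOn {ι : Type*} [DecidableEq ι] {s : α → α} (hs : Measurable s)
    (I : Finset ι) : Measurable (mapOn s I : (ι → α) → ι → α) := by
  refine measurable_pi_lambda _ fun a => ?_
  by_cases ha : a ∈ I
  · simpa [mapOn, ha, Function.comp_def] using hs.comp (measurable_pi_apply a)
  · simpa [mapOn, ha] using measurable_pi_apply a

theorem integral_pi_mul_comp_mapOn {θ : α → ℂ} (hθ : Integrable θ μ) {s : α → α}
    (hs : Measurable s)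
    (hskew : ∀ A : Set α, MeasurableSet A → ∫ p in s ⁻¹' A, θ p ∂μ = -∫ p in A, θ p ∂μ) {m : ℕ}
    {h : (Fin m → α) → ℂ} (hm : Measurable h) {c : ℝ} (hc : ∀ p, ‖h p‖ ≤ c) (I : Finset (Fin m)) :
    ∫ p, (∏ a, θ (p a)) * h (mapOn s I p) ∂(Measure.pi fun _ => μ) =
      (-1) ^ I.card * ∫ p, (∏ a, θ (p a)) * h p ∂(Measure.pi fun _ => μ) := by
  induction I using Finset.induction_on with
  | empty =>
    have e : (mapOn s ∅ : (Fin m → α) → Fin m → α) = id := by ext p a; simp [mapOn]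
    simp [e]
  | insert i I hi ih =>
    simp only [mapOn_insert s hi]
    rw [integral_pi_mul_comp_update hθ hs hskew (h := fun p => h (mapOn s I p))
      (hm.comp (measurable_mapOn hs I)) (fun p => hc _) i, ih, Finset.card_insert_of_notMem hi]
    ring

end SkewIntegration

section ExpDecay

variable {Z Z' : Type*} [MeasurableSpace Z] [MeasurableSpace Z'] {ν : Measure Z} {ν' : Measure Z'}
  {N : Z → ℝ} {N' : Z' → ℝ} {f : Z → ℂ}

/-- The function `f` is integrable against all exponentials of the size function `N`. -/
def ExpDecay (N : Z → ℝ) (ν : Measure Z) (f : Z → ℂ) : Prop :=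
  ∀ r : ℝ, Integrable (fun z => (Real.exp (r * N z) : ℂ) * f z) ν

theorem ExpDecay.integrable (hf : ExpDecay N ν f) : Integrable f ν := by simpa using hf 0

theorem ExpDecay.mul (hf : ExpDecay N ν f) {w : Z → ℂ} (hw : AEStronglyMeasurable w ν) {C c : ℝ}
    (hle : ∀ᵐ z ∂ν, ‖w z‖ ≤ C * Real.exp (c * N z)) : ExpDecay N ν fun z => f z * w z := by
  intro r
  refine ((hf (r + c)).norm.const_mul C).mono' ?_ ?_
  · exact ((hf r).aestronglyMeasurable.mul hw).congr
      (Filter.Eventually.of_forall fun z => mul_assoc _ _ _)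
  · filter_upwards [hle] with z hz
    rw [norm_mul, norm_mul, norm_mul, Complex.norm_real, Complex.norm_real, Real.norm_eq_abs,
      Real.norm_eq_abs, Real.abs_exp, Real.abs_exp, add_mul, Real.exp_add]
    have h1 := mul_le_mul_of_nonneg_left hz
      (mul_nonneg (Real.exp_pos (r * N z)).le (norm_nonneg (f z)))
    nlinarith

theorem ExpDecay.prod [SFinite ν] [SFinite ν'] (hf : ExpDecay N ν f) {f' : Z' → ℂ}
    (hf' : ExpDecay N' ν' f') :
    ExpDecay (fun z : Z × Z' => N z.1 + N' z.2) (ν.prod ν') fun z => f z.1 * f' z.2 := by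
  intro r
  refine ((hf r).mul_prod (hf' r)).congr (Filter.Eventually.of_forall fun z => ?_)
  simp only [mul_add, Real.exp_add, Complex.ofReal_mul]
  ring

theorem ExpDecay.hasFDerivAt {E : Type*} [NormedAddCommGroup E] [NormedSpace ℂ E]
    (hf : ExpDecay N ν f) {L : Z → E →L[ℂ] ℂ} (hL : AEStronglyMeasurable L ν) {c : ℝ}
    (hle : ∀ᵐ z ∂ν, ‖L z‖ ≤ c * N z) (t₀ : E) :
    HasFDerivAt (fun t => ∫ z, f z * Complex.exp (L z t) ∂ν)
      (∫ z, (f z * Complex.exp (L z t₀)) • L z ∂ν) t₀ := by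
  have hfm := hf.integrable.aestronglyMeasurable
  have hLt : ∀ t, AEStronglyMeasurable (fun z => Complex.exp (L z t)) ν := fun t =>
    Complex.continuous_exp.comp_aestronglyMeasurable
      ((ContinuousLinearMap.apply ℂ ℂ t).continuous.comp_aestronglyMeasurable hL)
  have hexp : ∀ᵐ z ∂ν, ∀ t, ‖Complex.exp (L z t)‖ ≤ Real.exp (c * N z * ‖t‖) := by
    filter_upwards [hle] with z hz t
    rw [Complex.norm_exp]
    refine Real.exp_le_exp.2 ?_
    exact (Complex.re_le_norm _).trans (((L z).le_opNorm t).trans (by gcongr))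
  refine hasFDerivAt_integral_of_dominated_of_fderiv_le (s := Metric.ball t₀ 1)
    (F' := fun t z => (f z * Complex.exp (L z t)) • L z)
    (bound := fun z => ‖(Real.exp ((c * (‖t₀‖ + 1) + c) * N z) : ℂ) * f z‖)
    (Metric.ball_mem_nhds _ one_pos) (Filter.Eventually.of_forall fun t => hfm.mul (hLt t)) ?_
    ((hfm.mul (hLt t₀)).smul hL) ?_ (hf _).norm ?_
  · refine (hf.mul (hLt t₀) (C := 1) (c := c * ‖t₀‖) ?_).integrable
    filter_upwards [hexp] with z hz
    refine (hz t₀).trans (le_of_eq ?_)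
    rw [one_mul]; ring_nf
  · filter_upwards [hexp, hle] with z hz hz' t ht
    have h0 : 0 ≤ c * N z := (norm_nonneg _).trans hz'
    have h1 : ‖t‖ ≤ ‖t₀‖ + 1 := by
      have := norm_sub_norm_le t t₀
      rw [Metric.mem_ball, dist_eq_norm] at ht
      linarith
    rw [norm_smul, norm_mul, norm_mul, Complex.norm_real, Real.norm_eq_abs, Real.abs_exp, add_mul,
      Real.exp_add]
    have h2 : ‖Complex.exp (L z t)‖ ≤ Real.exp (c * (‖t₀‖ + 1) * N z) := by
      refine (hz t).trans (Real.exp_le_exp.2 ?_)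
      nlinarith
    have h3 : ‖L z‖ ≤ Real.exp (c * N z) :=
      hz'.trans (by linarith [Real.add_one_le_exp (c * N z)])
    calc ‖f z‖ * ‖Complex.exp (L z t)‖ * ‖L z‖
        ≤ ‖f z‖ * Real.exp (c * (‖t₀‖ + 1) * N z) * Real.exp (c * N z) := by gcongr
      _ = _ := by ring
  · refine Filter.Eventually.of_forall fun z t _ => ?_
    have := ((L z).hasFDerivAt (x := t)).cexp.const_mul (f z)
    rwa [smul_smul] at this

theorem ExpDecay.differentiable {E : Type*} [NormedAddCommGroup E] [NormedSpace ℂ E]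
    (hf : ExpDecay N ν f) {L : Z → E →L[ℂ] ℂ} (hL : AEStronglyMeasurable L ν) {c : ℝ}
    (hle : ∀ᵐ z ∂ν, ‖L z‖ ≤ c * N z) :
    Differentiable ℂ (fun t => ∫ z, f z * Complex.exp (L z t) ∂ν) :=
  fun t => (hf.hasFDerivAt hL hle t).differentiableAt

theorem ExpDecay.hasDerivAt (hf : ExpDecay N ν f) {w : Z → ℂ} (hw : AEStronglyMeasurable w ν)
    {c : ℝ} (hle : ∀ᵐ z ∂ν, ‖w z‖ ≤ c * N z) (a : ℂ) :
    HasDerivAt (fun t => ∫ z, f z * Complex.exp (w z * (t - a)) ∂ν) (∫ z, f z * w z ∂ν) a := by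
  have h := hf.hasFDerivAt (L := fun z => ContinuousLinearMap.toSpanSingleton ℂ (w z))
    ((ContinuousLinearMap.toSpanSingletonLIE ℂ ℂ).continuous.comp_aestronglyMeasurable hw)
    (c := c) (by simpa using hle) (a - a)
  have h' := (h.comp (f := fun t : ℂ => t - a) a
    ((hasFDerivAt_id (𝕜 := ℂ) a).sub_const a)).hasDerivAt
  simp only [sub_self, map_zero, Complex.exp_zero, mul_one] at h'
  have hint : Integrable (fun z => f z • ContinuousLinearMap.toSpanSingleton ℂ (w z)) ν := by
    have h2 := (ContinuousLinearMap.toSpanSingletonLIE ℂ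
        ℂ).toContinuousLinearEquiv.toContinuousLinearMap.integrable_comp
      (hf.mul hw (C := 1) (c := c) (by
        filter_upwards [hle] with z hz
        linarith [Real.add_one_le_exp (c * N z)])).integrable
    refine h2.congr (Filter.Eventually.of_forall fun z => ?_)
    ext
    simp
  refine (h'.congr_deriv ?_).congr_of_eventuallyEq (Filter.Eventually.of_forall fun t =>
    integral_congr_ae (Filter.Eventually.of_forall fun z => ?_))
  · rw [ContinuousLinearMap.comp_apply, ContinuousLinearMap.integral_apply hint]
    simp
  · simp [mul_comm]

end ExpDecay

section Config

variable {α : Type*} [MeasurableSpace α] (μ : Measure α) [SigmaFinite μ]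

/-- Finite configurations of points. -/
abbrev Config (α : Type*) := Σ m : ℕ, Fin m → α

/-- The configuration of `m` given points. -/
def toConfig {α : Type*} (m : ℕ) (p : Fin m → α) : Config α := ⟨m, p⟩

/-- The measure on configurations induced by a measure on points. -/
noncomputable def configMeasure : Measure (Config α) :=
  Measure.sum fun m => (Measure.pi fun _ : Fin m => μ).map (toConfig m)

instance : SFinite (configMeasure μ) := by unfold configMeasure; infer_instance

omit [SigmaFinite μ] in
variable (α) in
theorem measurable_toConfig (m : ℕ) : Measurable (toConfig m (α := α)) :=
  fun _ hs => MeasurableSpace.measurableSet_iInf.1 hs m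

theorem measurable_of_sigma {β : Type*} [MeasurableSpace β] {f : Config α → β}
    (hf : ∀ m, Measurable fun p : Fin m → α => f ⟨m, p⟩) : Measurable f := fun _ hs =>
  MeasurableSpace.measurableSet_iInf.2 fun m => hf m hs

variable {μ}

omit [SigmaFinite μ] in
theorem integral_map_toConfig {f : Config α → ℂ} (m : ℕ)
    (hf : AEStronglyMeasurable f ((Measure.pi fun _ : Fin m => μ).map (toConfig m))) :
    ∫ z, f z ∂((Measure.pi fun _ : Fin m => μ).map (toConfig m)) =
      ∫ p : Fin m → α, f ⟨m, p⟩ ∂(Measure.pi fun _ => μ) :=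
  integral_map (measurable_toConfig α m).aemeasurable hf

omit [SigmaFinite μ] in
theorem hasSum_integral_configMeasure {f : Config α → ℂ} (hf : Integrable f (configMeasure μ)) :
    HasSum (fun m => ∫ p : Fin m → α, f ⟨m, p⟩ ∂(Measure.pi fun _ => μ))
      (∫ z, f z ∂(configMeasure μ)) := by
  have h := hasSum_integral_measure hf
  have e : ∀ m, _ := fun m => integral_map_toConfig (μ := μ) m
    (hf.mono_measure (Measure.le_sum _ m)).aestronglyMeasurable
  simp only [e] at h
  exact h

omit [SigmaFinite μ] in
theorem integrable_configMeasure {f : Config α → ℂ} (hf : Measurable f)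
    (h : ∀ m, Integrable (fun p : Fin m → α => f ⟨m, p⟩) (Measure.pi fun _ => μ)) {b : ℕ → ℝ}
    (hb : Summable b) (hle : ∀ m, ∫ p : Fin m → α, ‖f ⟨m, p⟩‖ ∂(Measure.pi fun _ => μ) ≤ b m) :
    Integrable f (configMeasure μ) := by
  refine integrable_sum_measure (fun m => ?_) (hb.of_nonneg_of_le (fun m => by positivity) fun m =>
      ?_)
  · rw [integrable_map_measure hf.aestronglyMeasurable (measurable_toConfig α m).aemeasurable]
    exact h m
  · rw [integral_map (measurable_toConfig α m).aemeasurable hf.norm.aestronglyMeasurable]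
    exact hle m

theorem prod_configMeasure : (configMeasure μ).prod (configMeasure μ) =
    Measure.sum fun n : ℕ × ℕ => ((Measure.pi fun _ : Fin n.1 => μ).prod
      (Measure.pi fun _ : Fin n.2 => μ)).map (Prod.map (toConfig n.1) (toConfig n.2)) := by
  rw [configMeasure, Measure.prod_sum]
  congr 1
  funext n
  exact Measure.map_prod_map _ _ (measurable_toConfig α n.1) (measurable_toConfig α n.2)

/-- The configuration of the points with indices in `I`. -/
def subConfig {M : ℕ} (I : Finset (Fin M)) (p : Fin M → α) : Config α :=
  ⟨I.card, fun a => p (I.orderEmbOfFin rfl a)⟩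

theorem measurePreserving_subConfig {M : ℕ} {m n : ℕ} (I : Finset (Fin M)) (hm : I.card = m)
    (hn : Iᶜ.card = n) :
    MeasurePreserving (fun p : Fin M → α => ((fun a => p (I.orderEmbOfFin hm a) : Fin m → α),
      (fun a => p (Iᶜ.orderEmbOfFin hn a) : Fin n → α))) (Measure.pi fun _ => μ)
      ((Measure.pi fun _ => μ).prod (Measure.pi fun _ => μ)) := by
  have h1 := measurePreserving_piCongrLeft (fun _ : Fin M => μ) (finSumEquivOfFinset hm hn)
  have h2 := measurePreserving_sumPiEquivProdPi (fun _ : Fin m ⊕ Fin n => μ)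
  have h3 := h2.comp h1.symm
  exact h3

theorem hasSum_integral_config_prod {G : Config α × Config α → ℂ}
    (hG : Integrable (fun z => ((z.1.1.factorial * z.2.1.factorial : ℕ) : ℂ)⁻¹ * G z)
      ((configMeasure μ).prod (configMeasure μ))) :
    HasSum (fun M : ℕ => ((M.factorial : ℕ) : ℂ)⁻¹ * ∫ p : Fin M → α,
        ∑ I ∈ (Finset.univ : Finset (Fin M)).powerset, G (subConfig I p, subConfig Iᶜ p)
          ∂(Measure.pi fun _ => μ))
      (∫ z, ((z.1.1.factorial * z.2.1.factorial : ℕ) : ℂ)⁻¹ * G z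
        ∂((configMeasure μ).prod (configMeasure μ))) := by
  rw [prod_configMeasure] at hG ⊢
  have hmeas : ∀ n : ℕ × ℕ, Measurable
      (Prod.map (toConfig n.1) (toConfig n.2) :
        (Fin n.1 → α) × (Fin n.2 → α) → Config α × Config α) := fun n =>
    (measurable_toConfig α n.1).prodMap (measurable_toConfig α n.2)
  have hint : ∀ n : ℕ × ℕ, Integrable (fun q : (Fin n.1 → α) × (Fin n.2 → α) =>
      G (⟨n.1, q.1⟩, ⟨n.2, q.2⟩)) ((Measure.pi fun _ => μ).prod (Measure.pi fun _ => μ)) := by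
    intro n
    have h := (hG.mono_measure (Measure.le_sum _ n)).comp_measurable (hmeas n)
    refine (h.const_mul ((n.1.factorial * n.2.factorial : ℕ) : ℂ)).congr
      (Filter.Eventually.of_forall fun q => ?_)
    have : ((n.1.factorial * n.2.factorial : ℕ) : ℂ) ≠ 0 := by
      exact_mod_cast (Nat.mul_pos n.1.factorial_pos n.2.factorial_pos).ne'
    simp only [Function.comp, Prod.map]
    exact mul_inv_cancel_left₀ this _
  have h := hasSum_integral_measure hG
  have h' := ((Finset.HasAntidiagonal.sigmaAntidiagonalEquivProd (A := ℕ)).hasSum_iff.2 h).sigma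
    fun M => hasSum_fintype _
  set A : ℕ → ℕ → ℂ := fun m n => ∫ q : (Fin m → α) × (Fin n → α), G (⟨m, q.1⟩, ⟨n, q.2⟩)
    ∂((Measure.pi fun _ => μ).prod (Measure.pi fun _ => μ)) with hA
  have hcongr : ∀ {u v : ℕ → ℂ} {c : ℂ}, (∀ n, u n = v n) → HasSum v c → HasSum u c :=
    fun h hv => by rwa [funext h]
  refine hcongr (fun M => ?_) h'
  have e1 : ∀ n : ℕ × ℕ, ∫ z, ((z.1.1.factorial * z.2.1.factorial : ℕ) : ℂ)⁻¹ * G z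
      ∂(((Measure.pi fun _ : Fin n.1 => μ).prod (Measure.pi fun _ : Fin n.2 => μ)).map
        (Prod.map (toConfig n.1) (toConfig n.2))) =
      ((n.1.factorial * n.2.factorial : ℕ) : ℂ)⁻¹ * A n.1 n.2 := by
    intro n
    rw [integral_map (hmeas n).aemeasurable
      (hG.mono_measure (Measure.le_sum _ n)).aestronglyMeasurable, hA, ← integral_const_mul]
    rfl
  have hsub : ∀ I : Finset (Fin M), Integrable (fun p : Fin M → α =>
      G (subConfig I p, subConfig Iᶜ p)) (Measure.pi fun _ => μ) ∧
      ∫ p : Fin M → α, G (subConfig I p, subConfig Iᶜ p) ∂(Measure.pi fun _ => μ) =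
        A I.card (M - I.card) := by
    intro I
    have hc : Iᶜ.card = M - I.card := by rw [Finset.card_compl, Fintype.card_fin]
    have mp := measurePreserving_subConfig (μ := μ) I rfl rfl
    refine ⟨mp.integrable_comp_of_integrable (hint (I.card, Iᶜ.card)), ?_⟩
    rw [← hc, hA]
    simp only
    rw [← mp.map_eq, integral_map mp.measurable.aemeasurable]
    · rfl
    · rw [mp.map_eq]
      exact (hint (I.card, Iᶜ.card)).aestronglyMeasurable
  have e2 : ∑ c : Finset.HasAntidiagonal.antidiagonal M, ((c.1.1.factorial *
      c.1.2.factorial : ℕ) : ℂ)⁻¹ *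
      A c.1.1 c.1.2 = ∑ c ∈ Finset.HasAntidiagonal.antidiagonal M,
        ((c.1.factorial * c.2.factorial : ℕ) : ℂ)⁻¹ * A c.1 c.2 :=
    Finset.sum_coe_sort (Finset.HasAntidiagonal.antidiagonal M) fun c =>
      ((c.1.factorial * c.2.factorial : ℕ) : ℂ)⁻¹ * A c.1 c.2
  simp only [Function.comp_apply, Finset.HasAntidiagonal.sigmaAntidiagonalEquivProd_apply, e1]
  rw [e2, integral_finsetSum _ fun I _ => (hsub I).1, Finset.sum_congr rfl fun I _ => (hsub I).2,
    Finset.sum_powerset_apply_card (fun m => A m (M - m)), Finset.card_univ, Fintype.card_fin,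
    Finset.Nat.sum_antidiagonal_eq_sum_range_succ
      (fun m n => ((m.factorial * n.factorial : ℕ) : ℂ)⁻¹ * A m n), Finset.mul_sum]
  refine Finset.sum_congr rfl fun m hm => ?_
  have hm' : m ≤ M := Nat.lt_succ_iff.1 (Finset.mem_range.1 hm)
  rw [← Nat.choose_mul_factorial_mul_factorial hm', nsmul_eq_mul, ← mul_assoc]
  congr 1
  have h1 : ((m.factorial * (M - m).factorial : ℕ) : ℂ) ≠ 0 := by
    exact_mod_cast (Nat.mul_pos m.factorial_pos (M - m).factorial_pos).ne'
  have h2 : ((M.choose m : ℕ) : ℂ) ≠ 0 := by exact_mod_cast (Nat.choose_pos hm').ne'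
  rw [mul_assoc, Nat.cast_mul (M.choose m), mul_inv, mul_right_comm, inv_mul_cancel₀ h2, one_mul]

end Config

section Amplitude

open Matrix

variable {ι β : Type*}

/-- The points of a family of pairs. -/
def pairPoint (p : ι → β × β) (s : ι × Bool) : β := if s.2 then (p s.1).2 else (p s.1).1

/-- The matrix of values of a kernel at the points of a family of pairs. -/
def kernelMatrix (Ω : β → β → ℂ) (p : ι → β × β) : Matrix (ι × Bool) (ι × Bool) ℂ :=
  Matrix.of fun s t => Ω (pairPoint p s) (pairPoint p t)

theorem kernelMatrix_skew {Ω : β → β → ℂ} (hΩ : ∀ a b, Ω a b = -Ω b a) (p : ι → β × β) :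
    (kernelMatrix Ω p)ᵀ = -kernelMatrix Ω p := by
  ext s t
  exact hΩ _ _

variable [Fintype ι] [DecidableEq ι]

/-- The coefficient of the square root of the Fredholm determinant of the kernel at a family of
pairs of points. -/
noncomputable def kernelPf (Ω : β → β → ℂ) (p : ι → β × β) : ℂ := pairPf (kernelMatrix Ω p)

theorem coeff_pairRoot_kernelMatrix {Ω : β → β → ℂ} (hΩ : ∀ a b, Ω a b = -Ω b a) {M : ℕ}
    (p : Fin M → β × β) (I : Finset (Fin M)) :
    MvPolynomial.coeff (ind I) (pairRoot (kernelMatrix Ω p)) = kernelPf Ω (subConfig I p).2 :=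
  coeff_pairRoot_image (e := I.orderEmbOfFin rfl) (I.orderEmbOfFin rfl).injective
    (kernelMatrix_skew hΩ p) I fun i => by
      rw [Finset.range_orderEmbOfFin, Finset.mem_coe]

theorem sum_kernelPf_mul {Ω : β → β → ℂ} (hΩ : ∀ a b, Ω a b = -Ω b a) {M : ℕ}
    (p : Fin M → β × β) :
    ∑ I ∈ (Finset.univ : Finset (Fin M)).powerset,
      kernelPf Ω (subConfig I p).2 * kernelPf Ω (subConfig Iᶜ p).2 =
    ∑ σ : Fin M → Bool, det (of fun a b => (if σ a then 1 else -1) *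
      Ω (pairPoint p (a, !σ a)) (pairPoint p (b, σ b))) := by
  have h := sum_coeff_pairRoot_mul (kernelMatrix_skew hΩ p) Finset.univ
  rw [coeff_ind_univ_pairDet] at h
  simp only [← Finset.compl_eq_univ_sdiff, coeff_pairRoot_kernelMatrix hΩ] at h
  exact h

theorem kernelPf_zero {Ω : β → β → ℂ} (hΩ : ∀ a b, Ω a b = -Ω b a) (p : Fin 0 → β × β) :
    kernelPf Ω p = 1 := by
  have h := (pairRoot_spec (kernelMatrix_skew hΩ p)).2
  rw [MvPolynomial.constantCoeff_eq] at h
  rw [kernelPf, pairPf, Finset.univ_eq_empty, ind_empty, h]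

variable [MeasurableSpace β]

omit [Fintype ι] [DecidableEq ι] in
theorem measurable_pairPoint (s : ι × Bool) : Measurable fun p : ι → β × β => pairPoint p s := by
  rcases s with ⟨i, _ | _⟩
  · exact measurable_fst.comp (measurable_pi_apply i)
  · exact measurable_snd.comp (measurable_pi_apply i)

theorem measurable_matrix_det {X : Type*} [MeasurableSpace X] {A : X → Matrix ι ι ℂ}
    (hA : ∀ i j, Measurable fun x => A x i j) : Measurable fun x => (A x).det := by
  simp only [det_apply]
  exact Finset.measurable_sum _ fun σ _ =>
    (Finset.measurable_prod _ fun i _ => hA _ _).const_smul _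

omit [MeasurableSpace β] in
theorem kernelPf_eq_sum {Ω : β → β → ℂ} (hΩ : ∀ a b, Ω a b = -Ω b a) {M : ℕ} (hM : M ≠ 0)
    (p : Fin M → β × β) :
    kernelPf Ω p = 2⁻¹ * (∑ σ : Fin M → Bool, det (of fun a b => (if σ a then 1 else -1) *
        Ω (pairPoint p (a, !σ a)) (pairPoint p (b, σ b))) -
      ∑ I ∈ ((Finset.univ : Finset (Fin M)).powerset.erase ∅).erase Finset.univ,
        kernelPf Ω (subConfig I p).2 * kernelPf Ω (subConfig Iᶜ p).2) := by
  have hne : (Finset.univ : Finset (Fin M)) ≠ ∅ := by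
    rw [← Finset.nonempty_iff_ne_empty]
    exact ⟨⟨0, Nat.pos_of_ne_zero hM⟩, Finset.mem_univ _⟩
  have hempty : kernelPf Ω (subConfig (∅ : Finset (Fin M)) p).2 = 1 := kernelPf_zero hΩ _
  have huniv : kernelPf Ω (subConfig (Finset.univ : Finset (Fin M)) p).2 = kernelPf Ω p := by
    rw [← coeff_pairRoot_kernelMatrix hΩ]; rfl
  rw [← sum_kernelPf_mul hΩ, ← Finset.add_sum_erase _ _ (Finset.mem_powerset.2
    (Finset.empty_subset _)), ← Finset.add_sum_erase _ _ (Finset.mem_erase.2 ⟨hne,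
    Finset.mem_powerset.2 (Finset.subset_univ _)⟩), Finset.compl_univ,
    Finset.compl_empty, hempty, huniv]
  ring

theorem measurable_subConfig_snd {M : ℕ} (I : Finset (Fin M)) :
    Measurable (β := Fin I.card → β × β) fun p : Fin M → β × β => (subConfig I p).2 :=
  measurable_pi_lambda _ fun a => measurable_pi_apply (I.orderEmbOfFin rfl a)

theorem measurable_kernelPf {Ω : β → β → ℂ} (hΩ : ∀ a b, Ω a b = -Ω b a)
    (hm : Measurable (Function.uncurry Ω)) (M : ℕ) :
    Measurable fun p : Fin M → β × β => kernelPf Ω p := by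
  induction M using Nat.strong_induction_on with
  | _ M ih =>
    by_cases hM : M = 0
    · subst hM
      simp only [kernelPf_zero hΩ]
      exact measurable_const
    simp_rw [kernelPf_eq_sum hΩ hM]
    refine ((Finset.measurable_sum _ fun σ _ => measurable_matrix_det fun a b => ?_).sub
      (Finset.measurable_sum _ fun I hI => ?_)).const_mul _
    · exact (hm.comp ((measurable_pairPoint _).prodMk (measurable_pairPoint _))).const_mul _
    · rw [Finset.mem_erase, Finset.mem_erase] at hI
      have h1 : I.card < M := by
        have := Finset.card_lt_card (Finset.ssubset_univ_iff.2 hI.1)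
        rwa [Finset.card_univ, Fintype.card_fin] at this
      have h2 : Iᶜ.card < M := by
        have := Finset.card_pos.2 (Finset.nonempty_iff_ne_empty.2 hI.2.1)
        rw [Finset.card_compl, Fintype.card_fin]
        omega
      exact ((ih _ h1).comp (measurable_subConfig_snd I)).mul
        ((ih _ h2).comp (measurable_subConfig_snd Iᶜ))

omit [MeasurableSpace β] in
theorem norm_kernelPf_div_factorial_le {Ω : β → β → ℂ} (hΩ : ∀ a b, Ω a b = -Ω b a) {B : ℝ}
    (hB : ∀ a b, ‖Ω a b‖ ≤ B) {M : ℕ} (p : Fin M → β × β) (x : ℝ) :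
    x ^ M * ‖kernelPf Ω p‖ / M.factorial ≤
      2⁻¹ * ((2⁻¹) ^ M + ((4 * Real.exp 1 * B ^ 2 + 1) * x ^ 2) ^ M / M.factorial) := by
  set D := 4 * Real.exp 1 * B ^ 2 + 1 with hD
  have hD0 : 0 < D := by positivity
  have hf : (0 : ℝ) < M.factorial := by exact_mod_cast M.factorial_pos
  have h1 := norm_pairPf_pow_four_le (kernelMatrix_skew hΩ p) (B := B) fun s t => hB _ _
  have h2 : ‖kernelPf Ω p‖ ^ 2 ≤ (2 * M * B ^ 2) ^ M := by
    rw [Fintype.card_fin] at h1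
    refine le_of_sq_le_sq ?_ (by positivity)
    rw [← pow_mul, ← pow_mul, mul_comm M 2]
    exact h1
  have h3 : ‖kernelPf Ω p‖ ^ 2 / M.factorial ≤ (2⁻¹ * D) ^ M := by
    have e := Real.pow_div_factorial_le_exp (M : ℝ) (Nat.cast_nonneg M) M
    calc ‖kernelPf Ω p‖ ^ 2 / M.factorial ≤ (2 * M * B ^ 2) ^ M / M.factorial := by gcongr
      _ = (2 * B ^ 2) ^ M * ((M : ℝ) ^ M / M.factorial) := by
        rw [show (2 * M * B ^ 2 : ℝ) = (2 * B ^ 2) * M by ring, mul_pow]; ring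
      _ ≤ (2 * B ^ 2) ^ M * Real.exp M := by gcongr
      _ = (2⁻¹ * (4 * Real.exp 1 * B ^ 2)) ^ M := by
        rw [← Real.exp_one_pow, ← mul_pow]; ring_nf
      _ ≤ (2⁻¹ * D) ^ M := by
        gcongr
        rw [hD]; linarith
  have h4 : ‖kernelPf Ω p‖ ^ 2 / M.factorial / D ^ M ≤ (2⁻¹) ^ M := by
    rw [div_le_iff₀ (by positivity), ← mul_pow]
    exact h3
  have h5 : 2 * (x ^ M * ‖kernelPf Ω p‖) ≤ ‖kernelPf Ω p‖ ^ 2 / D ^ M + D ^ M * (x ^ M) ^ 2 := by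
    have hDM : 0 < D ^ M := by positivity
    have := sq_nonneg (‖kernelPf Ω p‖ - D ^ M * x ^ M)
    rw [← sub_nonneg, show ‖kernelPf Ω p‖ ^ 2 / D ^ M + D ^ M * (x ^ M) ^ 2 -
      2 * (x ^ M * ‖kernelPf Ω p‖) = (‖kernelPf Ω p‖ - D ^ M * x ^ M) ^ 2 / D ^ M by
        field_simp; ring]
    positivity
  have h6 := div_le_div_of_nonneg_right h5 hf.le
  have h7 : (‖kernelPf Ω p‖ ^ 2 / D ^ M + D ^ M * (x ^ M) ^ 2) / M.factorial =
      ‖kernelPf Ω p‖ ^ 2 / M.factorial / D ^ M + (D * x ^ 2) ^ M / M.factorial := by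
    rw [mul_pow, ← pow_mul, ← pow_mul, mul_comm 2 M]; field_simp
  rw [h7] at h6
  have h8 : 2 * (x ^ M * ‖kernelPf Ω p‖) / M.factorial =
    2 * (x ^ M * ‖kernelPf Ω p‖ / M.factorial) := by ring
  linarith

end Amplitude

section FredholmSquare

open Matrix

variable {β : Type*} [MeasurableSpace β] {μ : Measure (β × β)} [SigmaFinite μ]
  {φ : β × β → ℂ} {Ω : β → β → ℂ}

/-- The weight of a configuration of pairs of points, without its combinatorial factor. -/
noncomputable def weight (φ : β × β → ℂ) (Ω : β → β → ℂ) (z : Config (β × β)) : ℂ :=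
  (1 / 2) ^ z.1 * ((∏ a, φ (z.2 a)) * kernelPf Ω z.2)

/-- The amplitude of a configuration of pairs of points. -/
noncomputable def amplitude (φ : β × β → ℂ) (Ω : β → β → ℂ) (z : Config (β × β)) : ℂ :=
  ((z.1.factorial : ℕ) : ℂ)⁻¹ * weight φ Ω z

theorem measurable_amplitude (hφ : Measurable φ) (hΩ : ∀ a b, Ω a b = -Ω b a)
    (hm : Measurable (Function.uncurry Ω)) : Measurable (amplitude φ Ω) := by
  refine measurable_of_sigma fun m => ?_
  change Measurable fun p : Fin m → β × β =>
    ((m.factorial : ℕ) : ℂ)⁻¹ * ((1 / 2) ^ m * ((∏ a, φ (p a)) * kernelPf Ω p))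
  refine ((Measurable.mul ?_ (measurable_kernelPf hΩ hm m)).const_mul _).const_mul _
  exact Finset.measurable_prod _ fun a _ => hφ.comp (measurable_pi_apply a)

theorem expDecay_amplitude (hφi : Integrable φ μ) (hφ : Measurable φ)
    (hΩ : ∀ a b, Ω a b = -Ω b a) (hm : Measurable (Function.uncurry Ω)) {B : ℝ}
    (hB : ∀ a b, ‖Ω a b‖ ≤ B) :
    ExpDecay (fun z : Config (β × β) => (z.1 : ℝ)) (configMeasure μ) (amplitude φ Ω) := by
  intro r
  set A := ∫ p, ‖φ p‖ ∂μ with hA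
  have hA0 : 0 ≤ A := integral_nonneg fun p => norm_nonneg _
  set T := A + 1 with hT
  have hT0 : 0 < T := by positivity
  set x := Real.exp r * (1 / 2) * T with hx
  set D := 4 * Real.exp 1 * B ^ 2 + 1 with hD
  set b : ℕ → ℝ := fun m => 2⁻¹ * ((2⁻¹) ^ m + (D * x ^ 2) ^ m / m.factorial) with hb
  have hprod : ∀ m : ℕ, Integrable (fun p : Fin m → β × β => ∏ a, φ (p a))
    (Measure.pi fun _ => μ) := fun m => Integrable.fintype_prod fun _ => hφi
  have hle : ∀ m (p : Fin m → β × β),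
      ‖(Real.exp (r * (m : ℝ)) : ℂ) * amplitude φ Ω ⟨m, p⟩‖ ≤
        b m * (T⁻¹) ^ m * ‖∏ a, φ (p a)‖ := by
    intro m p
    have h1 := norm_kernelPf_div_factorial_le hΩ hB p x
    rw [amplitude, weight, norm_mul, norm_mul, norm_mul, norm_mul, Complex.norm_real,
      Real.norm_eq_abs, Real.abs_exp, norm_inv, norm_pow, Complex.norm_natCast, mul_comm r,
      Real.exp_nat_mul]
    have e : ‖(1 / 2 : ℂ)‖ = 1 / 2 := by simp
    rw [e]
    have h2 : Real.exp r * (1 / 2) = x * T⁻¹ := by rw [hx]; field_simp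
    calc Real.exp r ^ m * ((m.factorial : ℝ)⁻¹ * ((1 / 2) ^ m * (‖∏ a, φ (p a)‖ * ‖kernelPf Ω p‖)))
        = (Real.exp r * (1 / 2)) ^ m * ‖kernelPf Ω p‖ / m.factorial * ‖∏ a, φ (p a)‖ := by
          rw [mul_pow]; ring
      _ = (x ^ m * ‖kernelPf Ω p‖ / m.factorial) * (T⁻¹) ^ m * ‖∏ a, φ (p a)‖ := by
          rw [h2, mul_pow]; ring
      _ ≤ _ := by gcongr
  have hmeas : Measurable fun z : Config (β × β) =>
      (Real.exp (r * (z.1 : ℝ)) : ℂ) * amplitude φ Ω z :=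
    (measurable_of_sigma fun m => (measurable_const :
      Measurable fun _ : Fin m → β × β => (Real.exp (r *
          (m : ℝ)) : ℂ))).mul (measurable_amplitude hφ hΩ hm)
  refine integrable_configMeasure hmeas (b := b) (fun m => ?_) ?_ fun m => ?_
  · refine ((hprod m).norm.const_mul (b m * (T⁻¹) ^ m)).mono'
      (hmeas.comp (measurable_toConfig _ m)).aestronglyMeasurable
      (Filter.Eventually.of_forall (hle m))
  · refine Summable.mul_left _ (Summable.add ?_ ?_)
    · exact summable_geometric_of_lt_one (by norm_num) (by norm_num)
    · exact Real.summable_pow_div_factorial _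
  · calc ∫ p : Fin m → β × β, ‖(Real.exp (r * (m : ℝ)) : ℂ) * amplitude φ Ω ⟨m, p⟩‖
          ∂(Measure.pi fun _ => μ)
        ≤ ∫ p : Fin m → β × β, b m * (T⁻¹) ^ m * ‖∏ a, φ (p a)‖ ∂(Measure.pi fun _ => μ) := by
          refine integral_mono_of_nonneg (Filter.Eventually.of_forall fun p => norm_nonneg _)
            ((hprod m).norm.const_mul _) (Filter.Eventually.of_forall (hle m))
      _ = b m * (T⁻¹ * A) ^ m := by
          simp_rw [norm_prod]
          rw [integral_const_mul, integral_fintype_prod_eq_pow (fun p => ‖φ p‖), Fintype.card_fin,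
            mul_pow, mul_assoc]
      _ ≤ b m * 1 := by
          have : T⁻¹ * A ≤ 1 := by
            rw [inv_mul_le_iff₀ hT0]; linarith
          gcongr
          exact pow_le_one₀ (by positivity) this
      _ = b m := mul_one _

omit [MeasurableSpace β] in
theorem weight_subConfig_mul {M : ℕ} (p : Fin M → β × β) (I : Finset (Fin M)) :
    weight φ Ω (subConfig I p) * weight φ Ω (subConfig Iᶜ p) =
      (1 / 2) ^ M * ((∏ a, φ (p a)) *
        (kernelPf Ω (subConfig I p).2 * kernelPf Ω (subConfig Iᶜ p).2)) := by
  have h : ∀ J : Finset (Fin M), ∏ a, φ ((subConfig J p).2 a) = ∏ i ∈ J, φ (p i) := by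
    intro J
    conv_rhs => rw [← Finset.map_orderEmbOfFin_univ J rfl, Finset.prod_map]
    rfl
  have hc : (subConfig I p).1 + (subConfig Iᶜ p).1 = M := by
    change I.card + Iᶜ.card = M
    rw [Finset.card_add_card_compl, Fintype.card_fin]
  have hpow : (1 / 2 : ℂ) ^ M = (1 / 2) ^ (subConfig I p).1 * (1 / 2) ^ (subConfig Iᶜ p).1 := by
    rw [← pow_add, hc]
  rw [weight, weight, h, h, ← Finset.prod_mul_prod_compl I, hpow]
  ring

theorem hasSum_integral_amplitude_mul {Q : Config (β × β) × Config (β × β) → ℂ}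
    (hQ : Integrable (fun z => amplitude φ Ω z.1 * amplitude φ Ω z.2 * Q z)
      ((configMeasure μ).prod (configMeasure μ))) :
    HasSum (fun M : ℕ => ((M.factorial : ℕ) : ℂ)⁻¹ * ∫ p : Fin M → β × β,
        (1 / 2) ^ M * ((∏ a, φ (p a)) * ∑ I ∈ (Finset.univ : Finset (Fin M)).powerset,
          kernelPf Ω (subConfig I p).2 * kernelPf Ω (subConfig Iᶜ p).2 *
            Q (subConfig I p, subConfig Iᶜ p)) ∂(Measure.pi fun _ => μ))
      (∫ z, amplitude φ Ω z.1 * amplitude φ Ω z.2 * Q z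
        ∂((configMeasure μ).prod (configMeasure μ))) := by
  have e : ∀ z : Config (β × β) × Config (β × β), amplitude φ Ω z.1 * amplitude φ Ω z.2 * Q z =
      ((z.1.1.factorial * z.2.1.factorial : ℕ) : ℂ)⁻¹ *
        (weight φ Ω z.1 * weight φ Ω z.2 * Q z) := by
    intro z
    rw [amplitude, amplitude, Nat.cast_mul, mul_inv]; ring
  simp only [e] at hQ ⊢
  have h := hasSum_integral_config_prod hQ
  simp only [weight_subConfig_mul] at h
  convert h using 5 with M p
  rw [Finset.mul_sum, Finset.mul_sum]
  refine Finset.sum_congr rfl fun I _ => by ring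

omit [MeasurableSpace β] in
theorem det_eq_det_mapOn (hΩ : ∀ a b, Ω a b = -Ω b a) {M : ℕ} (p : Fin M → β × β)
    (σ : Fin M → Bool) :
    det (of fun a b => (if σ a then 1 else -1) * Ω (pairPoint p (a, !σ a)) (pairPoint p (b, σ b))) =
      (-1) ^ (Finset.univ.filter fun a => σ a = true).card *
        det (of fun a b => Ω (mapOn Prod.swap (Finset.univ.filter fun a => σ a = true) p b).1
          (mapOn Prod.swap (Finset.univ.filter fun a => σ a = true) p a).2) := by
  have e : (-1 : ℂ) ^ (Finset.univ.filter fun a => σ a = true).card =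
      ∏ a, if σ a = true then (-1 : ℂ) else 1 := by
    rw [Finset.prod_ite]; simp
  rw [e, ← det_mul_column]
  congr 1
  ext a b
  simp only [of_apply, mapOn, Finset.mem_filter, Finset.mem_univ, true_and]
  cases ha : σ a <;> cases hb : σ b <;> simp [pairPoint] <;> rw [hΩ] <;> simp

theorem norm_det_le {ι : Type*} [Fintype ι] [DecidableEq ι] {A : Matrix ι ι ℂ} {B : ℝ}
    (hA : ∀ i j, ‖A i j‖ ≤ B) : ‖A.det‖ ≤ (Fintype.card ι).factorial * B ^ Fintype.card ι := by
  rw [det_apply]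
  refine (norm_sum_le _ _).trans ?_
  have : ∀ σ : Equiv.Perm ι, ‖Equiv.Perm.sign σ • ∏ i, A (σ i) i‖ ≤ B ^ Fintype.card ι := by
    intro σ
    have h1 : ‖Equiv.Perm.sign σ • ∏ i, A (σ i) i‖ = ‖∏ i, A (σ i) i‖ := by
      rcases Int.units_eq_one_or (Equiv.Perm.sign σ) with h | h <;> rw [h] <;> simp
    rw [h1, norm_prod]
    refine (Finset.prod_le_prod (fun i _ => norm_nonneg _) fun i _ => hA _ _).trans ?_
    simp
  refine (Finset.sum_le_sum fun σ _ => this σ).trans ?_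
  simp [Fintype.card_perm]

theorem integral_sum_kernelPf_mul {θ : β × β → ℂ} (hθ : Integrable θ μ)
    (hskew : ∀ A : Set (β × β), MeasurableSet A →
      ∫ p in Prod.swap ⁻¹' A, θ p ∂μ = -∫ p in A, θ p ∂μ) {u : β → ℂ} (hu : Measurable u)
    {U : ℝ} (hU : ∀ a, ‖u a‖ ≤ U) (hΩ : ∀ a b, Ω a b = -Ω b a)
    (hm : Measurable (Function.uncurry Ω)) {B : ℝ} (hB : ∀ a b, ‖Ω a b‖ ≤ B) (M : ℕ) :
    ∫ p : Fin M → β × β, (1 / 2) ^ M * ((∏ a, θ (p a) * (u (p a).1 * u (p a).2)) *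
        ∑ I ∈ (Finset.univ : Finset (Fin M)).powerset,
          kernelPf Ω (subConfig I p).2 * kernelPf Ω (subConfig Iᶜ p).2) ∂(Measure.pi fun _ => μ) =
      ∫ p : Fin M → β × β, (∏ a, θ (p a) * (u (p a).1 * u (p a).2)) *
        det (of fun a b => Ω (p b).1 (p a).2) ∂(Measure.pi fun _ => μ) := by
  set h : (Fin M → β × β) → ℂ := fun p => (∏ a, u (p a).1 * u (p a).2) *
    det (of fun a b => Ω (p b).1 (p a).2) with hh
  have hp : ∀ a, Measurable fun p : Fin M → β × β => p a := fun a => measurable_pi_apply a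
  have hhm : Measurable h := by
    refine Measurable.mul (Finset.measurable_prod _ fun a _ => ?_)
      (measurable_matrix_det fun a b => ?_)
    · exact (hu.comp (hp a).fst).mul
        (hu.comp (hp a).snd)
    · exact hm.comp ((hp b).fst.prodMk
        (hp a).snd)
  have hhb : ∀ p, ‖h p‖ ≤ (U * U) ^ M * (M.factorial * B ^ M) := by
    intro p
    have h2 := norm_det_le (A := of fun a b => Ω (p b).1 (p a).2) (B := B) fun a b => hB _ _
    rw [Fintype.card_fin] at h2
    rw [hh, norm_mul, norm_prod]
    refine mul_le_mul ?_ h2 (norm_nonneg _) ?_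
    · refine (Finset.prod_le_prod (fun i _ => norm_nonneg _) (g := fun _ => U * U)
        fun i _ => ?_).trans (by simp)
      rw [norm_mul]
      exact mul_le_mul (hU _) (hU _) (norm_nonneg _) ((norm_nonneg _).trans (hU (p i).1))
    · refine pow_nonneg ?_ _
      rcases isEmpty_or_nonempty β with hβ | ⟨⟨b⟩⟩
      · exact mul_self_nonneg U
      · exact mul_self_nonneg U
  have hprod : Integrable (fun p : Fin M → β × β => ∏ a, θ (p a)) (Measure.pi fun _ => μ) :=
    Integrable.fintype_prod fun _ => hθ
  have key : ∀ I : Finset (Fin M),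
      ∫ p, (∏ a, θ (p a)) * ((-1) ^ I.card * h (mapOn Prod.swap I p)) ∂(Measure.pi fun _ => μ) =
        ∫ p, (∏ a, θ (p a)) * h p ∂(Measure.pi fun _ => μ) := by
    intro I
    simp_rw [mul_left_comm _ ((-1 : ℂ) ^ I.card)]
    rw [integral_const_mul, integral_pi_mul_comp_mapOn hθ measurable_swap hskew hhm hhb,
        ← mul_assoc,
      ← mul_pow]
    simp
  have hswap : ∀ (I : Finset (Fin M)) (p : Fin M → β × β),
      ∏ a, u (mapOn Prod.swap I p a).1 * u (mapOn Prod.swap I p a).2 =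
        ∏ a, u (p a).1 * u (p a).2 := by
    intro I p
    refine Finset.prod_congr rfl fun a _ => ?_
    by_cases ha : a ∈ I <;> simp [mapOn, ha, mul_comm]
  have e : ∀ p : Fin M → β × β, (1 / 2 : ℂ) ^ M * ((∏ a, θ (p a) * (u (p a).1 * u (p a).2)) *
      ∑ I ∈ (Finset.univ : Finset (Fin M)).powerset,
        kernelPf Ω (subConfig I p).2 * kernelPf Ω (subConfig Iᶜ p).2) =
      (1 / 2) ^ M * ∑ σ : Fin M → Bool, (∏ a, θ (p a)) *
        ((-1) ^ (Finset.univ.filter fun a => σ a = true).card *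
          h (mapOn Prod.swap (Finset.univ.filter fun a => σ a = true) p)) := by
    intro p
    rw [sum_kernelPf_mul hΩ, Finset.prod_mul_distrib, Finset.mul_sum]
    congr 1
    refine Finset.sum_congr rfl fun σ _ => ?_
    rw [det_eq_det_mapOn hΩ, hh]
    simp only [hswap]
    ring
  simp_rw [e]
  rw [integral_const_mul, integral_finsetSum]
  · simp_rw [key]
    rw [Finset.sum_const, Finset.card_univ, Fintype.card_fun, Fintype.card_bool, Fintype.card_fin,
      nsmul_eq_mul, ← mul_assoc]
    push_cast
    rw [← mul_pow]
    simp only [one_div, inv_mul_cancel₀ (two_ne_zero (α := ℂ)), one_pow, one_mul, hh]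
    refine integral_congr_ae (Filter.Eventually.of_forall fun p => ?_)
    simp only [Finset.prod_mul_distrib]
    ring
  · intro σ _
    refine hprod.mul_bdd (c := (U * U) ^ M * (M.factorial * B ^ M))
      ((hhm.comp (measurable_mapOn measurable_swap _)).const_mul _).aestronglyMeasurable
      (Filter.Eventually.of_forall fun p => ?_)
    rw [norm_mul, norm_pow, norm_neg, norm_one, one_pow, one_mul]
    exact hhb _

end FredholmSquare

namespace EllCurve

variable (E : EllCurve)

theorem sum_branch : E.e₁ + E.e₂ + E.e₃ = 0 := by
  linear_combination (1 / 8) * (E.branch 1 + E.branch (-1) - 2 * E.branch 0)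

theorem k_sq {κ : ℂ} (h : κ ∉ E.L.lattice) (hK : E.K κ ≠ 0) :
    E.k κ ^ 2 = E.K κ + 3 * E.e + E.g / E.K κ := by
  have h1 := (E.L.derivWeierstrassP_sq κ h).trans (E.branch (E.L.weierstrassP κ))
  have h2 := E.sum_branch
  have h3 : E.k κ = 1 / 2 * (E.L.derivWeierstrassP κ / E.K κ) := rfl
  have h4 : E.L.weierstrassP κ = E.K κ + E.e₁ := by rw [K, e]; ring
  rw [h3, g, e]
  rw [h4] at h1
  field_simp
  rw [h1]
  linear_combination (-4) * E.K κ ^ 2 * h2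

theorem kernel_skew (κ κ' : ℂ) : E.kernel κ κ' = -E.kernel κ' κ := by
  rw [kernel, kernel, add_comm (E.k κ') (E.k κ), mul_comm (E.K κ') (E.K κ)]
  split_ifs <;> rw [← neg_div, neg_sub]

variable {E}

theorem curve_mul {κ κ' : ℂ} (h : κ ∉ E.L.lattice) (hK : E.K κ ≠ 0) (h' : κ' ∉ E.L.lattice)
    (hK' : E.K κ' ≠ 0) : (E.K κ - E.K κ') * (E.K κ * E.K κ' - E.g) =
      E.K κ * E.K κ' * (E.k κ ^ 2 - E.k κ' ^ 2) := by
  rw [E.k_sq h hK, E.k_sq h' hK']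
  field_simp
  ring

theorem kernel_mul_add {κ κ' : ℂ} (h : κ ∉ E.L.lattice) (hK : E.K κ ≠ 0) (h' : κ' ∉ E.L.lattice)
    (hK' : E.K κ' ≠ 0) (hp : E.k κ + E.k κ' ≠ 0 ∨ E.K κ * E.K κ' ≠ E.g) :
    E.kernel κ κ' * (E.k κ + E.k κ') = E.K κ - E.K κ' := by
  rw [kernel]
  split_ifs with hs
  · exact div_mul_cancel₀ _ hs
  · rw [not_not] at hs
    have h1 := curve_mul h hK h' hK'
    have h2 : E.k κ ^ 2 - E.k κ' ^ 2 = 0 := by linear_combination (E.k κ - E.k κ') * hs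
    rw [h2, mul_zero] at h1
    have h3 : E.K κ * E.K κ' - E.g ≠ 0 := sub_ne_zero.2 (hp.resolve_left (not_not.2 hs))
    rw [hs, mul_zero, (mul_eq_zero.1 h1).resolve_right h3]

theorem kernel_mul_sub {κ κ' : ℂ} (h : κ ∉ E.L.lattice) (hK : E.K κ ≠ 0) (h' : κ' ∉ E.L.lattice)
    (hK' : E.K κ' ≠ 0) (hp : E.k κ + E.k κ' ≠ 0 ∨ E.K κ * E.K κ' ≠ E.g) :
    E.kernel κ κ' * (E.K κ * E.K κ' - E.g) = E.K κ * E.K κ' * (E.k κ - E.k κ') := by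
  rw [kernel]
  split_ifs with hs
  · have h1 := curve_mul h hK h' hK'
    rw [div_mul_eq_mul_div, div_eq_iff hs, h1]
    ring
  · have h3 : E.K κ * E.K κ' - E.g ≠ 0 := sub_ne_zero.2 (hp.resolve_left hs)
    have h4 : 1 - E.g / (E.K κ * E.K κ') = (E.K κ * E.K κ' - E.g) / (E.K κ * E.K κ') := by
      field_simp
    rw [h4]
    field_simp

variable (E)

theorem measurable_of_continuousOn_compl_lattice {f : ℂ → ℂ}
    (hf : ContinuousOn f (E.L.lattice : Set ℂ)ᶜ) (h0 : ∀ κ ∈ E.L.lattice, f κ = 0) :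
    Measurable f := by
  classical
  have hL : MeasurableSet (E.L.lattice : Set ℂ)ᶜ := E.L.isClosed_lattice.measurableSet.compl
  have h := hf.measurable_piecewise (g := fun _ => (0 : ℂ)) continuousOn_const hL
  convert h using 1
  funext κ
  by_cases hκ : κ ∈ E.L.lattice <;> simp [Set.piecewise, hκ, h0]

theorem measurable_K : Measurable E.K := by
  refine Measurable.sub_const (E.measurable_of_continuousOn_compl_lattice
    E.L.differentiableOn_weierstrassP.continuousOn fun κ hκ => E.L.weierstrassP_coe ⟨κ, hκ⟩) _

theorem measurable_k : Measurable E.k := by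
  refine Measurable.const_mul (Measurable.div (E.measurable_of_continuousOn_compl_lattice
    E.L.differentiableOn_derivWeierstrassP.continuousOn
    fun κ hκ => E.L.derivWeierstrassP_coe ⟨κ, hκ⟩) E.measurable_K) _

theorem measurable_symbol (j : ℕ+) : Measurable fun κ => E.symbol κ j := by
  unfold symbol
  split_ifs
  · exact E.measurable_k.pow_const _
  · exact (E.measurable_K.pow_const _).sub ((measurable_const.div E.measurable_K).pow_const _)

theorem measurable_kernel : Measurable (Function.uncurry E.kernel) := by
  have hk : Measurable fun p : ℂ × ℂ => E.k p.1 + E.k p.2 :=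
    (E.measurable_k.comp measurable_fst).add (E.measurable_k.comp measurable_snd)
  have hK₁ : Measurable fun p : ℂ × ℂ => E.K p.1 := E.measurable_K.comp measurable_fst
  have hK₂ : Measurable fun p : ℂ × ℂ => E.K p.2 := E.measurable_K.comp measurable_snd
  have hk₁ : Measurable fun p : ℂ × ℂ => E.k p.1 := E.measurable_k.comp measurable_fst
  have hk₂ : Measurable fun p : ℂ × ℂ => E.k p.2 := E.measurable_k.comp measurable_snd
  unfold kernel Function.uncurry
  refine Measurable.ite ?_ ((hK₁.sub hK₂).div hk) ((hk₁.sub hk₂).div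
    (measurable_const.sub (measurable_const.div (hK₁.mul hK₂))))
  exact (hk (measurableSet_singleton 0)).compl

/-- The region of the spectral parameter in which the coordinates are bounded in terms of `R`. -/
def region (R : ℝ) : Set ℂ :=
  {κ | κ ∉ E.L.lattice ∧ E.K κ ≠ 0 ∧ ‖E.k κ‖ ≤ R ∧ ‖E.K κ‖ ≤ R ^ 2 ∧ ‖E.g / E.K κ‖ ≤ R ^ 2}

theorem measurableSet_region (R : ℝ) : MeasurableSet (E.region R) := by
  refine E.L.isClosed_lattice.measurableSet.compl.inter (MeasurableSet.inter ?_
    (MeasurableSet.inter ?_ (MeasurableSet.inter ?_ ?_)))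
  · exact (E.measurable_K (measurableSet_singleton 0)).compl
  · exact measurableSet_le E.measurable_k.norm measurable_const
  · exact measurableSet_le E.measurable_K.norm measurable_const
  · exact measurableSet_le (measurable_const.div E.measurable_K).norm measurable_const

variable {E}

theorem norm_symbol_le {R : ℝ} (hR : 0 ≤ R) {κ : ℂ} (hκ : κ ∈ E.region R) (j : ℕ+) :
    ‖E.symbol κ j‖ ≤ 2 * R ^ (j : ℕ) := by
  obtain ⟨-, -, h1, h2, h3⟩ := hκ
  rw [symbol]
  split_ifs with hj
  · rw [norm_pow]
    have := pow_le_pow_left₀ (norm_nonneg _) h1 (j : ℕ)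
    linarith [pow_nonneg hR (j : ℕ)]
  · have hj' : 2 * ((j : ℕ) / 2) = j := Nat.two_mul_div_two_of_even (Nat.not_odd_iff_even.1 hj)
    refine (norm_sub_le _ _).trans ?_
    rw [norm_pow, norm_pow]
    have e : R ^ (j : ℕ) = (R ^ 2) ^ ((j : ℕ) / 2) := by rw [← pow_mul, hj']
    rw [e]
    linarith [pow_le_pow_left₀ (norm_nonneg _) h2 ((j : ℕ) / 2),
      pow_le_pow_left₀ (norm_nonneg _) h3 ((j : ℕ) / 2)]

theorem summable_symbol_mul {R : ℝ} (hR : 0 ≤ R) {κ : ℂ} (hκ : κ ∈ E.region R) {x : ℕ+ → ℂ}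
    (hx : Summable fun j : ℕ+ => ‖x j‖ * R ^ (j : ℕ)) :
    Summable fun j : ℕ+ => ‖E.symbol κ j * x j‖ := by
  refine (hx.mul_left 2).of_nonneg_of_le (fun j => norm_nonneg _) fun j => ?_
  rw [norm_mul]
  have := mul_le_mul_of_nonneg_right (norm_symbol_le hR hκ j) (norm_nonneg (x j))
  linarith

variable (E)

/-- The symbol of a flow, restricted to a region of the spectral parameter. -/
noncomputable def regionSymbol (R : ℝ) (j : ℕ+) : ℂ → ℂ :=
  (E.region R).indicator fun κ => E.symbol κ j

/-- The plane wave factor, restricted to a region of the spectral parameter. -/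
noncomputable def wave (R : ℝ) (n : ℤ) (x : ℕ+ → ℂ) : ℂ → ℂ := (E.region R).indicator (E.rho n x)

theorem measurable_regionSymbol (R : ℝ) (j : ℕ+) : Measurable (E.regionSymbol R j) :=
  (E.measurable_symbol j).indicator (E.measurableSet_region R)

variable {E}

theorem norm_regionSymbol_le {R : ℝ} (hR : 0 ≤ R) (j : ℕ+) (κ : ℂ) :
    ‖E.regionSymbol R j κ‖ ≤ 2 * R ^ (j : ℕ) := by
  rw [regionSymbol]
  by_cases hκ : κ ∈ E.region R
  · rw [Set.indicator_of_mem hκ]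
    exact norm_symbol_le hR hκ j
  · rw [Set.indicator_of_notMem hκ, norm_zero]
    positivity

theorem measurable_wave {R : ℝ} (hR : 0 ≤ R) (n : ℤ) {x : ℕ+ → ℂ}
    (hx : Summable fun j : ℕ+ => ‖x j‖ * R ^ (j : ℕ)) : Measurable (E.wave R n x) := by
  have h1 : Measurable fun κ => ∑' j : ℕ+, E.regionSymbol R j κ * x j := by
    refine measurable_of_tendsto_metrizable' Filter.atTop
      (f := fun (s : Finset ℕ+) κ => ∑ j ∈ s, E.regionSymbol R j κ * x j)
      (fun s => Finset.measurable_sum _ fun j _ => (E.measurable_regionSymbol R j).mul_const _) ?_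
    rw [tendsto_pi_nhds]
    intro κ
    refine Summable.hasSum ?_
    by_cases hκ : κ ∈ E.region R
    · simp only [regionSymbol, Set.indicator_of_mem hκ]
      exact (summable_symbol_mul hR hκ hx).of_norm
    · simp only [regionSymbol, Set.indicator_of_notMem hκ, zero_mul]
      exact summable_zero
  have h2 : E.wave R n x = (E.region R).indicator fun κ =>
      Complex.exp (∑' j : ℕ+, E.regionSymbol R j κ * x j) * (E.K κ / E.sqrtg) ^ n := by
    funext κ
    by_cases hκ : κ ∈ E.region R
    · simp only [wave, regionSymbol, Set.indicator_of_mem hκ, rho]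
    · simp only [wave, Set.indicator_of_notMem hκ]
  rw [h2]
  refine Measurable.indicator ((Complex.measurable_exp.comp h1).mul ?_) (E.measurableSet_region R)
  exact (E.measurable_K.div_const _).pow_const n

theorem sqrtg_ne_zero : E.sqrtg ≠ 0 := by
  intro h
  have := E.sqrtg_sq
  rw [h, zero_pow two_ne_zero] at this
  exact E.g_ne_zero this.symm

theorem norm_zpow_le {z : ℂ} {V : ℝ} (h1 : ‖z‖ ≤ V) (h2 : ‖z⁻¹‖ ≤ V) (n : ℤ) :
    ‖z ^ n‖ ≤ V ^ n.natAbs := by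
  rcases Int.natAbs_eq n with h | h
  · rw [h, zpow_natCast, norm_pow, Int.natAbs_natCast]
    exact pow_le_pow_left₀ (norm_nonneg _) h1 _
  · rw [h, zpow_neg, zpow_natCast, ← inv_pow, norm_pow, Int.natAbs_neg, Int.natAbs_natCast]
    exact pow_le_pow_left₀ (norm_nonneg _) h2 _

theorem exists_norm_zpow_le (R : ℝ) (n : ℤ) :
    ∃ V, ∀ κ ∈ E.region R, ‖(E.K κ / E.sqrtg) ^ n‖ ≤ V := by
  refine ⟨(R ^ 2 / ‖E.sqrtg‖) ^ n.natAbs, fun κ hκ => norm_zpow_le ?_ ?_ n⟩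
  · rw [norm_div]
    exact div_le_div_of_nonneg_right hκ.2.2.2.1 (norm_nonneg _)
  · have h0 := sqrtg_ne_zero (E := E)
    have hK := hκ.2.1
    have e : (E.K κ / E.sqrtg)⁻¹ = E.g / E.K κ / E.sqrtg := by
      rw [g, ← E.sqrtg_sq]; field_simp
    rw [e, norm_div]
    exact div_le_div_of_nonneg_right hκ.2.2.2.2 (norm_nonneg _)

theorem exists_norm_wave_le {R : ℝ} (hR : 0 ≤ R) (n : ℤ) {x : ℕ+ → ℂ}
    (hx : Summable fun j : ℕ+ => ‖x j‖ * R ^ (j : ℕ)) : ∃ U, ∀ κ, ‖E.wave R n x κ‖ ≤ U := by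
  obtain ⟨V, hV⟩ := exists_norm_zpow_le (E := E) R n
  refine ⟨Real.exp (∑' j : ℕ+, 2 * (‖x j‖ * R ^ (j : ℕ))) * |V|, fun κ => ?_⟩
  rw [wave]
  by_cases hκ : κ ∈ E.region R
  · rw [Set.indicator_of_mem hκ, rho, norm_mul, Complex.norm_exp]
    refine mul_le_mul (Real.exp_le_exp.2 ?_) ((hV κ hκ).trans (le_abs_self V)) (norm_nonneg _)
      (Real.exp_pos _).le
    refine (Complex.re_le_norm _).trans ((norm_tsum_le_tsum_norm
      (summable_symbol_mul hR hκ hx)).trans ((summable_symbol_mul hR hκ hx).tsum_le_tsum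
        (fun j => ?_) (hx.mul_left 2)))
    rw [norm_mul]
    have := mul_le_mul_of_nonneg_right (norm_symbol_le hR hκ j) (norm_nonneg (x j))
    linarith
  · rw [Set.indicator_of_notMem hκ, norm_zero]
    positivity

theorem wave_update {R : ℝ} (hR : 0 ≤ R) (n : ℤ) {x : ℕ+ → ℂ}
    (hx : Summable fun j : ℕ+ => ‖x j‖ * R ^ (j : ℕ)) (i : ℕ+) (t : ℂ) (κ : ℂ) :
    E.wave R n (Function.update x i t) κ =
      E.wave R n x κ * Complex.exp (E.regionSymbol R i κ * (t - x i)) := by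
  rw [wave, wave, regionSymbol]
  by_cases hκ : κ ∈ E.region R
  · rw [Set.indicator_of_mem hκ, Set.indicator_of_mem hκ, Set.indicator_of_mem hκ, rho, rho,
      mul_right_comm, ← Complex.exp_add]
    have h1 := (summable_symbol_mul hR hκ hx).of_norm.hasSum
    have h2 := h1.update i (E.symbol κ i * t)
    have e : (fun j => E.symbol κ j * Function.update x i t j) =
        Function.update (fun j => E.symbol κ j * x j) i (E.symbol κ i * t) := by
      funext j
      by_cases hj : j = i
      · subst hj; simp
      · simp [hj]
    rw [e, h2.tsum_eq]
    congr 2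
    ring
  · rw [Set.indicator_of_notMem hκ, Set.indicator_of_notMem hκ, zero_mul]

theorem wave_add_one (R : ℝ) (n : ℤ) (x : ℕ+ → ℂ) (κ : ℂ) :
    E.wave R (n + 1) x κ = E.wave R n x κ * (E.K κ / E.sqrtg) := by
  rw [wave, wave]
  by_cases hκ : κ ∈ E.region R
  · rw [Set.indicator_of_mem hκ, Set.indicator_of_mem hκ, rho, rho, zpow_add_one₀, mul_assoc]
    exact div_ne_zero hκ.2.1 sqrtg_ne_zero
  · rw [Set.indicator_of_notMem hκ, Set.indicator_of_notMem hκ, zero_mul]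

end EllCurve

namespace EllCurve

variable {E : EllCurve}

theorem wave_sub_one (R : ℝ) (n : ℤ) (x : ℕ+ → ℂ) (κ : ℂ) :
    E.wave R (n - 1) x κ = E.wave R n x κ * (E.K κ / E.sqrtg)⁻¹ := by
  rw [wave, wave]
  by_cases hκ : κ ∈ E.region R
  · rw [Set.indicator_of_mem hκ, Set.indicator_of_mem hκ, rho, rho, zpow_sub_one₀, mul_assoc]
    exact div_ne_zero hκ.2.1 sqrtg_ne_zero
  · rw [Set.indicator_of_notMem hκ, Set.indicator_of_notMem hκ, zero_mul]

end EllCurve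

namespace SkewMeasure

variable {E : EllCurve} (ζ : SkewMeasure E)

instance : SigmaFinite ζ.μ := ζ.sigmaFinite

/-- The least bound for the coordinates on `S`. -/
noncomputable def radius : ℝ :=
  sInf {R : ℝ | ∀ κ ∈ ζ.S, ‖E.k κ‖ ≤ R ∧ ‖E.K κ‖ ≤ R ^ 2 ∧ ‖E.g / E.K κ‖ ≤ R ^ 2}

theorem radius_eq_zero (h : ¬ ζ.S.Nonempty) : ζ.radius = 0 := by
  rw [Set.not_nonempty_iff_eq_empty] at h
  simp [radius, h]

theorem radius_nonneg : 0 ≤ ζ.radius := by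
  by_cases h : ζ.S.Nonempty
  · obtain ⟨κ, hκ⟩ := h
    exact Real.sInf_nonneg fun R hR => (norm_nonneg _).trans (hR κ hκ).1
  · rw [ζ.radius_eq_zero h]

theorem le_radius {κ : ℂ} (hκ : κ ∈ ζ.S) {c : ℝ} (hc : ∀ R : ℝ,
    (∀ κ ∈ ζ.S, ‖E.k κ‖ ≤ R ∧ ‖E.K κ‖ ≤ R ^ 2 ∧ ‖E.g / E.K κ‖ ≤ R ^ 2) → 0 ≤ R → c ≤ R) :
    c ≤ ζ.radius :=
  le_csInf ζ.bounded fun R hR => hc R hR ((norm_nonneg _).trans (hR κ hκ).1)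

theorem mem_region {κ : ℂ} (hκ : κ ∈ ζ.S) : κ ∈ E.region ζ.radius := by
  have hsq : ∀ c : ℝ, 0 ≤ c → Real.sqrt c ≤ ζ.radius → c ≤ ζ.radius ^ 2 := fun c hc h => by
    rw [← Real.sq_sqrt hc]
    exact pow_le_pow_left₀ (Real.sqrt_nonneg _) h 2
  refine ⟨(ζ.not_pole κ hκ).1, (ζ.not_pole κ hκ).2, ?_, ?_, ?_⟩
  · exact ζ.le_radius hκ fun R hR _ => (hR κ hκ).1
  · refine hsq _ (norm_nonneg _) (ζ.le_radius hκ fun R hR h0 => ?_)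
    exact (Real.sqrt_le_left h0).2 (hR κ hκ).2.1
  · refine hsq _ (norm_nonneg _) (ζ.le_radius hκ fun R hR h0 => ?_)
    exact (Real.sqrt_le_left h0).2 (hR κ hκ).2.2

variable {ζ}

theorem summable_of_mem_times {x : ℕ+ → ℂ} (hx : x ∈ ζ.times) :
    Summable fun j : ℕ+ => ‖x j‖ * ζ.radius ^ (j : ℕ) := by
  obtain ⟨R, hR, hs⟩ := hx
  by_cases h : ζ.S.Nonempty
  · obtain ⟨κ, hκ⟩ := h
    have hle : ζ.radius ≤ R := csInf_le ⟨0, fun R hR => (norm_nonneg _).trans (hR κ hκ).1⟩ hR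
    have h0 := ζ.radius_nonneg
    refine hs.of_nonneg_of_le (fun j => by positivity) fun j => ?_
    gcongr
  · rw [ζ.radius_eq_zero h]
    simp

theorem update_mem_times {x : ℕ+ → ℂ} (hx : x ∈ ζ.times) (i : ℕ+) (t : ℂ) :
    Function.update x i t ∈ ζ.times := by
  obtain ⟨R, hR, hs⟩ := hx
  refine ⟨R, hR, ?_⟩
  have e : (fun j => ‖Function.update x i t j‖ * R ^ (j : ℕ)) =
      Function.update (fun j => ‖x j‖ * R ^ (j : ℕ)) i (‖t‖ * R ^ (i : ℕ)) := by
    funext j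
    by_cases hj : j = i
    · subst hj; simp
    · simp [hj]
  rw [e]
  exact hs.update _ _

variable (ζ)

open Classical in
/-- The kernel, cut off outside of the region where it is bounded. -/
noncomputable def cutKernel (κ κ' : ℂ) : ℂ :=
  if ‖E.kernel κ κ'‖ ≤ ζ.kernel_bounded.choose then E.kernel κ κ' else 0

theorem cutKernel_skew (κ κ' : ℂ) : ζ.cutKernel κ κ' = -ζ.cutKernel κ' κ := by
  rw [cutKernel, cutKernel, E.kernel_skew κ κ', norm_neg]
  split_ifs <;> simp

theorem norm_cutKernel_le (κ κ' : ℂ) : ‖ζ.cutKernel κ κ'‖ ≤ |ζ.kernel_bounded.choose| := by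
  rw [cutKernel]
  split_ifs with h
  · exact h.trans (le_abs_self _)
  · simp

theorem cutKernel_eq {κ κ' : ℂ} (h : κ ∈ ζ.S) (h' : κ' ∈ ζ.S) :
    ζ.cutKernel κ κ' = E.kernel κ κ' :=
  if_pos (ζ.kernel_bounded.choose_spec κ h κ' h')

theorem measurable_cutKernel : Measurable (Function.uncurry ζ.cutKernel) :=
  Measurable.ite (measurableSet_le E.measurable_kernel.norm measurable_const) E.measurable_kernel
    measurable_const

/-- A measurable version of the density. -/
noncomputable def density : ℂ × ℂ → ℂ := ζ.integrable.aestronglyMeasurable.mk ζ.θ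

theorem measurable_density : Measurable ζ.density :=
  ζ.integrable.aestronglyMeasurable.stronglyMeasurable_mk.measurable

theorem density_ae_eq : ζ.θ =ᵐ[ζ.μ] ζ.density := ζ.integrable.aestronglyMeasurable.ae_eq_mk

theorem integrable_density : Integrable ζ.density ζ.μ := ζ.integrable.congr ζ.density_ae_eq

theorem density_skew (A : Set (ℂ × ℂ)) (hA : MeasurableSet A) :
    ∫ p in Prod.swap ⁻¹' A, ζ.density p ∂ζ.μ = -∫ p in A, ζ.density p ∂ζ.μ := by
  rw [← setIntegral_congr_ae (measurable_swap hA) (ζ.density_ae_eq.mono fun p hp _ => hp),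
    ← setIntegral_congr_ae hA (ζ.density_ae_eq.mono fun p hp _ => hp)]
  exact ζ.skew A hA

/-- The density with the plane wave factors. -/
noncomputable def waveDensity (n : ℤ) (x : ℕ+ → ℂ) (p : ℂ × ℂ) : ℂ :=
  ζ.density p * (E.wave ζ.radius n x p.1 * E.wave ζ.radius n x p.2)

theorem ae_pi_mem (m : ℕ) : ∀ᵐ p ∂(Measure.pi fun _ : Fin m => ζ.μ),
    ∀ a, (p a).1 ∈ ζ.S ∧ (p a).2 ∈ ζ.S :=
  Filter.eventually_all.2 fun a =>
    (Measure.tendsto_eval_ae_ae (μ := fun _ : Fin m => ζ.μ) (i := a)).eventually ζ.carried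

theorem ae_pi_density (m : ℕ) : ∀ᵐ p ∂(Measure.pi fun _ : Fin m => ζ.μ),
    ∀ a, ζ.θ (p a) = ζ.density (p a) :=
  Filter.eventually_all.2 fun a =>
    (Measure.tendsto_eval_ae_ae (μ := fun _ : Fin m => ζ.μ) (i := a)).eventually ζ.density_ae_eq

theorem detTerm_eq (n : ℤ) (x : ℕ+ → ℂ) (m : ℕ) :
    ζ.detTerm n x m = ((m.factorial : ℕ) : ℂ)⁻¹ * ∫ p : Fin m → ℂ × ℂ,
      (∏ a, ζ.waveDensity n x (p a)) *
        (Matrix.of fun a b : Fin m => ζ.cutKernel (p b).1 (p a).2).det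
      ∂(Measure.pi fun _ => ζ.μ) := by
  rw [detTerm, one_div]
  congr 1
  refine integral_congr_ae ?_
  filter_upwards [ζ.ae_pi_mem m, ζ.ae_pi_density m] with p hp hp'
  congr 1
  · refine Finset.prod_congr rfl fun a _ => ?_
    rw [waveDensity, EllCurve.wave, Set.indicator_of_mem (ζ.mem_region (hp a).1),
      Set.indicator_of_mem (ζ.mem_region (hp a).2), hp']
  · congr 2
    ext a b
    exact (ζ.cutKernel_eq (hp b).1 (hp a).2).symm

theorem measurable_waveDensity (n : ℤ) {x : ℕ+ → ℂ} (hx : x ∈ ζ.times) :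
    Measurable (ζ.waveDensity n x) := by
  have hw := E.measurable_wave ζ.radius_nonneg n (summable_of_mem_times hx)
  exact ζ.measurable_density.mul ((hw.comp measurable_fst).mul (hw.comp measurable_snd))

theorem integrable_waveDensity (n : ℤ) {x : ℕ+ → ℂ} (hx : x ∈ ζ.times) :
    Integrable (ζ.waveDensity n x) ζ.μ := by
  have hw := E.measurable_wave ζ.radius_nonneg n (summable_of_mem_times hx)
  obtain ⟨U, hU⟩ := E.exists_norm_wave_le ζ.radius_nonneg n (summable_of_mem_times hx)
  refine ζ.integrable_density.mul_bdd (c := U * U)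
    ((hw.comp measurable_fst).mul (hw.comp measurable_snd)).aestronglyMeasurable
    (Filter.Eventually.of_forall fun p => ?_)
  simp only [norm_mul]
  exact mul_le_mul (hU _) (hU _) (norm_nonneg _) ((norm_nonneg _).trans (hU p.1))

/-- The contribution of a configuration of pairs of points to the `τ`-function. -/
noncomputable def amp (n : ℤ) (x : ℕ+ → ℂ) : Config (ℂ × ℂ) → ℂ :=
  amplitude (ζ.waveDensity n x) ζ.cutKernel

/-- The `τ`-function as an integral over configurations. -/
noncomputable def tau (n : ℤ) (x : ℕ+ → ℂ) : ℂ := ∫ z, ζ.amp n x z ∂(configMeasure ζ.μ)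

theorem expDecay_amp (n : ℤ) {x : ℕ+ → ℂ} (hx : x ∈ ζ.times) :
    ExpDecay (fun z : Config (ℂ × ℂ) => (z.1 : ℝ)) (configMeasure ζ.μ) (ζ.amp n x) :=
  expDecay_amplitude (ζ.integrable_waveDensity n hx) (ζ.measurable_waveDensity n hx)
    ζ.cutKernel_skew ζ.measurable_cutKernel ζ.norm_cutKernel_le

theorem measurable_pow_fst (ε : ℂ) : Measurable fun z : Config (ℂ × ℂ) => ε ^ z.1 :=
  measurable_of_sigma fun m => (measurable_const : Measurable fun _ : Fin m → ℂ × ℂ => ε ^ m)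

theorem integrable_pow_mul_amp (n : ℤ) {x : ℕ+ → ℂ} (hx : x ∈ ζ.times) (ε : ℂ) :
    Integrable (fun z => ζ.amp n x z * ε ^ z.1) (configMeasure ζ.μ) := by
  refine ((ζ.expDecay_amp n hx).mul (measurable_pow_fst ε).aestronglyMeasurable (C := 1)
    (c := ‖ε‖) (Filter.Eventually.of_forall fun z => ?_)).integrable
  rw [norm_pow, one_mul, mul_comm, Real.exp_nat_mul]
  exact pow_le_pow_left₀ (norm_nonneg _) (by linarith [Real.add_one_le_exp ‖ε‖]) _

/-- The integral over configurations of `m` pairs of points. -/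
noncomputable def tauTerm (n : ℤ) (x : ℕ+ → ℂ) (m : ℕ) : ℂ :=
  ∫ p : Fin m → ℂ × ℂ, ζ.amp n x ⟨m, p⟩ ∂(Measure.pi fun _ => ζ.μ)

theorem hasSum_tauTerm (n : ℤ) {x : ℕ+ → ℂ} (hx : x ∈ ζ.times) (ε : ℂ) :
    HasSum (fun m => ε ^ m * ζ.tauTerm n x m)
      (∫ z, ζ.amp n x z * ε ^ z.1 ∂(configMeasure ζ.μ)) := by
  have h := hasSum_integral_configMeasure (ζ.integrable_pow_mul_amp n hx ε)
  simpa only [integral_mul_const, mul_comm (ε ^ _), tauTerm] using h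

theorem tauTerm_zero (n : ℤ) (x : ℕ+ → ℂ) : ζ.tauTerm n x 0 = 1 := by
  have : ∀ p : Fin 0 → ℂ × ℂ, ζ.amp n x ⟨0, p⟩ = 1 := fun p => by
    simp [amp, amplitude, weight, kernelPf_zero ζ.cutKernel_skew]
  simp [tauTerm, this, measureReal_def]

theorem differentiable_tau_smul (n : ℤ) {x : ℕ+ → ℂ} (hx : x ∈ ζ.times) :
    Differentiable ℂ fun ε : ℂ => ∫ z, ζ.amp n x z * ε ^ z.1 ∂(configMeasure ζ.μ) := by
  have e : (fun ε : ℂ => ∫ z, ζ.amp n x z * ε ^ z.1 ∂(configMeasure ζ.μ)) =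
      fun ε => ∑' m, ε ^ m * ζ.tauTerm n x m :=
    funext fun ε => (ζ.hasSum_tauTerm n hx ε).tsum_eq.symm
  rw [e]
  intro ε
  set r : ℝ := ‖ε‖ + 1 with hr
  have hs := (ζ.hasSum_tauTerm n hx (r : ℂ)).summable.norm
  have hd := Complex.differentiableOn_tsum_of_summable_norm (U := Metric.ball (0 : ℂ) r)
    (F := fun m (ε : ℂ) => ε ^ m * ζ.tauTerm n x m) hs
    (fun m => ((differentiable_id.pow m).mul_const _).differentiableOn) Metric.isOpen_ball
    fun m w hw => by
      rw [norm_mul, norm_mul, norm_pow, norm_pow, Complex.norm_real, Real.norm_eq_abs]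
      rw [Metric.mem_ball, dist_zero_right] at hw
      have : ‖w‖ ≤ |r| := hw.le.trans (le_abs_self r)
      gcongr
  exact (hd ε (by rw [Metric.mem_ball, dist_zero_right, hr]; linarith)).differentiableAt
    (Metric.isOpen_ball.mem_nhds (by rw [Metric.mem_ball, dist_zero_right, hr]; linarith))

theorem hasSum_detTerm (n : ℤ) {x : ℕ+ → ℂ} (hx : x ∈ ζ.times) (ε : ℂ) :
    HasSum (fun m => ε ^ m * ζ.detTerm n x m)
      ((∫ z, ζ.amp n x z * ε ^ z.1 ∂(configMeasure ζ.μ)) ^ 2) := by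
  have hi := ζ.integrable_pow_mul_amp n hx ε
  have e : ∀ z : Config (ℂ × ℂ) × Config (ℂ × ℂ),
      (ζ.amp n x z.1 * ε ^ z.1.1) * (ζ.amp n x z.2 * ε ^ z.2.1) =
        ζ.amp n x z.1 * ζ.amp n x z.2 * ε ^ (z.1.1 + z.2.1) := fun z => by
    rw [pow_add]; ring
  have h := hi.mul_prod hi
  simp only [e] at h
  have h' := hasSum_integral_amplitude_mul h
  rw [sq, ← integral_prod_mul]
  simp only [e]
  convert h' using 1
  · funext M
    obtain ⟨U, hU⟩ := E.exists_norm_wave_le ζ.radius_nonneg n (summable_of_mem_times hx)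
    rw [ζ.detTerm_eq, mul_left_comm]
    congr 1
    have key := integral_sum_kernelPf_mul ζ.integrable_density ζ.density_skew
      (E.measurable_wave ζ.radius_nonneg n (summable_of_mem_times hx)) hU ζ.cutKernel_skew
      ζ.measurable_cutKernel ζ.norm_cutKernel_le M
    simp only [waveDensity]
    rw [← key, ← integral_const_mul]
    refine integral_congr_ae (Filter.Eventually.of_forall fun p => ?_)
    have hc : ∀ I : Finset (Fin M), (subConfig I p).1 + (subConfig Iᶜ p).1 = M := fun I => by
      change I.card + Iᶜ.card = M
      rw [Finset.card_add_card_compl, Fintype.card_fin]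
    simp only [hc, ← Finset.sum_mul]
    ring
  · rfl

theorem isTau_tau : ζ.IsTau ζ.tau := by
  intro n x hx
  refine ⟨fun ε => ∫ z, ζ.amp n x z * ε ^ z.1 ∂(configMeasure ζ.μ),
    ζ.differentiable_tau_smul n hx, ?_, fun ε => ζ.hasSum_detTerm n hx ε, ?_⟩
  · have h := ζ.hasSum_tauTerm n hx 0
    have h' := hasSum_single (f := fun m => (0 : ℂ) ^ m * ζ.tauTerm n x m) 0 fun m hm => by
      rw [zero_pow hm, zero_mul]
    change ∫ z, ζ.amp n x z * 0 ^ z.1 ∂(configMeasure ζ.μ) = 1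
    rw [h.unique h', pow_zero, one_mul, tauTerm_zero]
  · simp [tau]

theorem eq_of_sq_eq_sq_of_eq_one {f₁ f₂ : ℂ → ℂ} (h₁ : Differentiable ℂ f₁)
    (h₂ : Differentiable ℂ f₂) (h₁0 : f₁ 0 = 1) (h₂0 : f₂ 0 = 1)
    (h : ∀ ε, f₁ ε ^ 2 = f₂ ε ^ 2) : f₁ = f₂ := by
  have hne : ∀ᶠ ε in nhds (0 : ℂ), f₁ ε + f₂ ε ≠ 0 :=
    (h₁.continuous.add h₂.continuous).continuousAt.eventually_ne (by
      simp [h₁0, h₂0, one_add_one_eq_two])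
  have hev : f₁ =ᶠ[nhds 0] f₂ := by
    filter_upwards [hne] with ε hε
    have : (f₁ ε - f₂ ε) * (f₁ ε + f₂ ε) = 0 := by linear_combination h ε
    exact sub_eq_zero.1 ((mul_eq_zero.1 this).resolve_right hε)
  exact AnalyticOnNhd.eq_of_eventuallyEq (fun z _ => h₁.analyticAt z)
    (fun z _ => h₂.analyticAt z) hev

variable {ζ}

theorem IsTau.unique {τ τ' : ℤ → (ℕ+ → ℂ) → ℂ} (h : ζ.IsTau τ) (h' : ζ.IsTau τ') (n : ℤ)
    {x : ℕ+ → ℂ} (hx : x ∈ ζ.times) : τ' n x = τ n x := by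
  obtain ⟨f, hf, hf0, hfs, hf1⟩ := h n x hx
  obtain ⟨f', hf', hf'0, hfs', hf'1⟩ := h' n x hx
  rw [hf1, hf'1, eq_of_sq_eq_sq_of_eq_one hf' hf hf'0 hf0 fun ε => (hfs' ε).unique (hfs ε)]

end SkewMeasure

namespace SkewMeasure

variable {E : EllCurve} (ζ : SkewMeasure E)

/-- The weight of a configuration with respect to the flow `x_j`. -/
noncomputable def flowWeight (j : ℕ+) (z : Config (ℂ × ℂ)) : ℂ :=
  ∑ a, (E.regionSymbol ζ.radius j (z.2 a).1 + E.regionSymbol ζ.radius j (z.2 a).2)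

theorem measurable_flowWeight (j : ℕ+) : Measurable (ζ.flowWeight j) := by
  refine measurable_of_sigma fun m => ?_
  have hs := E.measurable_regionSymbol ζ.radius j
  have hp : ∀ a, Measurable fun p : Fin m → ℂ × ℂ => p a := fun a => measurable_pi_apply a
  change Measurable fun p : Fin m → ℂ × ℂ =>
    ∑ a, (E.regionSymbol ζ.radius j (p a).1 + E.regionSymbol ζ.radius j (p a).2)
  exact Finset.measurable_sum _ fun a _ => (hs.comp (hp a).fst).add (hs.comp (hp a).snd)

theorem norm_flowWeight_le (j : ℕ+) (z : Config (ℂ × ℂ)) :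
    ‖ζ.flowWeight j z‖ ≤ 4 * ζ.radius ^ (j : ℕ) * z.1 := by
  refine (norm_sum_le_of_le _ fun a _ => ((norm_add_le _ _).trans (add_le_add
    (EllCurve.norm_regionSymbol_le ζ.radius_nonneg j _)
    (EllCurve.norm_regionSymbol_le ζ.radius_nonneg j _)))).trans (le_of_eq ?_)
  rw [Finset.sum_const, Finset.card_univ, Fintype.card_fin, nsmul_eq_mul]
  ring

/-- The factor by which the shift of `n` multiplies the contribution of a configuration. -/
noncomputable def shiftWeight (E : EllCurve) (z : Config (ℂ × ℂ)) : ℂ :=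
  ∏ a, E.g⁻¹ * (E.K (z.2 a).1 * E.K (z.2 a).2)

theorem amplitude_mul {β : Type*} (φ ψ : β × β → ℂ) (Ω : β → β → ℂ) (z : Config (β × β)) :
    amplitude (fun p => φ p * ψ p) Ω z = amplitude φ Ω z * ∏ a, ψ (z.2 a) := by
  rw [amplitude, amplitude, weight, weight, Finset.prod_mul_distrib]
  ring

theorem amp_update {n : ℤ} {x : ℕ+ → ℂ} (hx : x ∈ ζ.times) (i : ℕ+) (t : ℂ)
    (z : Config (ℂ × ℂ)) :
    ζ.amp n (Function.update x i t) z =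
      ζ.amp n x z * Complex.exp (ζ.flowWeight i z * (t - x i)) := by
  have e : ζ.waveDensity n (Function.update x i t) = fun p => ζ.waveDensity n x p *
      Complex.exp ((E.regionSymbol ζ.radius i p.1 + E.regionSymbol ζ.radius i p.2) *
        (t - x i)) := by
    funext p
    rw [waveDensity, EllCurve.wave_update ζ.radius_nonneg n (summable_of_mem_times hx),
      EllCurve.wave_update ζ.radius_nonneg n (summable_of_mem_times hx), waveDensity, add_mul,
      Complex.exp_add]
    ring
  rw [amp, e, amplitude_mul, ← Complex.exp_sum, ← Finset.sum_mul]
  rfl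

theorem amp_add_one (n : ℤ) (x : ℕ+ → ℂ) (z : Config (ℂ × ℂ)) :
    ζ.amp (n + 1) x z = ζ.amp n x z * shiftWeight E z := by
  have e : ζ.waveDensity (n + 1) x = fun p => ζ.waveDensity n x p *
      (E.g⁻¹ * (E.K p.1 * E.K p.2)) := by
    funext p
    rw [waveDensity, EllCurve.wave_add_one, EllCurve.wave_add_one, waveDensity, EllCurve.g,
      ← E.sqrtg_sq]
    have := EllCurve.sqrtg_ne_zero (E := E)
    field_simp
  rw [amp, e, amplitude_mul]
  rfl

theorem amp_sub_one (n : ℤ) (x : ℕ+ → ℂ) (z : Config (ℂ × ℂ)) :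
    ζ.amp (n - 1) x z = ζ.amp n x z * (shiftWeight E z)⁻¹ := by
  have e : ζ.waveDensity (n - 1) x = fun p => ζ.waveDensity n x p *
      (E.g⁻¹ * (E.K p.1 * E.K p.2))⁻¹ := by
    funext p
    rw [waveDensity, EllCurve.wave_sub_one, EllCurve.wave_sub_one, waveDensity, EllCurve.g,
      ← E.sqrtg_sq, mul_inv, mul_inv, inv_inv, inv_div, inv_div, div_eq_mul_inv, div_eq_mul_inv]
    ring
  rw [amp, e, amplitude_mul, Finset.prod_inv_distrib]
  rfl

/-- Measurable functions of two configurations with at most exponential growth. -/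
def IsModerate (Q : Config (ℂ × ℂ) × Config (ℂ × ℂ) → ℂ) : Prop :=
  Measurable Q ∧ ∃ C c : ℝ, ∀ z, ‖Q z‖ ≤ C * Real.exp (c * (z.1.1 + z.2.1))

/-- The bilinear integral with weight `Q` at two points `x`, `x'`. -/
noncomputable def bilin (n n' : ℤ) (Q : Config (ℂ × ℂ) × Config (ℂ × ℂ) → ℂ)
    (x x' : ℕ+ → ℂ) : ℂ :=
  ∫ z, ζ.amp n x z.1 * ζ.amp n' x' z.2 * Q z ∂((configMeasure ζ.μ).prod (configMeasure ζ.μ))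

/-- The difference of the weights of two configurations. -/
noncomputable def weightDiff (j : ℕ+) (z : Config (ℂ × ℂ) × Config (ℂ × ℂ)) : ℂ :=
  ζ.flowWeight j z.1 - ζ.flowWeight j z.2

theorem measurable_weightDiff (j : ℕ+) : Measurable (ζ.weightDiff j) :=
  ((ζ.measurable_flowWeight j).comp measurable_fst).sub
    ((ζ.measurable_flowWeight j).comp measurable_snd)

theorem isModerate_one : IsModerate fun _ => 1 :=
  ⟨measurable_const, 1, 0, fun z => by simp⟩

theorem IsModerate.weightDiff_mul {Q : Config (ℂ × ℂ) × Config (ℂ × ℂ) → ℂ} (hQ : IsModerate Q)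
    (j : ℕ+) : IsModerate fun z => ζ.weightDiff j z * Q z := by
  obtain ⟨hm, C, c, hC⟩ := hQ
  refine ⟨(ζ.measurable_weightDiff j).mul hm, 4 * ζ.radius ^ (j : ℕ) * C, c + 1, fun z => ?_⟩
  have h0 := ζ.radius_nonneg
  have h1 : ‖ζ.weightDiff j z‖ ≤ 4 * ζ.radius ^ (j : ℕ) * Real.exp (z.1.1 + z.2.1) := by
    refine (norm_sub_le _ _).trans ((add_le_add (ζ.norm_flowWeight_le j _)
      (ζ.norm_flowWeight_le j _)).trans ?_)
    rw [← mul_add]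
    gcongr
    linarith [Real.add_one_le_exp ((z.1.1 : ℝ) + z.2.1)]
  rw [norm_mul, add_mul, one_mul, Real.exp_add]
  calc ‖ζ.weightDiff j z‖ * ‖Q z‖ ≤ (4 * ζ.radius ^ (j : ℕ) * Real.exp (z.1.1 + z.2.1)) *
        (C * Real.exp (c * (z.1.1 + z.2.1))) :=
        mul_le_mul h1 (hC z) (norm_nonneg _) (by positivity)
    _ = _ := by ring

variable {ζ}

theorem expDecay_bilin {Q : Config (ℂ × ℂ) × Config (ℂ × ℂ) → ℂ} (hQ : IsModerate Q) (n n' : ℤ)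
    {x x' : ℕ+ → ℂ} (hx : x ∈ ζ.times) (hx' : x' ∈ ζ.times) :
    ExpDecay (fun z : Config (ℂ × ℂ) × Config (ℂ × ℂ) => (z.1.1 : ℝ) + z.2.1)
      ((configMeasure ζ.μ).prod (configMeasure ζ.μ))
      fun z => ζ.amp n x z.1 * ζ.amp n' x' z.2 * Q z := by
  obtain ⟨hm, C, c, hC⟩ := hQ
  exact ((ζ.expDecay_amp n hx).prod (ζ.expDecay_amp n' hx')).mul hm.aestronglyMeasurable
    (Filter.Eventually.of_forall hC)

theorem partialDeriv_bilin {Q : Config (ℂ × ℂ) × Config (ℂ × ℂ) → ℂ} (hQ : IsModerate Q)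
    {n n' : ℤ} {F : (ℕ+ → ℂ) → (ℕ+ → ℂ) → ℂ}
    (hF : ∀ x ∈ ζ.times, ∀ x' ∈ ζ.times, F x x' = ζ.bilin n n' Q x x')
    {x x' : ℕ+ → ℂ} (hx : x ∈ ζ.times) (hx' : x' ∈ ζ.times) (j : ℕ+) :
    partialDeriv j (fun y => F y x') x = ∫ z, ζ.amp n x z.1 * ζ.amp n' x' z.2 * Q z *
        ζ.flowWeight j z.1 ∂((configMeasure ζ.μ).prod (configMeasure ζ.μ)) ∧
      partialDeriv j (fun y => F x y) x' = ∫ z, ζ.amp n x z.1 * ζ.amp n' x' z.2 * Q z *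
        ζ.flowWeight j z.2 ∂((configMeasure ζ.μ).prod (configMeasure ζ.μ)) := by
  have hd := expDecay_bilin hQ n n' hx hx'
  have h0 := ζ.radius_nonneg
  constructor
  · have e : (fun t => F (Function.update x j t) x') = fun t =>
        ∫ z, ζ.amp n x z.1 * ζ.amp n' x' z.2 * Q z * Complex.exp (ζ.flowWeight j z.1 * (t - x j))
          ∂((configMeasure ζ.μ).prod (configMeasure ζ.μ)) := by
      funext t
      rw [hF _ (update_mem_times hx j t) _ hx', bilin]
      refine integral_congr_ae (Filter.Eventually.of_forall fun z => ?_)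
      simp only [ζ.amp_update hx]
      ring
    rw [partialDeriv, e]
    refine (hd.hasDerivAt ((ζ.measurable_flowWeight j).comp measurable_fst).aestronglyMeasurable
      (c := 4 * ζ.radius ^ (j : ℕ)) (Filter.Eventually.of_forall fun z => ?_) (x j)).deriv
    refine (ζ.norm_flowWeight_le j z.1).trans ?_
    gcongr
    simp
  · have e : (fun t => F x (Function.update x' j t)) = fun t =>
        ∫ z, ζ.amp n x z.1 * ζ.amp n' x' z.2 * Q z * Complex.exp (ζ.flowWeight j z.2 * (t - x' j))
          ∂((configMeasure ζ.μ).prod (configMeasure ζ.μ)) := by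
      funext t
      rw [hF _ hx _ (update_mem_times hx' j t), bilin]
      refine integral_congr_ae (Filter.Eventually.of_forall fun z => ?_)
      simp only [ζ.amp_update hx']
      ring
    rw [partialDeriv, e]
    refine (hd.hasDerivAt ((ζ.measurable_flowWeight j).comp measurable_snd).aestronglyMeasurable
      (c := 4 * ζ.radius ^ (j : ℕ)) (Filter.Eventually.of_forall fun z => ?_) (x' j)).deriv
    refine (ζ.norm_flowWeight_le j z.2).trans ?_
    gcongr
    simp

theorem hirotaD_bilin {Q : Config (ℂ × ℂ) × Config (ℂ × ℂ) → ℂ} (hQ : IsModerate Q)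
    {n n' : ℤ} {F : (ℕ+ → ℂ) → (ℕ+ → ℂ) → ℂ}
    (hF : ∀ x ∈ ζ.times, ∀ x' ∈ ζ.times, F x x' = ζ.bilin n n' Q x x') (j : ℕ+) :
    ∀ x ∈ ζ.times, ∀ x' ∈ ζ.times, hirotaD j F x x' =
      ζ.bilin n n' (fun z => ζ.weightDiff j z * Q z) x x' := by
  intro x hx x' hx'
  have hd := expDecay_bilin hQ n n' hx hx'
  obtain ⟨h1, h2⟩ := partialDeriv_bilin hQ hF hx hx' j
  have hle : ∀ t : ℝ, 0 ≤ t → t ≤ Real.exp (1 * t) := fun t _ => by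
    rw [one_mul]; linarith [Real.add_one_le_exp t]
  have h0 := ζ.radius_nonneg
  have hi1 := (hd.mul ((ζ.measurable_flowWeight j).comp measurable_fst).aestronglyMeasurable
    (C := 4 * ζ.radius ^ (j : ℕ)) (c := 1) (Filter.Eventually.of_forall fun z => by
      refine (ζ.norm_flowWeight_le j z.1).trans ?_
      refine mul_le_mul_of_nonneg_left (le_trans ?_ (hle _ (by positivity))) (by positivity)
      simp)).integrable
  have hi2 := (hd.mul ((ζ.measurable_flowWeight j).comp measurable_snd).aestronglyMeasurable
    (C := 4 * ζ.radius ^ (j : ℕ)) (c := 1) (Filter.Eventually.of_forall fun z => by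
      refine (ζ.norm_flowWeight_le j z.2).trans ?_
      refine mul_le_mul_of_nonneg_left (le_trans ?_ (hle _ (by positivity))) (by positivity)
      simp)).integrable
  rw [hirotaD, h1, h2, bilin]
  refine (integral_sub hi1 hi2).symm.trans
    (integral_congr_ae (Filter.Eventually.of_forall fun z => ?_))
  simp only [weightDiff, Function.comp]
  ring

theorem dot_eq_bilin {τ : ℤ → (ℕ+ → ℂ) → ℂ} (h : ζ.IsTau τ) (n n' : ℤ) :
    ∀ x ∈ ζ.times, ∀ x' ∈ ζ.times, dot (τ n) (τ n') x x' = ζ.bilin n n' (fun _ => 1) x x' := by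
  intro x hx x' hx'
  rw [dot, ← h.unique ζ.isTau_tau n hx, ← h.unique ζ.isTau_tau n' hx', bilin, tau, tau,
    ← integral_prod_mul]
  simp only [mul_one]

theorem differentiable_tau {τ : ℤ → (ℕ+ → ℂ) → ℂ} (h : ζ.IsTau τ) (n : ℤ) {x : ℕ+ → ℂ}
    (hx : x ∈ ζ.times) : Differentiable ℂ (fun t : ℂ × ℂ × ℂ =>
      τ n (Function.update (Function.update (Function.update x 1 t.1) 2 t.2.1) 3 t.2.2)) := by
  set L : Config (ℂ × ℂ) → ℂ × ℂ × ℂ →L[ℂ] ℂ := fun z =>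
    ζ.flowWeight 1 z • ContinuousLinearMap.fst ℂ ℂ (ℂ × ℂ) +
      ζ.flowWeight 2 z • (ContinuousLinearMap.fst ℂ ℂ ℂ).comp (ContinuousLinearMap.snd ℂ ℂ (ℂ × ℂ))
          +
      ζ.flowWeight 3 z • (ContinuousLinearMap.snd ℂ ℂ ℂ).comp (ContinuousLinearMap.snd ℂ ℂ (ℂ × ℂ))
    with hL
  have hLm : AEStronglyMeasurable L (configMeasure ζ.μ) :=
    (((ζ.measurable_flowWeight 1).smul_const _).add ((ζ.measurable_flowWeight 2).smul_const _)).add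
      ((ζ.measurable_flowWeight 3).smul_const _) |>.aestronglyMeasurable
  have hLe : ∀ z, ‖L z‖ ≤ (4 * ζ.radius ^ 1 + 4 * ζ.radius ^ 2 + 4 * ζ.radius ^ 3) * (z.1 : ℝ) := by
    intro z
    have h1 := ζ.norm_flowWeight_le 1 z
    have h2 := ζ.norm_flowWeight_le 2 z
    have h3 := ζ.norm_flowWeight_le 3 z
    have hc1 : ‖ContinuousLinearMap.fst ℂ ℂ (ℂ × ℂ)‖ ≤ 1 := ContinuousLinearMap.norm_fst_le ..
    have hc2 : ‖(ContinuousLinearMap.fst ℂ ℂ ℂ).comp (ContinuousLinearMap.snd ℂ ℂ (ℂ × ℂ))‖ ≤ 1 :=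
      (ContinuousLinearMap.opNorm_comp_le _ _).trans (mul_le_one₀
        (ContinuousLinearMap.norm_fst_le ..) (norm_nonneg _) (ContinuousLinearMap.norm_snd_le ..))
    have hc3 : ‖(ContinuousLinearMap.snd ℂ ℂ ℂ).comp (ContinuousLinearMap.snd ℂ ℂ (ℂ × ℂ))‖ ≤ 1 :=
      (ContinuousLinearMap.opNorm_comp_le _ _).trans (mul_le_one₀
        (ContinuousLinearMap.norm_snd_le ..) (norm_nonneg _) (ContinuousLinearMap.norm_snd_le ..))
    refine (norm_add₃_le ..).trans ?_
    rw [norm_smul, norm_smul, norm_smul, add_mul, add_mul]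
    exact add_le_add (add_le_add ((mul_le_of_le_one_right (norm_nonneg _) hc1).trans h1)
      ((mul_le_of_le_one_right (norm_nonneg _) hc2).trans h2))
      ((mul_le_of_le_one_right (norm_nonneg _) hc3).trans h3)
  have hd := ((ζ.expDecay_amp n hx).differentiable hLm (Filter.Eventually.of_forall hLe)).comp
    (differentiable_id.sub_const ((x 1, x 2, x 3) : ℂ × ℂ × ℂ))
  have hext : ∀ f f' : ℂ × ℂ × ℂ → ℂ, Differentiable ℂ f' → (∀ t, f t = f' t) →
      Differentiable ℂ f := fun f f' hf' he => funext he ▸ hf'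
  refine hext _ _ hd fun t => ?_
  have hx1 := update_mem_times hx 1 t.1
  have hx2 := update_mem_times hx1 2 t.2.1
  rw [← h.unique ζ.isTau_tau n (update_mem_times hx2 3 t.2.2), tau]
  refine integral_congr_ae (Filter.Eventually.of_forall fun z => ?_)
  have h21 : Function.update x 1 t.1 2 = x 2 := Function.update_of_ne (by decide) _ _
  have h32 : Function.update (Function.update x 1 t.1) 2 t.2.1 3 = x 3 := by
    rw [Function.update_of_ne (by decide), Function.update_of_ne (by decide)]
  simp only [ζ.amp_update hx2, ζ.amp_update hx1, ζ.amp_update hx, h21, h32, mul_assoc,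
    ← Complex.exp_add]
  congr 2

end SkewMeasure

namespace SkewMeasure

variable {E : EllCurve} {ζ : SkewMeasure E}

theorem isCauchyMatrix_kernelMatrix {ι : Type*} {p : ι → ℂ × ℂ}
    (hp : ∀ i, (p i).1 ∈ ζ.S ∧ (p i).2 ∈ ζ.S) :
    IsCauchyMatrix (3 * E.e) E.g (fun s => E.k (pairPoint p s)) (fun s => E.K (pairPoint p s))
      (kernelMatrix ζ.cutKernel p) := by
  have hS : ∀ s, pairPoint p s ∈ ζ.S := by
    rintro ⟨i, _ | _⟩
    · exact (hp i).1
    · exact (hp i).2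
  have hX : ∀ s t, kernelMatrix ζ.cutKernel p s t = E.kernel (pairPoint p s) (pairPoint p t) :=
    fun s t => ζ.cutKernel_eq (hS s) (hS t)
  have hn := fun s => ζ.not_pole _ (hS s)
  exact
    { skew := kernelMatrix_skew ζ.cutKernel_skew p
      g_ne_zero := E.g_ne_zero
      ne_zero := fun s => (hn s).2
      curve := fun s => E.k_sq (hn s).1 (hn s).2
      kernel_mul_add := fun s t => by
        rw [hX]
        exact E.kernel_mul_add (hn s).1 (hn s).2 (hn t).1 (hn t).2
          (ζ.kernel_not_pole _ (hS s) _ (hS t))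
      kernel_mul_sub := fun s t => by
        rw [hX]
        exact E.kernel_mul_sub (hn s).1 (hn s).2 (hn t).1 (hn t).2
          (ζ.kernel_not_pole _ (hS s) _ (hS t)) }

section Weights

variable {M : ℕ} {p : Fin M → ℂ × ℂ}

theorem flowWeight_subConfig (hp : ∀ i, (p i).1 ∈ ζ.S ∧ (p i).2 ∈ ζ.S) (j : ℕ+)
    (I : Finset (Fin M)) : ζ.flowWeight j (subConfig I p) =
      ∑ i ∈ I, (E.symbol (p i).2 j + E.symbol (p i).1 j) := by
  conv_rhs => rw [← Finset.map_orderEmbOfFin_univ I rfl, Finset.sum_map]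
  refine Finset.sum_congr rfl fun a _ => ?_
  rw [add_comm]
  exact congrArg₂ _ (Set.indicator_of_mem (ζ.mem_region (hp _).2) _)
    (Set.indicator_of_mem (ζ.mem_region (hp _).1) _)

theorem flowWeight_one_subConfig (hp : ∀ i, (p i).1 ∈ ζ.S ∧ (p i).2 ∈ ζ.S)
    (I : Finset (Fin M)) : ζ.flowWeight 1 (subConfig I p) =
      IsCauchyMatrix.wt₁ (fun s => E.k (pairPoint p s)) I := by
  rw [flowWeight_subConfig hp, IsCauchyMatrix.wt₁]
  simp [EllCurve.symbol, pairPoint]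

theorem flowWeight_two_subConfig (hp : ∀ i, (p i).1 ∈ ζ.S ∧ (p i).2 ∈ ζ.S)
    (I : Finset (Fin M)) : ζ.flowWeight 2 (subConfig I p) =
      IsCauchyMatrix.wt₂ E.g (fun s => E.K (pairPoint p s)) I := by
  rw [flowWeight_subConfig hp, IsCauchyMatrix.wt₂]
  have h : ¬ Odd ((2 : ℕ+) : ℕ) := by decide
  have h' : ((2 : ℕ+) : ℕ) / 2 = 1 := rfl
  simp only [EllCurve.symbol, if_neg h, h', pow_one, pairPoint, if_true, Bool.false_eq_true,
    if_false]

theorem flowWeight_three_subConfig (hp : ∀ i, (p i).1 ∈ ζ.S ∧ (p i).2 ∈ ζ.S)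
    (I : Finset (Fin M)) : ζ.flowWeight 3 (subConfig I p) =
      IsCauchyMatrix.wt₃ (fun s => E.k (pairPoint p s)) I := by
  rw [flowWeight_subConfig hp, IsCauchyMatrix.wt₃]
  have h : Odd 3 := by decide
  have h' : ((3 : ℕ+) : ℕ) = 3 := rfl
  simp only [EllCurve.symbol, if_pos h, h', pairPoint, if_true, Bool.false_eq_true, if_false]

theorem shiftWeight_subConfig (p : Fin M → ℂ × ℂ) (I : Finset (Fin M)) :
    shiftWeight E (subConfig I p) = IsCauchyMatrix.shiftFactor E.g
      (fun s => E.K (pairPoint p s)) I := by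
  rw [IsCauchyMatrix.shiftFactor]
  conv_rhs => rw [← Finset.map_orderEmbOfFin_univ I rfl, Finset.prod_map]
  refine Finset.prod_congr rfl fun a _ => ?_
  exact congrArg _ (mul_comm _ _)

end Weights

theorem integral_amp_mul_eq_zero {n : ℤ} {x : ℕ+ → ℂ}
    {f Q : Config (ℂ × ℂ) × Config (ℂ × ℂ) → ℂ}
    (hf : Integrable f ((configMeasure ζ.μ).prod (configMeasure ζ.μ)))
    (hfQ : ∀ z, f z = ζ.amp n x z.1 * ζ.amp n x z.2 * Q z)
    (h : ∀ (M : ℕ) (p : Fin M → ℂ × ℂ), (∀ i, (p i).1 ∈ ζ.S ∧ (p i).2 ∈ ζ.S) →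
      ∑ I ∈ (Finset.univ : Finset (Fin M)).powerset,
          Q (subConfig I p, subConfig (Finset.univ \ I) p) *
        (MvPolynomial.coeff (ind I) (pairRoot (kernelMatrix ζ.cutKernel p)) *
          MvPolynomial.coeff (ind (Finset.univ \ I)) (pairRoot (kernelMatrix ζ.cutKernel p))) = 0) :
    ∫ z, f z ∂((configMeasure ζ.μ).prod (configMeasure ζ.μ)) = 0 := by
  rw [funext hfQ] at hf ⊢
  refine (hasSum_integral_amplitude_mul hf).unique ?_
  have hcongr : ∀ u : ℕ → ℂ, (∀ M, u M = 0) → HasSum u 0 := fun u hu => by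
    rw [funext hu]; exact hasSum_zero
  refine hcongr _ fun M => mul_eq_zero_of_right _ (integral_eq_zero_of_ae ?_)
  filter_upwards [ζ.ae_pi_mem M] with p hp
  have := h M p hp
  simp only [coeff_pairRoot_kernelMatrix ζ.cutKernel_skew, ← Finset.compl_eq_univ_sdiff] at this
  simp only [mul_comm _ (Q _), this, mul_zero, Pi.zero_apply]

theorem integral_linearCombination {X : Type*} [MeasurableSpace X] {μ : Measure X}
    {f₁ f₂ f₃ f₄ : X → ℂ} (h₁ : Integrable f₁ μ) (h₂ : Integrable f₂ μ) (h₃ : Integrable f₃ μ)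
    (h₄ : Integrable f₄ μ) (a b c : ℂ) :
    Integrable (fun z => f₁ z + a * f₂ z + b * f₃ z + c * f₄ z) μ ∧
      ∫ z, (f₁ z + a * f₂ z + b * f₃ z + c * f₄ z) ∂μ =
        ∫ z, f₁ z ∂μ + a * ∫ z, f₂ z ∂μ + b * ∫ z, f₃ z ∂μ + c * ∫ z, f₄ z ∂μ := by
  have i := (h₁.add (h₂.const_mul a)).add (h₃.const_mul b)
  refine ⟨i.add (h₄.const_mul c), ?_⟩
  rw [← integral_const_mul, ← integral_const_mul, ← integral_const_mul]
  exact (integral_add i (h₄.const_mul c)).trans (congrArg₂ _ ((integral_add (h₁.add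
    (h₂.const_mul a)) (h₃.const_mul b)).trans (congrArg₂ _ (integral_add h₁ (h₂.const_mul a)) rfl))
    rfl)

section Equations

variable {τ : ℤ → (ℕ+ → ℂ) → ℂ} (h : ζ.IsTau τ) (n : ℤ) {x : ℕ+ → ℂ} (hx : x ∈ ζ.times)

include h hx

theorem bilinear_first :
    hirotaD 1 (hirotaD 1 (hirotaD 1 (hirotaD 1 (dot (τ n) (τ n))))) x x
        - 4 * hirotaD 1 (hirotaD 3 (dot (τ n) (τ n))) x x
        + 3 * hirotaD 2 (hirotaD 2 (dot (τ n) (τ n))) x x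
      = 24 * E.g * (τ (n + 1) x * τ (n - 1) x - τ n x ^ 2) := by
  have m0 := isModerate_one
  have d0 := dot_eq_bilin h n n
  have d0' := dot_eq_bilin h (n + 1) (n - 1) x hx x hx
  have m1 := m0.weightDiff_mul ζ 1
  have m11 := m1.weightDiff_mul ζ 1
  have m111 := m11.weightDiff_mul ζ 1
  have m1111 := m111.weightDiff_mul ζ 1
  have m3 := m0.weightDiff_mul ζ 3
  have m13 := m3.weightDiff_mul ζ 1
  have m2 := m0.weightDiff_mul ζ 2
  have m22 := m2.weightDiff_mul ζ 2
  have e1 := hirotaD_bilin m111 (hirotaD_bilin m11 (hirotaD_bilin m1 (hirotaD_bilin m0 d0 1) 1) 1) 1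
    x hx x hx
  have e2 := hirotaD_bilin m3 (hirotaD_bilin m0 d0 3) 1 x hx x hx
  have e3 := hirotaD_bilin m2 (hirotaD_bilin m0 d0 2) 2 x hx x hx
  have i1 := (expDecay_bilin m1111 n n hx hx).integrable
  have i2 := (expDecay_bilin m13 n n hx hx).integrable
  have i3 := (expDecay_bilin m22 n n hx hx).integrable
  have i4 := (expDecay_bilin m0 (n + 1) (n - 1) hx hx).integrable
  have i5 := (expDecay_bilin m0 n n hx hx).integrable
  have d5 := d0 x hx x hx
  rw [dot] at d0' d5
  rw [e1, e2, e3, d0', sq, d5]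
  obtain ⟨iT, hT⟩ := integral_linearCombination i1 i2 i3 (i4.sub i5) (-4) 3 (-(24 * E.g))
  rw [integral_sub' i4 i5] at hT
  suffices hz : _ = (0 : ℂ) from sub_eq_zero.1 (Eq.trans (by simp only [bilin]; ring)
      (hT.symm.trans hz))
  refine integral_amp_mul_eq_zero (n := n) (x := x) (Q := fun z =>
      (ζ.weightDiff 1 z ^ 4 - 4 * (ζ.weightDiff 1 z * ζ.weightDiff 3 z) +
        3 * ζ.weightDiff 2 z ^ 2 -
        24 * E.g * (shiftWeight E z.1 * (shiftWeight E z.2)⁻¹ - 1))) iT (fun z => ?_)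
      fun M p hp => ?_
  · simp only [Pi.sub_apply, amp_add_one, amp_sub_one]; ring
  · simp only [weightDiff, flowWeight_one_subConfig hp, flowWeight_two_subConfig hp,
      flowWeight_three_subConfig hp, shiftWeight_subConfig]
    exact (isCauchyMatrix_kernelMatrix hp).sum_first Finset.univ

theorem bilinear_second :
    hirotaD 1 (hirotaD 1 (hirotaD 1 (dot (τ (n + 1)) (τ n)))) x x
        + 2 * hirotaD 3 (dot (τ (n + 1)) (τ n)) x x
        - 3 * hirotaD 1 (hirotaD 2 (dot (τ (n + 1)) (τ n))) x x
        - 18 * E.e * hirotaD 1 (dot (τ (n + 1)) (τ n)) x x = 0 := by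
  have m0 := isModerate_one
  have d0 := dot_eq_bilin h (n + 1) n
  have m1 := m0.weightDiff_mul ζ 1
  have m11 := m1.weightDiff_mul ζ 1
  have m111 := m11.weightDiff_mul ζ 1
  have m3 := m0.weightDiff_mul ζ 3
  have m2 := m0.weightDiff_mul ζ 2
  have m12 := m2.weightDiff_mul ζ 1
  have e1 := hirotaD_bilin m11 (hirotaD_bilin m1 (hirotaD_bilin m0 d0 1) 1) 1 x hx x hx
  have e2 := hirotaD_bilin m0 d0 3 x hx x hx
  have e3 := hirotaD_bilin m2 (hirotaD_bilin m0 d0 2) 1 x hx x hx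
  have e4 := hirotaD_bilin m0 d0 1 x hx x hx
  have i1 := (expDecay_bilin m111 (n + 1) n hx hx).integrable
  have i2 := (expDecay_bilin m3 (n + 1) n hx hx).integrable
  have i3 := (expDecay_bilin m12 (n + 1) n hx hx).integrable
  have i4 := (expDecay_bilin m1 (n + 1) n hx hx).integrable
  rw [e1, e2, e3, e4]
  obtain ⟨iT, hT⟩ := integral_linearCombination i1 i2 i3 i4 2 (-3) (-(18 * E.e))
  refine Eq.trans (by simp only [bilin]; ring) (hT.symm.trans ?_)
  refine integral_amp_mul_eq_zero (n := n) (x := x) (Q := fun z =>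
      ((ζ.weightDiff 1 z ^ 3 + 2 * ζ.weightDiff 3 z - 3 * (ζ.weightDiff 1 z * ζ.weightDiff 2 z) -
        6 * (3 * E.e) * ζ.weightDiff 1 z) * shiftWeight E z.1)) iT (fun z => ?_) fun M p hp => ?_
  · simp only [amp_add_one]; ring
  · simp only [weightDiff, flowWeight_one_subConfig hp, flowWeight_two_subConfig hp,
      flowWeight_three_subConfig hp, shiftWeight_subConfig]
    exact (isCauchyMatrix_kernelMatrix hp).sum_second Finset.univ

theorem bilinear_third :
    hirotaD 1 (hirotaD 1 (hirotaD 1 (dot (τ (n - 1)) (τ n)))) x x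
        + 2 * hirotaD 3 (dot (τ (n - 1)) (τ n)) x x
        + 3 * hirotaD 1 (hirotaD 2 (dot (τ (n - 1)) (τ n))) x x
        - 18 * E.e * hirotaD 1 (dot (τ (n - 1)) (τ n)) x x = 0 := by
  have m0 := isModerate_one
  have d0 := dot_eq_bilin h (n - 1) n
  have m1 := m0.weightDiff_mul ζ 1
  have m11 := m1.weightDiff_mul ζ 1
  have m111 := m11.weightDiff_mul ζ 1
  have m3 := m0.weightDiff_mul ζ 3
  have m2 := m0.weightDiff_mul ζ 2
  have m12 := m2.weightDiff_mul ζ 1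
  have e1 := hirotaD_bilin m11 (hirotaD_bilin m1 (hirotaD_bilin m0 d0 1) 1) 1 x hx x hx
  have e2 := hirotaD_bilin m0 d0 3 x hx x hx
  have e3 := hirotaD_bilin m2 (hirotaD_bilin m0 d0 2) 1 x hx x hx
  have e4 := hirotaD_bilin m0 d0 1 x hx x hx
  have i1 := (expDecay_bilin m111 (n - 1) n hx hx).integrable
  have i2 := (expDecay_bilin m3 (n - 1) n hx hx).integrable
  have i3 := (expDecay_bilin m12 (n - 1) n hx hx).integrable
  have i4 := (expDecay_bilin m1 (n - 1) n hx hx).integrable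
  rw [e1, e2, e3, e4]
  obtain ⟨iT, hT⟩ := integral_linearCombination i1 i2 i3 i4 2 3 (-(18 * E.e))
  refine Eq.trans (by simp only [bilin]; ring) (hT.symm.trans ?_)
  refine integral_amp_mul_eq_zero (n := n) (x := x) (Q := fun z =>
      ((ζ.weightDiff 1 z ^ 3 + 2 * ζ.weightDiff 3 z + 3 * (ζ.weightDiff 1 z * ζ.weightDiff 2 z) -
        6 * (3 * E.e) * ζ.weightDiff 1 z) * (shiftWeight E z.1)⁻¹)) iT (fun z => ?_)
      fun M p hp => ?_
  · simp only [amp_sub_one]; ring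
  · simp only [weightDiff, flowWeight_one_subConfig hp, flowWeight_two_subConfig hp,
      flowWeight_three_subConfig hp, shiftWeight_subConfig]
    exact (isCauchyMatrix_kernelMatrix hp).sum_third Finset.univ

end Equations

end SkewMeasure

section InfiniteDet

open Matrix

theorem hasSum_pi_prod {ι : Type*} {m : ℕ} {F : Fin m → ι → ℂ} {c : Fin m → ℂ}
    (hn : ∀ a, Summable fun i => ‖F a i‖) (hc : ∀ a, HasSum (F a) (c a)) :
    HasSum (fun f : Fin m → ι => ∏ a, F a (f a)) (∏ a, c a) ∧
      Summable fun f : Fin m → ι => ‖∏ a, F a (f a)‖ := by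
  induction m with
  | zero =>
    simp only [Finset.univ_eq_empty, Finset.prod_empty]
    exact ⟨hasSum_unique _, (hasSum_unique _).summable⟩
  | succ m ih =>
    obtain ⟨h1, h2⟩ := ih (F := fun a => F a.succ) (fun a => hn _) fun a => hc _
    rw [← (Fin.consEquiv fun _ : Fin (m + 1) => ι).hasSum_iff,
      ← (Fin.consEquiv fun _ : Fin (m + 1) => ι).summable_iff, Fin.prod_univ_succ]
    simp only [Function.comp_def, Fin.consEquiv_apply, Fin.prod_univ_succ, Fin.cons_zero,
      Fin.cons_succ]
    have h3 := summable_mul_of_summable_norm (hn 0) h2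
    have h4 := (hc 0).mul h1 h3
    have h5 := (hn 0).mul_norm h2
    exact ⟨h4, h5⟩

theorem hasSum_principalMinor {A : Matrix ℤ ℤ ℂ} {m : ℕ} {d : ℂ}
    (h : HasSum (fun f : Fin m → ℤ => det (of fun a b => A (f a) (f b)))
      ((m.factorial : ℕ) * d)) :
    HasSum (fun s : {s : Finset ℤ // s.card = m} => principalMinor A s.1) d := by
  set Φ : {s : Finset ℤ // s.card = m} × Equiv.Perm (Fin m) → Fin m → ℤ :=
    fun q a => q.1.1.orderEmbOfFin q.1.2 (q.2 a) with hΦ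
  have hrange : ∀ q, Set.range (Φ q) = q.1.1 := fun q => by
    rw [← Finset.range_orderEmbOfFin q.1.1 q.1.2]
    exact q.2.surjective.range_comp _
  have hinj : Function.Injective Φ := by
    rintro ⟨⟨s, hs⟩, σ⟩ ⟨⟨t, ht⟩, π⟩ hq
    have hst : s = t := by
      rw [← Finset.coe_inj]
      exact (hrange ⟨⟨s, hs⟩, σ⟩).symm.trans (hq ▸ hrange ⟨⟨t, ht⟩, π⟩)
    subst hst
    have : σ = π := Equiv.ext fun a => (s.orderEmbOfFin hs).injective (congrFun hq a)
    rw [this]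
  have hzero : ∀ f ∉ Set.range Φ, det (of fun a b => A (f a) (f b)) = 0 := by
    intro f hf
    by_cases hfi : Function.Injective f
    · refine absurd ?_ hf
      set s : Finset ℤ := Finset.univ.image f with hs
      have hsc : s.card = m := by
        rw [hs, Finset.card_image_of_injective _ hfi, Finset.card_univ, Fintype.card_fin]
      have hmem : ∀ a, ∃ b, s.orderEmbOfFin hsc b = f a := fun a => by
        have : f a ∈ Set.range (s.orderEmbOfFin hsc) := by
          rw [Finset.range_orderEmbOfFin, Finset.mem_coe]
          exact Finset.mem_image_of_mem f (Finset.mem_univ a)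
        exact this
      choose σ hσ using hmem
      have hσi : Function.Injective σ := fun a b hab => hfi (by rw [← hσ a, ← hσ b, hab])
      exact ⟨⟨⟨s, hsc⟩, Equiv.ofBijective σ (Finite.injective_iff_bijective.1 hσi)⟩, funext hσ⟩
    · rw [Function.not_injective_iff] at hfi
      obtain ⟨a, b, hab, hne⟩ := hfi
      exact det_zero_of_row_eq hne (funext fun c => by simp only [of_apply, hab])
  have hminor : ∀ q, det (of fun a b => A (Φ q a) (Φ q b)) = principalMinor A q.1.1 := by
    intro q
    rw [principalMinor, ← det_submatrix_equiv_self
      (q.2.trans (q.1.1.orderIsoOfFin q.1.2).toEquiv)]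
    rfl
  have h1 := (hinj.hasSum_iff hzero).2 h
  have h2 : HasSum (fun s : {s : Finset ℤ // s.card = m} =>
      ((m.factorial : ℕ) : ℂ) * principalMinor A s.1) ((m.factorial : ℕ) * d) := by
    refine HasSum.prod_fiberwise h1 fun s => ?_
    simp only [Function.comp_def, hminor]
    have := hasSum_fintype fun _ : Equiv.Perm (Fin m) => principalMinor A s.1
    rwa [Finset.sum_const, Finset.card_univ, Fintype.card_perm, Fintype.card_fin,
      nsmul_eq_mul] at this
  exact (hasSum_mul_left_iff (Nat.cast_ne_zero.2 m.factorial_ne_zero)).1 h2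

variable {β : Type*} [MeasurableSpace β] {μ : Measure (β × β)} [SigmaFinite μ]

theorem hasSum_det_integral {S : Set β} (hS : ∀ᵐ p ∂μ, p.1 ∈ S ∧ p.2 ∈ S) {w : β × β → ℂ}
    (hw : Integrable w μ) {ι : Type*} [Countable ι] {u v : ι → β → ℂ}
    (hu : ∀ i, AEStronglyMeasurable (fun p => u i p.2) μ)
    (hv : ∀ i, AEStronglyMeasurable (fun p => v i p.1) μ) {c : ι → ℝ} (hc : Summable c)
    (hle : ∀ a ∈ S, ∀ b ∈ S, ∀ i, ‖u i b * v i a‖ ≤ c i) {Ω : β → β → ℂ}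
    (hm : Measurable (Function.uncurry Ω)) {B : ℝ} (hB : ∀ a b, ‖Ω a b‖ ≤ B)
    (hΩ : ∀ a ∈ S, ∀ b ∈ S, HasSum (fun i => u i b * v i a) (Ω a b)) (m : ℕ) :
    HasSum (fun f : Fin m → ι => det (of fun a b : Fin m =>
        ∫ p, w p * (v (f a) p.1 * u (f b) p.2) ∂μ))
      (∫ p : Fin m → β × β, (∏ a, w (p a)) * det (of fun a b => Ω (p b).1 (p a).2)
        ∂(Measure.pi fun _ => μ)) := by
  have hprod : Integrable (fun p : Fin m → β × β => ∏ a, w (p a)) (Measure.pi fun _ => μ) :=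
    Integrable.fintype_prod fun _ => hw
  have hmem : ∀ᵐ p ∂(Measure.pi fun _ : Fin m => μ), ∀ a, (p a).1 ∈ S ∧ (p a).2 ∈ S :=
    Filter.eventually_all.2 fun a =>
      (Measure.tendsto_eval_ae_ae (μ := fun _ : Fin m => μ) (i := a)).eventually hS
  have hcomp : ∀ {F : β × β → ℂ}, AEStronglyMeasurable F μ → ∀ a : Fin m,
      AEStronglyMeasurable (fun p : Fin m → β × β => F (p a)) (Measure.pi fun _ => μ) :=
    fun hF a => hF.comp_quasiMeasurePreserving
      (Measure.quasiMeasurePreserving_eval (fun _ : Fin m => μ) a)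
  have hp : ∀ a, Measurable fun p : Fin m → β × β => p a := fun a => measurable_pi_apply a
  have hcabs : Summable fun i => |c i| := hc.abs
  have hcsum := (hasSum_pi_prod (m := m) (F := fun _ i => ((|c i| : ℝ) : ℂ))
    (fun _ => by simpa using hcabs) fun _ => (Complex.hasSum_ofReal.2 hcabs.hasSum)).2
  have hcsum' : Summable fun f : Fin m → ι => ∏ a, |c (f a)| := by
    refine hcsum.congr fun f => ?_
    rw [norm_prod]
    simp
  have key : ∀ σ : Equiv.Perm (Fin m),
      HasSum (fun f : Fin m → ι => ∏ i, ∫ p, w p * (v (f (σ i)) p.1 * u (f i) p.2) ∂μ)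
        (∫ p : Fin m → β × β, (∏ a, w (p a)) * ∏ i, Ω (p i).1 (p (σ i)).2
          ∂(Measure.pi fun _ => μ)) := by
    intro σ
    have e : ∀ f : Fin m → ι, ∏ i, ∫ p, w p * (v (f (σ i)) p.1 * u (f i) p.2) ∂μ =
        ∫ p : Fin m → β × β, (∏ a, w (p a)) * ∏ i, (u (f (σ i)) (p (σ i)).2 * v (f (σ i)) (p i).1)
          ∂(Measure.pi fun _ => μ) := by
      intro f
      rw [← integral_fintype_prod_eq_prod (μ := fun _ => μ)
        fun i p => w p * (v (f (σ i)) p.1 * u (f i) p.2)]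
      refine integral_congr_ae (Filter.Eventually.of_forall fun p => ?_)
      simp only [Finset.prod_mul_distrib]
      rw [Equiv.prod_comp σ fun i => u (f i) (p i).2]
      ring
    have hcongr : ∀ {X Y : (Fin m → ι) → ℂ} {d : ℂ}, (∀ f, X f = Y f) → HasSum Y d → HasSum X d :=
      fun h hY => by rwa [funext h]
    refine hcongr e (hasSum_integral_of_dominated_convergence
      (fun f p => ‖∏ a, w (p a)‖ * ∏ a, |c (f a)|) (fun f => ?_) (fun f => ?_) ?_ ?_ ?_)
    · exact hprod.aestronglyMeasurable.mul (Finset.aestronglyMeasurable_fun_prod _ fun i _ =>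
        (hcomp (hu _) (σ i)).mul (hcomp (hv _) i))
    · filter_upwards [hmem] with p hp
      rw [norm_mul, norm_prod (f := fun i => u (f (σ i)) (p (σ i)).2 * v (f (σ i)) (p i).1),
        ← Equiv.prod_comp σ fun a => |c (f a)|]
      gcongr with i
      exact (hle _ (hp _).1 _ (hp _).2 _).trans (le_abs_self _)
    · exact Filter.Eventually.of_forall fun p => hcsum'.mul_left _
    · simp only [tsum_mul_left]
      exact hprod.norm.mul_const _
    · filter_upwards [hmem] with p hp
      refine HasSum.mul_left _ ?_
      have h1 := (hasSum_pi_prod (F := fun a i => u i (p a).2 * v i (p (σ.symm a)).1)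
        (c := fun a => Ω (p (σ.symm a)).1 (p a).2)
        (fun a => hc.of_nonneg_of_le (fun _ => norm_nonneg _)
          (hle _ (hp _).1 _ (hp _).2)) fun a => hΩ _ (hp _).1 _ (hp _).2).1
      rw [← Equiv.prod_comp σ] at h1
      simp only [Equiv.symm_apply_apply] at h1
      refine hcongr (fun f => ?_) h1
      rw [← Equiv.prod_comp σ fun a => u (f a) (p a).2 * v (f a) (p (σ.symm a)).1]
      simp only [Equiv.symm_apply_apply]
  have hint : ∀ σ : Equiv.Perm (Fin m), Integrable (fun p : Fin m → β × β =>
      (∏ a, w (p a)) * ∏ i, Ω (p i).1 (p (σ i)).2) (Measure.pi fun _ => μ) := by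
    intro σ
    refine hprod.mul_bdd (c := ∏ _i : Fin m, B) (Finset.measurable_prod _ fun i _ =>
      hm.comp ((hp i).fst.prodMk (hp (σ i)).snd)).aestronglyMeasurable
      (Filter.Eventually.of_forall fun p => ?_)
    rw [norm_prod]
    exact Finset.prod_le_prod (fun _ _ => norm_nonneg _) fun _ _ => hB _ _
  have hsum := hasSum_sum (s := (Finset.univ : Finset (Equiv.Perm (Fin m))))
    fun σ _ => (key σ).mul_left ((Equiv.Perm.sign σ : ℤ) : ℂ)
  have hlim : ∫ p : Fin m → β × β, (∏ a, w (p a)) * det (of fun a b => Ω (p b).1 (p a).2)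
        ∂(Measure.pi fun _ => μ) =
      ∑ σ : Equiv.Perm (Fin m), ((Equiv.Perm.sign σ : ℤ) : ℂ) *
          ∫ p : Fin m → β × β, (∏ a, w (p a)) *
        ∏ i, Ω (p i).1 (p (σ i)).2 ∂(Measure.pi fun _ => μ) := by
    simp only [det_apply', of_apply, Finset.mul_sum, mul_left_comm (∏ a, w _)]
    exact (integral_finsetSum _ fun σ _ => (hint σ).const_mul _).trans
      (Finset.sum_congr rfl fun σ _ => integral_const_mul _ _)
  rw [hlim]
  simpa only [det_apply', of_apply] using hsum

end InfiniteDet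

namespace SkewMeasure

variable {E : EllCurve} (ζ : SkewMeasure E)

theorem C_apply (n : ℤ) (x : ℕ+ → ℂ) (i j : ℤ) :
    ζ.C n x i j = ∫ p, ζ.waveDensity n x p * (p.1 ^ i * p.2 ^ j) ∂ζ.μ := by
  rw [C, Matrix.of_apply]
  refine integral_congr_ae ?_
  filter_upwards [ζ.carried, ζ.density_ae_eq] with p hp hd
  simp only [waveDensity, EllCurve.wave, Set.indicator_of_mem (ζ.mem_region hp.1),
    Set.indicator_of_mem (ζ.mem_region hp.2), hd]
  ring

theorem ne_zero_of_mem {κ : ℂ} (hκ : κ ∈ ζ.S) : κ ≠ 0 := by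
  rintro rfl
  exact (ζ.not_pole 0 hκ).1 (zero_mem _)

variable {ζ}

namespace IsKernelMatrix

variable {Ω : Matrix ℤ ℤ ℂ} (hΩ : ζ.IsKernelMatrix Ω)

include hΩ

theorem summable_row {κ : ℂ} (hκ : κ ∈ ζ.S) (i : ℤ) : Summable fun l => Ω i l * κ ^ l := by
  obtain ⟨⟨b, hb, hle⟩, -⟩ := hΩ
  have h0 : κ ^ i ≠ 0 := zpow_ne_zero _ (ζ.ne_zero_of_mem hκ)
  refine (summable_mul_left_iff h0).1 ?_
  refine Summable.of_norm_bounded (hb.comp_injective (Prod.mk_right_injective i)) fun l => ?_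
  rw [← mul_assoc]
  exact hle κ hκ κ hκ (i, l)

theorem aestronglyMeasurable_row (i : ℤ) :
    AEStronglyMeasurable (fun p : ℂ × ℂ => ∑' l, Ω i l * p.1 ^ l) ζ.μ := by
  refine aestronglyMeasurable_of_tendsto_ae Filter.atTop
    (f := fun (s : Finset ℤ) (p : ℂ × ℂ) => ∑ l ∈ s, Ω i l * p.1 ^ l) (fun s => ?_) ?_
  · exact (Finset.measurable_sum _ fun l _ =>
      (measurable_fst.pow_const l).const_mul _).aestronglyMeasurable
  · filter_upwards [ζ.carried] with p hp
    exact (hΩ.summable_row hp.1 i).hasSum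

theorem exists_norm_zpow_le {i l : ℤ} (hil : Ω i l ≠ 0) :
    ∃ D : ℝ, ∀ κ ∈ ζ.S, ‖κ ^ i‖ ≤ D := by
  obtain ⟨⟨b, -, hle⟩, -⟩ := hΩ
  rcases ζ.S.eq_empty_or_nonempty with hS | ⟨κ₀, hκ₀⟩
  · exact ⟨0, fun κ hκ => by simp [hS] at hκ⟩
  · have h0 : 0 < ‖Ω i l * κ₀ ^ l‖ :=
      norm_pos_iff.2 (mul_ne_zero hil (zpow_ne_zero _ (ζ.ne_zero_of_mem hκ₀)))
    refine ⟨b (i, l) / ‖Ω i l * κ₀ ^ l‖, fun κ hκ => ?_⟩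
    rw [le_div_iff₀ h0, ← norm_mul, ← mul_assoc]
    exact hle κ₀ hκ₀ κ hκ (i, l)

theorem infMul_C_apply (n : ℤ) {x : ℕ+ → ℂ} (hx : x ∈ ζ.times) (i : ℤ) {j l : ℤ}
    (hj : Ω j l ≠ 0) : infMul Ω (ζ.C n x) i j =
      ∫ p, ζ.waveDensity n x p * ((∑' l, Ω i l * p.1 ^ l) * p.2 ^ j) ∂ζ.μ := by
  obtain ⟨D, hD⟩ := hΩ.exists_norm_zpow_le hj
  have hw := ζ.integrable_waveDensity n hx
  have hrow := fun κ (hκ : κ ∈ ζ.S) => hΩ.summable_row hκ i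
  obtain ⟨⟨b, hb, hle⟩, -⟩ := hΩ
  rcases ζ.S.eq_empty_or_nonempty with hS | ⟨κ₀, hκ₀⟩
  · have hμ : ∀ f : ℂ × ℂ → ℂ, ∫ p, f p ∂ζ.μ = 0 := fun f => integral_eq_zero_of_ae (by
      filter_upwards [ζ.carried] with p hp
      simp [hS] at hp)
    simp [infMul, C, hμ]
  have h0 : 0 < ‖κ₀ ^ i‖ := norm_pos_iff.2 (zpow_ne_zero _ (ζ.ne_zero_of_mem hκ₀))
  have hbd : ∀ l, ∀ κ ∈ ζ.S, ‖Ω i l * κ ^ l‖ ≤ b (i, l) / ‖κ₀ ^ i‖ := fun l κ hκ => by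
    rw [le_div_iff₀' h0, ← norm_mul, ← mul_assoc]
    exact hle κ hκ κ₀ hκ₀ (i, l)
  have hbi : Summable fun l => b (i, l) / ‖κ₀ ^ i‖ :=
    (hb.comp_injective (Prod.mk_right_injective i)).div_const _
  have e : ∀ l, Ω i l * ζ.C n x l j =
      ∫ p, ζ.waveDensity n x p * (Ω i l * p.1 ^ l * p.2 ^ j) ∂ζ.μ := fun l => by
    rw [C_apply, ← integral_const_mul]
    refine integral_congr_ae (Filter.Eventually.of_forall fun p => ?_)
    simp only
    ring
  rw [infMul, Matrix.of_apply]
  simp only [e]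
  refine HasSum.tsum_eq (hasSum_integral_of_dominated_convergence
    (fun l p => ‖ζ.waveDensity n x p‖ * (b (i, l) / ‖κ₀ ^ i‖ * D)) (fun l => ?_) (fun l => ?_)
      ?_ ?_ ?_)
  · exact hw.aestronglyMeasurable.mul (((measurable_fst.pow_const l).const_mul _).mul
      (measurable_snd.pow_const j)).aestronglyMeasurable
  · filter_upwards [ζ.carried] with p hp
    rw [norm_mul, norm_mul]
    exact mul_le_mul_of_nonneg_left (mul_le_mul (hbd l _ hp.1) (hD _ hp.2) (norm_nonneg _)
      ((norm_nonneg _).trans (hbd l _ hp.1))) (norm_nonneg _)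
  · exact Filter.Eventually.of_forall fun p => (hbi.mul_right _).mul_left _
  · simp only [tsum_mul_left]
    exact hw.norm.mul_const _
  · filter_upwards [ζ.carried] with p hp
    exact ((hrow _ hp.1).hasSum.mul_right _).mul_left _

theorem hasSum_principalMinor (n : ℤ) {x : ℕ+ → ℂ} (hx : x ∈ ζ.times) (m : ℕ) :
    HasSum (fun s : {s : Finset ℤ // s.card = m} =>
      principalMinor (infMul Ω (ζ.C n x)) s.1) (ζ.detTerm n x m) := by
  refine _root_.hasSum_principalMinor ?_
  rw [ζ.detTerm_eq, mul_inv_cancel_left₀ (Nat.cast_ne_zero.2 m.factorial_ne_zero)]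
  have hrow := fun κ (hκ : κ ∈ ζ.S) i => hΩ.summable_row hκ i
  obtain ⟨⟨b, hb, hle⟩, hsum⟩ := id hΩ
  have hterm : ∀ a ∈ ζ.S, ∀ c ∈ ζ.S, ∀ i,
      HasSum (fun l => c ^ i * Ω i l * a ^ l) (c ^ i * ∑' l, Ω i l * a ^ l) := by
    intro a ha c hc i
    simpa only [mul_assoc] using (hrow a ha i).hasSum.mul_left (c ^ i)
  have h := hasSum_det_integral ζ.carried (ζ.integrable_waveDensity n hx) (ι := ℤ)
    (u := fun i κ => κ ^ i) (v := fun i κ => ∑' l, Ω i l * κ ^ l)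
    (fun i => (measurable_snd.pow_const i).aestronglyMeasurable) hΩ.aestronglyMeasurable_row
    (c := fun i => ∑' l, b (i, l)) hb.prod
    (fun a ha c hc i => by
      rw [← (hterm a ha c hc i).tsum_eq]
      exact tsum_of_norm_bounded (hb.prod_factor i).hasSum fun l => hle a ha c hc (i, l))
    ζ.measurable_cutKernel ζ.norm_cutKernel_le
    (fun a ha c hc => by
      rw [ζ.cutKernel_eq ha hc]
      exact (hsum a ha c hc).prod_fiberwise fun i => hterm a ha c hc i) m
  have hcongr : ∀ {X Y : (Fin m → ℤ) → ℂ} {d : ℂ}, (∀ f, X f = Y f) → HasSum Y d → HasSum X d :=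
    fun h hY => by rwa [funext h]
  refine hcongr (fun f => ?_) h
  by_cases hf : ∀ a, ∃ l, Ω (f a) l ≠ 0
  · congr 2
    ext a b
    obtain ⟨l, hl⟩ := hf b
    exact hΩ.infMul_C_apply n hx (f a) hl
  · push Not at hf
    obtain ⟨a, ha⟩ := hf
    rw [Matrix.det_eq_zero_of_row_eq_zero a fun b => by simp [infMul, ha],
      Matrix.det_eq_zero_of_row_eq_zero a fun b => by simp [ha]]

end IsKernelMatrix

end SkewMeasure

theorem mainTheorem2 (E : EllCurve) (ζ : SkewMeasure E) :
    -- the terms `detTerm` are those of the formal expansion of the infinite determinant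
    (∀ Ω : Matrix ℤ ℤ ℂ, ζ.IsKernelMatrix Ω → ∀ n : ℤ, ∀ x ∈ ζ.times, ∀ m : ℕ,
      HasSum (fun s : {s : Finset ℤ // s.card = m} =>
        principalMinor (infMul Ω (ζ.C n x)) s.1) (ζ.detTerm n x m)) ∧
    -- the `τ`-function exists
    (∃ τ : ℤ → (ℕ+ → ℂ) → ℂ, ζ.IsTau τ) ∧
    -- it is unique, holomorphic in `x₁, x₂, x₃`, and satisfies the bilinear equations
    (∀ τ : ℤ → (ℕ+ → ℂ) → ℂ, ζ.IsTau τ →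
      (∀ τ' : ℤ → (ℕ+ → ℂ) → ℂ, ζ.IsTau τ' → ∀ n : ℤ, ∀ x ∈ ζ.times, τ' n x = τ n x) ∧
      ∀ n : ℤ, ∀ x ∈ ζ.times,
        Differentiable ℂ (fun t : ℂ × ℂ × ℂ =>
          τ n (Function.update (Function.update (Function.update x 1 t.1) 2 t.2.1) 3 t.2.2)) ∧
        (hirotaD 1 (hirotaD 1 (hirotaD 1 (hirotaD 1 (dot (τ n) (τ n))))) x x
            - 4 * hirotaD 1 (hirotaD 3 (dot (τ n) (τ n))) x x
            + 3 * hirotaD 2 (hirotaD 2 (dot (τ n) (τ n))) x x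
          = 24 * E.g * (τ (n + 1) x * τ (n - 1) x - τ n x ^ 2)) ∧
        (hirotaD 1 (hirotaD 1 (hirotaD 1 (dot (τ (n + 1)) (τ n)))) x x
            + 2 * hirotaD 3 (dot (τ (n + 1)) (τ n)) x x
            - 3 * hirotaD 1 (hirotaD 2 (dot (τ (n + 1)) (τ n))) x x
            - 18 * E.e * hirotaD 1 (dot (τ (n + 1)) (τ n)) x x
          = 0) ∧
        (hirotaD 1 (hirotaD 1 (hirotaD 1 (dot (τ (n - 1)) (τ n)))) x x
            + 2 * hirotaD 3 (dot (τ (n - 1)) (τ n)) x x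
            + 3 * hirotaD 1 (hirotaD 2 (dot (τ (n - 1)) (τ n))) x x
            - 18 * E.e * hirotaD 1 (dot (τ (n - 1)) (τ n)) x x
          = 0)) := by
  refine ⟨fun Ω hΩ n x hx m => hΩ.hasSum_principalMinor n hx m, ⟨ζ.tau, ζ.isTau_tau⟩,
    fun τ h => ⟨fun τ' h' n x hx => h.unique h' n hx, fun n x hx =>
      ⟨SkewMeasure.differentiable_tau h n hx, SkewMeasure.bilinear_first h n hx,
        SkewMeasure.bilinear_second h n hx, SkewMeasure.bilinear_third h n hx⟩⟩⟩
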